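/- Let $K$ be any field, $x=(x_1,\dots,x_n)$, and for a polynomial map $H=(H_1,\dots,H_m)\in K[x]^m$ let $\mathcal J H=(\partial H_i/\partial x_j)_{i,j}$ be its Jacobian matrix, whose rank $\operatorname{rk}\mathcal J H$ is taken over $K(x)$. Call $H$ quadratic homogeneous if each $H_i$ is zero or homogeneous of degree $2$. **Theorem.** Let $H\in K[x]^m$ be quadratic homogeneous with $\operatorname{rk}\mathcal J H=3$. Then there are $S\in\operatorname{GL}_m(K)$ and $T\in\operatorname{GL}_n(K)$ such that for $\tilde H:=S\,H(Tx)$ one of the following holds: 1. only the first $3$ rows of $\mathcal J\tilde H$ may be nonzero; 2. $\operatorname{char}K\neq2$, only the first $4$ rows of $\mathcal J\tilde H$ may be nonzero, and $(\tilde H_1,\tilde H_2,\tilde H_3,\tilde H_4)=(\tilde H_1,\tfrac12x_1^2,\,x_1x_2,\,\tfrac12x_2^2)$; 3. $\operatorname{char}K=2$, only the first $4$ rows of $\mathcal J\tilde H$ may be nonzero, and $\mathcal J(\tilde H_1,\tilde H_2,\tilde H_3,\tilde H_4)=\mathcal J(\tilde H_1,\,x_1x_2,\,x_1x_3,\,x_2x_3)$;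 4. only the first $6$ rows of $\mathcal J\tilde H$ may be nonzero, and either $\operatorname{char}K\ne2$ and exactly the first $3$ columns of $\mathcal J\tilde H$ are nonzero, or $\operatorname{char}K=2$ and exactly the first $4$ columns of $\mathcal J\tilde H$ are nonzero; 5. $\operatorname{char}K\neq2$, only the first $4$ rows of $\mathcal J\tilde H$ may be nonzero, and for some nonzero $c\in K$ $$(\tilde H_1,\tilde H_2,\tilde H_3,\tilde H_4)=\bigl(x_1x_3+c\,x_2x_4,\; x_2x_3-x_1x_4,\; \tfrac12x_3^2+\tfrac c2x_4^2,\; \tfrac12x_1^2+\tfrac c2x_2^2\bigr).$$ Conversely, let $\tilde H\in K[x]^m$ be any quadratic homogeneous map satisfying (1), (2), (3), (5), or the following weaker form of (4): $\operatorname{char}K\ne2$ and only the first $3$ columns of $\mathcal J\tilde H$ may be nonzero, or $\operatorname{char}K=2$ and only the first $4$ columns of $\mathcal J\tilde H$ may be nonzero. Then $\operatorname{rk}\mathcal J\tilde H\le3$. Cases (2), (3), (5) include that $m\ge4$ and that $n\ge2$, $n\ge3$, $n\ge4$, respectively. -/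

import Mathlib

namespace PolyMap

open MvPolynomial

/-- A polynomial map `H = (H_1, …, H_m)` in `n` variables over `K`, that is, an element of
`K[x]^m` with `x = (x_1, …, x_n)`. Indices are zero-based, so `x_1` is `X 0` and `H_1` is
`H 0`. -/
abbrev Map (K : Type*) [Field K] (m n : ℕ) : Type _ :=
  Fin m → MvPolynomial (Fin n) K

/-- Every component is zero or homogeneous of degree 2. -/
def IsQuadraticHomogeneous {K : Type*} [Field K] {m n : ℕ} (H : Map K m n) : Prop :=
  ∀ i, (H i).IsHomogeneous 2

/-- The Jacobian matrix, with entry `∂ H_i / ∂ x_j` in row `i` and column `j`. -/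
noncomputable def jacobian {K : Type*} [Field K] {m n : ℕ} (H : Map K m n) :
    Matrix (Fin m) (Fin n) (MvPolynomial (Fin n) K) :=
  Matrix.of fun i j => pderiv j (H i)

/-- The rank of the Jacobian matrix over the field `K(x)` of rational functions. -/
noncomputable def jacobianRank {K : Type*} [Field K] {m n : ℕ} (H : Map K m n) : ℕ :=
  ((jacobian H).map
    (algebraMap (MvPolynomial (Fin n) K) (FractionRing (MvPolynomial (Fin n) K)))).rank

/-- The polynomial `f(Tx)`. -/
noncomputable def substLinear {K : Type*} [Field K] {n : ℕ} (T : Matrix (Fin n) (Fin n) K)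
    (f : MvPolynomial (Fin n) K) : MvPolynomial (Fin n) K :=
  aeval (fun j => ∑ l, C (T j l) * X l) f

/-- The map `S H(Tx)`. -/
noncomputable def transform {K : Type*} [Field K] {m n : ℕ} (S : Matrix (Fin m) (Fin m) K)
    (T : Matrix (Fin n) (Fin n) K) (H : Map K m n) : Map K m n :=
  fun i => ∑ k, C (S i k) * substLinear T (H k)

/-- Only the first `k` rows of the Jacobian matrix may be nonzero. -/
def OnlyFirstRows {K : Type*} [Field K] {m n : ℕ} (k : ℕ) (H : Map K m n) : Prop :=
  ∀ i : Fin m, k ≤ (i : ℕ) → (jacobian H).row i = 0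

/-- Only the first `k` columns of the Jacobian matrix may be nonzero. -/
def OnlyFirstCols {K : Type*} [Field K] {m n : ℕ} (k : ℕ) (H : Map K m n) : Prop :=
  ∀ j : Fin n, k ≤ (j : ℕ) → (jacobian H).col j = 0

/-- The first `k` columns of the Jacobian matrix are nonzero. -/
def FirstColsNonzero {K : Type*} [Field K] {m n : ℕ} (k : ℕ) (H : Map K m n) : Prop :=
  ∀ j : Fin n, (j : ℕ) < k → (jacobian H).col j ≠ 0

/-- Only the first three rows of the Jacobian matrix may be nonzero. -/
def ThreeRows {K : Type*} [Field K] {m n : ℕ} (H : Map K m n) : Prop :=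
  OnlyFirstRows 3 H

/-- `(H_1, H_2, H_3, H_4) = (H_1, x_1²/2, x_1 x_2, x_2²/2)`, characteristic not 2, only the
first four rows of the Jacobian matrix may be nonzero. -/
def FourRowsBinary {K : Type*} [Field K] {m n : ℕ} (H : Map K m n) : Prop :=
  ringChar K ≠ 2 ∧ OnlyFirstRows 4 H ∧
    ∃ (hm : 4 ≤ m) (hn : 2 ≤ n),
      let x : Fin 2 → MvPolynomial (Fin n) K := fun i => X (Fin.castLE hn i)
      (fun i : Fin 4 => H (Fin.castLE hm i)) =
        ![H (Fin.castLE hm 0), C (1 / 2) * x 0 ^ 2, x 0 * x 1, C (1 / 2) * x 1 ^ 2]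

/-- `J(H_1, H_2, H_3, H_4) = J(H_1, x_1 x_2, x_1 x_3, x_2 x_3)`, characteristic 2, only the
first four rows of the Jacobian matrix may be nonzero. -/
def FourRowsCharTwo {K : Type*} [Field K] {m n : ℕ} (H : Map K m n) : Prop :=
  ringChar K = 2 ∧ OnlyFirstRows 4 H ∧
    ∃ (hm : 4 ≤ m) (hn : 3 ≤ n),
      let x : Fin 3 → MvPolynomial (Fin n) K := fun i => X (Fin.castLE hn i)
      jacobian (fun i : Fin 4 => H (Fin.castLE hm i)) =
        jacobian ![H (Fin.castLE hm 0), x 0 * x 1, x 0 * x 2, x 1 * x 2]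

/-- Characteristic not 2, only the first `r` columns of the Jacobian matrix may be nonzero. -/
def FewCols {K : Type*} [Field K] {m n : ℕ} (r : ℕ) (H : Map K m n) : Prop :=
  ringChar K ≠ 2 ∧ OnlyFirstCols r H

/-- Characteristic 2, only the first `r + 1` columns of the Jacobian matrix may be nonzero. -/
def FewColsCharTwo {K : Type*} [Field K] {m n : ℕ} (r : ℕ) (H : Map K m n) : Prop :=
  ringChar K = 2 ∧ OnlyFirstCols (r + 1) H

/-- The exceptional form with parameter `c ≠ 0`: `(H_1, H_2, H_3, H_4)` equals
`(x_1 x_3 + c x_2 x_4, x_2 x_3 - x_1 x_4, x_3²/2 + (c/2) x_4², x_1²/2 + (c/2) x_2²)`,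
characteristic not 2, only the first four rows of the Jacobian matrix may be nonzero. -/
def Exceptional {K : Type*} [Field K] {m n : ℕ} (H : Map K m n) : Prop :=
  ringChar K ≠ 2 ∧ OnlyFirstRows 4 H ∧
    ∃ (hm : 4 ≤ m) (hn : 4 ≤ n) (c : K), c ≠ 0 ∧
      let x : Fin 4 → MvPolynomial (Fin n) K := fun i => X (Fin.castLE hn i)
      (fun i : Fin 4 => H (Fin.castLE hm i)) =
        ![x 0 * x 2 + C c * x 1 * x 3,
          x 1 * x 2 - x 0 * x 3,
          C (1 / 2) * x 2 ^ 2 + C (c / 2) * x 3 ^ 2,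
          C (1 / 2) * x 0 ^ 2 + C (c / 2) * x 1 ^ 2]

end PolyMap

open PolyMap

/-! ### Frames adapted to a vector `e`, and pointwise identities valid over small fields -/

namespace PolyMap

open Module

/-! The Jacobian of a quadratic homogeneous map is linear in x, so it amounts to the bilinear map
B(x, y) = JH(x)y (`polar`), which is symmetric, and alternating in characteristic 2. The theorem
thus classifies such B with B(x, ·) of generic rank 3, up to coordinates in source and target. Two
outcomes are mere dimensions: the values of B span at most 3 dimensions (`ThreeRows`), or B factors
through a quotient of V of dimension 3, or 4 if alternating. In the latter case six rows suffice,
because Sym² of a 3-space and Λ² of a 4-space have dimension 6.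

Fix e with B(e, ·) of rank 3 and let N be the kernel of B(e, ·). Expanding a 4 × 4 minor at Te + x
in powers of T (`Frame.kills`) shows that a functional ω vanishing on B(e, V) satisfies ω(B(x, y)) =
0 for y in N, together with a second relation that constrains B(x, y) itself. So ω ∘ B is a form on
the 3-space V/N. If all these forms are zero, the values of B lie in B(e, V). If two of them are not
proportional, the relations force N to be the radical of B, or the radical plus the line of e in the
alternating case, and few columns remain. Otherwise there is one form q = ω₀ ∘ B up to scalars. In
the alternating case q = ℓ₀ ∧ ℓ₁, and one more minor yields few columns or the wedge form
(`alternating_classification`). In the symmetric case e is in the radical of q and q diagonalizes to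
a² + cb²; beside few columns, c = 0 yields the binary form and c ≠ 0 the exceptional one
(`symmetric_classification`).

Since K may be finite, a K-point e of rank 3 is not evident. The minors are therefore tested over F
= K(x), and the classification is applied first over F at the generic point. The dimension outcomes
descend because matrix ranks are unchanged by field extension. Each remaining normal form over F has
rank 3 on a locus explicit enough to contain a K-point, where the classification is applied again,
now over K.

Conversely, each normal form carries a visible dependence. In the exceptional form, with δ² = -c,
the first two components are the parts of (x₁ + δx₂)(x₃ - δx₄), and multiplicativity of the norm
gives H₁² + cH₂² = 4H₃H₄. Four columns in characteristic 2 are dependent by Euler's identity. -/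

theorem coeffs_eq_zero_of_forall {F : Type*} [Field F] [Infinite F] {c₀ c₁ c₂ c₃ c₄ : F}
    (h : ∀ s : F, c₀ + c₁ * s + c₂ * s ^ 2 + c₃ * s ^ 3 + c₄ * s ^ 4 = 0) :
    c₀ = 0 ∧ c₁ = 0 ∧ c₂ = 0 ∧ c₃ = 0 ∧ c₄ = 0 := by
  have hp : (Polynomial.C c₀ + Polynomial.C c₁ * Polynomial.X + Polynomial.C c₂ * Polynomial.X ^ 2
      + Polynomial.C c₃ * Polynomial.X ^ 3 + Polynomial.C c₄ * Polynomial.X ^ 4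
      : Polynomial F) = 0 := by
    apply Polynomial.funext
    intro s
    simpa using h s
  have key := fun k => congrArg (fun p => Polynomial.coeff p k) hp
  simp only [Polynomial.coeff_add, Polynomial.coeff_C_mul, Polynomial.coeff_C,
    Polynomial.coeff_X_pow, Polynomial.coeff_X, Polynomial.coeff_zero] at key
  refine ⟨?_, ?_, ?_, ?_, ?_⟩
  · simpa using key 0
  · simpa using key 1
  · simpa using key 2
  · simpa using key 3
  · simpa using key 4

theorem det_fin_four {R : Type*} [CommRing R] (M : Matrix (Fin 4) (Fin 4) R) :
    M.det =
      M 0 0 * (M 1 1 * (M 2 2 * M 3 3 - M 2 3 * M 3 2) - M 1 2 * (M 2 1 * M 3 3 - M 2 3 * M 3 1)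
        + M 1 3 * (M 2 1 * M 3 2 - M 2 2 * M 3 1))
      - M 0 1 * (M 1 0 * (M 2 2 * M 3 3 - M 2 3 * M 3 2) - M 1 2 * (M 2 0 * M 3 3 - M 2 3 * M 3 0)
        + M 1 3 * (M 2 0 * M 3 2 - M 2 2 * M 3 0))
      + M 0 2 * (M 1 0 * (M 2 1 * M 3 3 - M 2 3 * M 3 1) - M 1 1 * (M 2 0 * M 3 3 - M 2 3 * M 3 0)
        + M 1 3 * (M 2 0 * M 3 1 - M 2 1 * M 3 0))
      - M 0 3 * (M 1 0 * (M 2 1 * M 3 2 - M 2 2 * M 3 1) - M 1 1 * (M 2 0 * M 3 2 - M 2 2 * M 3 0)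
        + M 1 2 * (M 2 0 * M 3 1 - M 2 1 * M 3 0)) := by
  rw [Matrix.det_succ_row_zero]
  simp only [Fin.sum_univ_four, Matrix.det_fin_three, Matrix.submatrix_apply]
  have h1 : (1 : Fin 4).succAbove = ![0, 2, 3] := by decide
  have h2 : (2 : Fin 4).succAbove = ![0, 1, 3] := by decide
  have h3 : (3 : Fin 4).succAbove = ![0, 1, 2] := by decide
  have h4 : (0 : Fin 4).succAbove = ![1, 2, 3] := by decide
  have h5 : (Fin.succ : Fin 3 → Fin 4) = ![1, 2, 3] := by decide
  simp only [h1, h2, h3, h4, h5, Matrix.cons_val]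
  norm_num
  ring

/-- A vector space is not the union of two proper subspaces; this holds even over the field with two
elements. -/
theorem functional_mul_eq_zero {K V : Type*} [Field K] [AddCommGroup V] [Module K V]
    {g l : Dual K V} (h : ∀ x, g x * l x = 0) (hl : l ≠ 0) : g = 0 := by
  obtain ⟨s, hs⟩ : ∃ s, l s ≠ 0 := by
    by_contra hc
    push Not at hc
    exact hl (LinearMap.ext hc)
  have hgs : g s = 0 := (mul_eq_zero.1 (h s)).resolve_right hs
  ext x
  rcases mul_eq_zero.1 (h x) with hx | hx
  · simpa using hx
  · have := h (x + s)
    simp only [map_add, hgs, hx, add_zero, zero_add] at this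
    simpa using (mul_eq_zero.1 this).resolve_right hs

/-- The span of all values of a bilinear map. -/
def imageSpan {K V W : Type*} [Field K] [AddCommGroup V] [Module K V] [AddCommGroup W]
    [Module K W] (B : V →ₗ[K] V →ₗ[K] W) : Submodule K W :=
  Submodule.span K {w | ∃ x y, B x y = w}

/-- Functionals that separate the points of the span of all values of a bilinear map. -/
def Separates {K V W ι : Type*} [Field K] [AddCommGroup V] [Module K V] [AddCommGroup W]
    [Module K W] (B : V →ₗ[K] V →ₗ[K] W) (ω : ι → Dual K W) : Prop :=
  ∀ w ∈ imageSpan B, (∀ i, ω i w = 0) → w = 0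

/-- All `4 × 4` minors of the matrix `B(x, ·)` vanish at all points `x` of `F ⊗ V`. -/
def MinorsVanish {K V W : Type*} [Field K] [AddCommGroup V] [Module K V] [AddCommGroup W]
    [Module K W] (F : Type*) [Field F] [Algebra K F] (B : V →ₗ[K] V →ₗ[K] W) : Prop :=
  ∀ (ω : Fin 4 → Dual K W) (v : Fin 4 → V) (k : ℕ) (x : Fin k → V) (c : Fin k → F),
    (Matrix.of fun i j => ∑ l, c l * algebraMap K F (ω i (B (x l) (v j)))).det = 0

/-- Three vectors whose images under `B(e, ·)` form a basis of the range, with dual functionals. -/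
structure Frame {K V W : Type*} [Field K] [AddCommGroup V] [Module K V] [AddCommGroup W]
    [Module K W] (B : V →ₗ[K] V →ₗ[K] W) (e : V) where
  v : Fin 3 → V
  ω : Fin 3 → Dual K W
  dual : ∀ i j, ω i (B e (v j)) = if i = j then 1 else 0
  expand : ∀ x, B e x = ∑ i, ω i (B e x) • B e (v i)

section

variable {K V W : Type*} [Field K] [AddCommGroup V] [Module K V] [AddCommGroup W] [Module K W]
  {B : V →ₗ[K] V →ₗ[K] W} {e : V}

theorem exists_frame_of_linearIndependent (hr : finrank K (LinearMap.range (B e)) = 3)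
    {vv : Fin 3 → V} (hli : LinearIndependent K fun i => B e (vv i)) :
    ∃ f : Frame B e, f.v = vv := by
  have : FiniteDimensional K (LinearMap.range (B e)) :=
    FiniteDimensional.of_finrank_pos (by omega)
  have hdual : ∀ i : Fin 3, ∃ g : Dual K W, ∀ j, g (B e (vv j)) = if i = j then 1 else 0 :=
    fun i => by
      obtain ⟨g, hg⟩ := LinearMap.exists_extend ((Basis.span hli).coord i)
      refine ⟨g, fun j => ?_⟩
      have h1 : g (Basis.span hli j : W) = (Basis.span hli).coord i (Basis.span hli j) := by
        rw [← hg]; rfl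
      have h2 : (Basis.span hli j : W) = B e (vv j) :=
        congrArg Subtype.val (Basis.span_apply hli j)
      rw [h2, Basis.coord_apply, Basis.repr_self, Finsupp.single_apply] at h1
      simpa [eq_comm] using h1
  choose ω hω using hdual
  have heq : Submodule.span K (Set.range fun i => B e (vv i)) = LinearMap.range (B e) := by
    refine Submodule.eq_of_le_of_finrank_eq ?_ ?_
    · rw [Submodule.span_le]
      rintro _ ⟨i, rfl⟩
      exact ⟨_, rfl⟩
    · rw [finrank_span_eq_card hli, hr]; simp
  refine ⟨⟨vv, ω, hω, fun x => ?_⟩, rfl⟩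
  have hx' : B e x ∈ Submodule.span K (Set.range fun i => B e (vv i)) := by
    rw [heq]; exact ⟨x, rfl⟩
  obtain ⟨c, hc⟩ := (Submodule.mem_span_range_iff_exists_fun K).1 hx'
  have hωc : ∀ i, ω i (B e x) = c i := fun i => by
    rw [← hc]; simp [hω]
  simp only [hωc, hc]

theorem nonempty_frame (hr : finrank K (LinearMap.range (B e)) = 3) : Nonempty (Frame B e) := by
  have : FiniteDimensional K (LinearMap.range (B e)) :=
    FiniteDimensional.of_finrank_pos (by omega)
  let b := finBasisOfFinrankEq K (LinearMap.range (B e)) hr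
  choose vv hvv using fun i => (b i).2
  have hli : LinearIndependent K fun i => B e (vv i) := by
    simp only [hvv]
    exact b.linearIndependent.map' (Submodule.subtype _) (Submodule.ker_subtype _)
  obtain ⟨f, -⟩ := exists_frame_of_linearIndependent hr hli
  exact ⟨f⟩

/-- `P` is a normalization of the third vector that is reachable by adding multiples of `x₁` and
`x₂`; such a change does not affect independence of its image modulo `B e x₁` and `B e x₂`. -/
theorem exists_frame (hr : finrank K (LinearMap.range (B e)) = 3) {x₁ x₂ : V}
    (hx : LinearIndependent K ![B e x₁, B e x₂]) (P : V → Prop)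
    (hP : ∀ v, ∃ α β : K, P (v + α • x₁ + β • x₂)) :
    ∃ f : Frame B e, f.v 0 = x₁ ∧ f.v 1 = x₂ ∧ P (f.v 2) := by
  obtain ⟨v, hv⟩ : ∃ v, B e v ∉ Submodule.span K (Set.range ![B e x₁, B e x₂]) := by
    by_contra hc
    push Not at hc
    have h1 : LinearMap.range (B e) ≤ Submodule.span K (Set.range ![B e x₁, B e x₂]) := by
      rintro _ ⟨v, rfl⟩
      exact hc v
    have : FiniteDimensional K (Submodule.span K (Set.range ![B e x₁, B e x₂])) :=
      FiniteDimensional.span_of_finite K (Set.finite_range _)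
    have h2 := Submodule.finrank_mono h1
    have h3 := finrank_span_eq_card hx
    simp only [Fintype.card_fin] at h3
    omega
  obtain ⟨α, β, hαβ⟩ := hP v
  set u : V := v + α • x₁ + β • x₂ with hu
  have hu' : B e u ∉ Submodule.span K (Set.range ![B e x₁, B e x₂]) := by
    intro hmem
    apply hv
    have : B e v = B e u - (α • B e x₁ + β • B e x₂) := by
      rw [hu]; simp only [map_add, map_smul]; abel
    rw [this]
    refine Submodule.sub_mem _ hmem (Submodule.add_mem _ ?_ ?_)
    · exact Submodule.smul_mem _ _ (Submodule.subset_span ⟨0, rfl⟩)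
    · exact Submodule.smul_mem _ _ (Submodule.subset_span ⟨1, rfl⟩)
  have hli : LinearIndependent K (Fin.snoc ![B e x₁, B e x₂] (B e u) : Fin 3 → W) :=
    linearIndependent_finSnoc.2 ⟨hx, hu'⟩
  have hli' : LinearIndependent K (fun i => B e ((![x₁, x₂, u] : Fin 3 → V) i)) := by
    convert hli using 1
    funext i
    fin_cases i <;> rfl
  obtain ⟨f, hf⟩ := exists_frame_of_linearIndependent hr hli'
  refine ⟨f, ?_, ?_, ?_⟩ <;> rw [hf]
  exacts [rfl, rfl, hαβ]

theorem linearIndependent_of_dual_vectors {ι : Type*} [Fintype ι] [DecidableEq ι]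
    {l : ι → Dual K V} {u : ι → V} (h : ∀ i j, l i (u j) = if i = j then 1 else 0) :
    LinearIndependent K l := by
  rw [Fintype.linearIndependent_iff]
  intro c hc j
  have := LinearMap.congr_fun hc (u j)
  simpa [LinearMap.sum_apply, h] using this

/-- At every point `(g₀, g₁)` is parallel to `(a, b)`, and linearity makes the factor constant. Only
values at `K`-points are available, so the relation is tested at `u + w` and at `u` and `w` shifted
by the part of `x` killed by `a` and `b`. -/
theorem proportional_of_wedge {a b g₀ g₁ : Dual K V} {u w : V} (hau : a u = 1) (hbu : b u = 0)
    (haw : a w = 0) (hbw : b w = 1) (h : ∀ x, a x * g₁ x = b x * g₀ x) (x : V) :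
    g₀ x = g₀ u * a x ∧ g₁ x = g₀ u * b x := by
  have h1 : g₁ u = 0 := by simpa [hau, hbu] using h u
  have h2 : g₀ w = 0 := by simpa [haw, hbw] using (h w).symm
  have h3 : g₁ w = g₀ u := by simpa [hau, hbu, haw, hbw, h1, h2] using h (u + w)
  have h4 := h (u + (x - a x • u - b x • w))
  have h5 := h (w + (x - a x • u - b x • w))
  simp only [map_add, map_sub, map_smul, smul_eq_mul, hau, hbu, haw, hbw, h1, h2, h3] at h4 h5
  constructor
  · linear_combination -h5
  · linear_combination h4

end

end PolyMap

/-! ### Relations forced by the vanishing minors along a frame -/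

namespace PolyMap

open Module

section

variable {K V W : Type*} [Field K] [AddCommGroup V] [Module K V] [AddCommGroup W] [Module K W]
  {F : Type*} [Field F] [Algebra K F]
  {B : V →ₗ[K] V →ₗ[K] W} {e : V}

theorem MinorsVanish.det_eq_zero (hB : MinorsVanish F B) (ω : Fin 4 → Dual K W) (v : Fin 4 → V)
    (x : V) : (Matrix.of fun i j => ω i (B x (v j))).det = 0 := by
  apply (algebraMap K F).injective
  rw [map_zero, RingHom.map_det, ← hB ω v 1 ![x] ![1]]
  congr 1
  ext i j
  simp

/-- The coordinate functionals `ω_i(B(e, ·))` of a frame. -/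
def Frame.coord (f : Frame B e) (i : Fin 3) : Dual K V := f.ω i ∘ₗ B e

theorem Frame.coord_v (f : Frame B e) (i j : Fin 3) :
    f.coord i (f.v j) = if i = j then 1 else 0 := f.dual i j

theorem Frame.dual_self (f : Frame B e) (i : Fin 3) : f.ω i (B e (f.v i)) = 1 := by
  rw [f.dual, if_pos rfl]

theorem Frame.dual_ne (f : Frame B e) {i j : Fin 3} (h : i ≠ j) : f.ω i (B e (f.v j)) = 0 := by
  rw [f.dual, if_neg h]

theorem Frame.exists_decomposition (f : Frame B e) (x : V) :
    ∃ z, B e z = 0 ∧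
      x = f.coord 0 x • f.v 0 + f.coord 1 x • f.v 1 + f.coord 2 x • f.v 2 + z := by
  refine ⟨x - (f.coord 0 x • f.v 0 + f.coord 1 x • f.v 1 + f.coord 2 x • f.v 2), ?_, by abel⟩
  have h := f.expand x
  rw [Fin.sum_univ_three] at h
  simp only [map_sub, map_add, map_smul, Frame.coord, LinearMap.comp_apply]
  rw [sub_eq_zero]
  exact h

/-- With rows `f.ω 0`, `f.ω 1`, `f.ω 2`, `ω` and columns `f.v 0`, `f.v 1`, `f.v 2`, `y`, the matrix
of B(Te + x) has blocks T + A, b, c, d. Its determinant is T³d + T²(tr(A)d - c·b) + …, and the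
coefficients of T³ and T² vanish because `F` is infinite. -/
theorem Frame.kills [Infinite F] (f : Frame B e) (hB : MinorsVanish F B) {ω : Dual K W}
    (hω : ∀ z, ω (B e z) = 0) {y : V} (hy : B e y = 0) (x : V) :
    ω (B x y) = 0 ∧ ω (B x (f.v 0)) * f.ω 0 (B x y) + ω (B x (f.v 1)) * f.ω 1 (B x y)
      + ω (B x (f.v 2)) * f.ω 2 (B x y) = 0 := by
  set ι := algebraMap K F with hι
  have key := fun T : F => hB ![f.ω 0, f.ω 1, f.ω 2, ω] ![f.v 0, f.v 1, f.v 2, y] 2 ![e, x] ![T, 1]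
  have d01 := f.dual_ne (i := 0) (j := 1) (by decide)
  have d02 := f.dual_ne (i := 0) (j := 2) (by decide)
  have d10 := f.dual_ne (i := 1) (j := 0) (by decide)
  have d12 := f.dual_ne (i := 1) (j := 2) (by decide)
  have d20 := f.dual_ne (i := 2) (j := 0) (by decide)
  have d21 := f.dual_ne (i := 2) (j := 1) (by decide)
  simp only [det_fin_four, Matrix.of_apply, Fin.sum_univ_two, Matrix.cons_val, hω, hy, d01, d02,
    d10, d12, d20, d21, f.dual_self, ← hι, map_zero, map_one, mul_zero, mul_one, zero_add,
    one_mul] at key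
  generalize f.ω 0 (B x (f.v 0)) = a00 at *
  generalize f.ω 0 (B x (f.v 1)) = a01 at *
  generalize f.ω 0 (B x (f.v 2)) = a02 at *
  generalize f.ω 1 (B x (f.v 0)) = a10 at *
  generalize f.ω 1 (B x (f.v 1)) = a11 at *
  generalize f.ω 1 (B x (f.v 2)) = a12 at *
  generalize f.ω 2 (B x (f.v 0)) = a20 at *
  generalize f.ω 2 (B x (f.v 1)) = a21 at *
  generalize f.ω 2 (B x (f.v 2)) = a22 at *
  generalize f.ω 0 (B x y) = b0 at *
  generalize f.ω 1 (B x y) = b1 at *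
  generalize f.ω 2 (B x y) = b2 at *
  generalize ω (B x (f.v 0)) = c0 at *
  generalize ω (B x (f.v 1)) = c1 at *
  generalize ω (B x (f.v 2)) = c2 at *
  generalize ω (B x y) = d0 at *
  obtain ⟨-, -, h2, h3, -⟩ := coeffs_eq_zero_of_forall (F := F) (c₄ := 0) (c₃ := ι d0)
    (c₂ := ι ((a00 + a11 + a22) * d0 - (c0 * b0 + c1 * b1 + c2 * b2)))
    (c₁ := ι (d0 * (a00 * a11 - a01 * a10 + a00 * a22 - a02 * a20 + a11 * a22 - a12 * a21)
      - c0 * b0 * (a11 + a22) - c1 * b1 * (a00 + a22) - c2 * b2 * (a00 + a11)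
      + c0 * (a01 * b1 + a02 * b2) + c1 * (a10 * b0 + a12 * b2) + c2 * (a20 * b0 + a21 * b1)))
    (c₀ := ι (Matrix.det !![a00, a01, a02, b0; a10, a11, a12, b1; a20, a21, a22, b2;
      c0, c1, c2, d0]))
    (fun T => by
      simp only [det_fin_four, Matrix.of_apply, Matrix.cons_val, map_add, map_sub, map_mul]
      linear_combination key T)
  have hd : d0 = 0 := (map_eq_zero ι).1 h3
  refine ⟨hd, ?_⟩
  have := (map_eq_zero ι).1 h2
  rw [hd] at this
  linear_combination -this

/-- Functionals vanishing on `B(e, V)` vanish identically only if `B(e, V)` is everything. -/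
theorem finrank_imageSpan_le (hr : finrank K (LinearMap.range (B e)) = 3)
    (h : ∀ ω : Dual K W, (∀ z, ω (B e z) = 0) → ∀ x y, ω (B x y) = 0) :
    finrank K (imageSpan B) ≤ 3 := by
  have : FiniteDimensional K (LinearMap.range (B e)) :=
    FiniteDimensional.of_finrank_pos (by omega)
  rw [← hr]
  refine Submodule.finrank_mono ?_
  refine Submodule.span_le.2 ?_
  rintro _ ⟨x, y, rfl⟩
  by_contra hc
  obtain ⟨g, hg, hle⟩ := Submodule.exists_le_ker_of_notMem hc
  exact hg (h g (fun z => hle ⟨z, rfl⟩) x y)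

theorem finrank_range_eq [FiniteDimensional K V] (hr : finrank K (LinearMap.range (B e)) = 3)
    (h : ∀ y, B e y = 0 → B y = 0) (h' : ∀ y, B y = 0 → B e y = 0) :
    finrank K (LinearMap.range B) = 3 := by
  have hk : LinearMap.ker B = LinearMap.ker (B e) := by
    ext y; exact ⟨fun hy => h' y hy, fun hy => h y hy⟩
  have h1 := LinearMap.finrank_range_add_finrank_ker B
  have h2 := LinearMap.finrank_range_add_finrank_ker (B e)
  rw [hk] at h1
  omega

/-- Subtracting from any functional its expansion in the `f.ω i` leaves one that vanishes on B(e,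
V), so the two kinds together separate points. -/
theorem Frame.eq_zero (f : Frame B e) {w : W} (h : ∀ i, f.ω i w = 0)
    (h' : ∀ ω : Dual K W, (∀ z, ω (B e z) = 0) → ω w = 0) : w = 0 := by
  rw [← Module.forall_dual_apply_eq_zero_iff K]
  intro g
  have := h' (g - (g (B e (f.v 0)) • f.ω 0 + g (B e (f.v 1)) • f.ω 1
      + g (B e (f.v 2)) • f.ω 2)) (fun z => by
    have hz := congrArg g (f.expand z)
    simp only [Fin.sum_univ_three, map_add, map_smul, smul_eq_mul] at hz
    simp only [LinearMap.sub_apply, LinearMap.add_apply, LinearMap.smul_apply, smul_eq_mul]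
    rw [hz]; ring)
  simpa only [LinearMap.sub_apply, LinearMap.add_apply, LinearMap.smul_apply, smul_eq_mul,
    h, mul_zero, add_zero, sub_zero] using this

theorem Frame.separates (f : Frame B e) {ω₀ : Dual K W}
    (h : ∀ ω : Dual K W, (∀ z, ω (B e z) = 0) → ∃ κ : K, ∀ x y, ω (B x y) = κ * ω₀ (B x y))
    {w : W} (hw : w ∈ imageSpan B) (h₀ : ω₀ w = 0) (hf : ∀ i, f.ω i w = 0) : w = 0 := by
  refine f.eq_zero hf fun ω hω => ?_
  obtain ⟨κ, hκ⟩ := h ω hω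
  have hall : ω w = κ * ω₀ w := by
    refine Submodule.span_induction ?_ ?_ ?_ ?_ hw
    · rintro _ ⟨x, y, rfl⟩; exact hκ x y
    · simp
    · intro a b _ _ ha hb; rw [map_add, map_add, ha, hb]; ring
    · intro a b _ hb; rw [map_smul, map_smul, hb, smul_eq_mul, smul_eq_mul]; ring
  rw [hall, h₀, mul_zero]

end

end PolyMap

/-! ### Alternating bilinear maps -/

namespace PolyMap

open Module

/-- Three of four separating coordinates of `B` are `ℓ₀ ∧ ℓ₁`, `ℓ₀ ∧ ℓ₂`, `ℓ₁ ∧ ℓ₂`. -/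
def HasWedgeForm {K V W : Type*} [Field K] [AddCommGroup V] [Module K V] [AddCommGroup W]
    [Module K W] (B : V →ₗ[K] V →ₗ[K] W) : Prop :=
  ∃ (l : Fin 3 → Dual K V) (ω : Fin 4 → Dual K W), LinearIndependent K l ∧ Separates B ω ∧
    ∀ x y, ω 1 (B x y) = l 0 x * l 1 y - l 1 x * l 0 y ∧
      ω 2 (B x y) = l 0 x * l 2 y - l 2 x * l 0 y ∧
      ω 3 (B x y) = l 1 x * l 2 y - l 2 x * l 1 y

/-- The last two factors are nonzero polynomials in `s`, so over an infinite field the first one is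
the zero polynomial. -/
theorem linear_factor_eq_zero {F : Type*} [Field F] [Infinite F] {a b c p q r : F} (hp : p ≠ 0)
    (h : ∀ s : F, (a * s + b) * (s + c) * (p * s ^ 2 + q * s + r) = 0) : b = 0 := by
  obtain ⟨-, -, -, h3, h4⟩ := coeffs_eq_zero_of_forall (F := F)
    (c₀ := b * c * r) (c₁ := b * c * q + (a * c + b) * r)
    (c₂ := b * c * p + (a * c + b) * q + a * r)
    (c₃ := (a * c + b) * p + a * q) (c₄ := a * p)
    (fun s => by linear_combination h s)
  have ha : a = 0 := (mul_eq_zero.1 h4).resolve_right hp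
  simpa [ha, hp] using h3

section

variable {K V W : Type*} [Field K] [AddCommGroup V] [Module K V] [AddCommGroup W] [Module K W]
  {F : Type*} [Field F] [Algebra K F]
  {B : V →ₗ[K] V →ₗ[K] W} {e : V}

/-- As `B` is alternating, `e` lies in the kernel of `B e` but not in that of `B`; hence ker (B e) =
ker B ⊕ ⟨e⟩, and the rank goes up from 3 by one. -/
theorem finrank_range_eq_four [FiniteDimensional K V]
    (hr : finrank K (LinearMap.range (B e)) = 3) (hA : ∀ x, B x x = 0)
    (h : ∀ y, B e y = 0 → ∃ μ : K, B (y + μ • e) = 0) : finrank K (LinearMap.range B) = 4 := by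
  have hanti : ∀ x y, B x y = -B y x := fun x y => by
    have := hA (x + y)
    simp only [map_add, LinearMap.add_apply, hA, zero_add, add_zero] at this
    exact eq_neg_of_add_eq_zero_right this
  have he : B e ≠ 0 := by
    intro h0
    rw [h0, LinearMap.range_zero, finrank_bot] at hr
    omega
  have he0 : e ≠ 0 := by rintro rfl; exact he (map_zero B)
  have hsup : LinearMap.ker B ⊔ Submodule.span K {e} = LinearMap.ker (B e) := by
    apply le_antisymm
    · refine sup_le ?_ ?_
      · intro y hy
        rw [LinearMap.mem_ker] at hy ⊢
        rw [hanti, hy]; simp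
      · rw [Submodule.span_singleton_le_iff_mem]; exact hA e
    · intro y hy
      obtain ⟨μ, hμ⟩ := h y hy
      have : y = (y + μ • e) + (-μ) • e := by rw [neg_smul]; abel
      rw [this]
      exact Submodule.add_mem_sup hμ (Submodule.smul_mem _ _ (Submodule.mem_span_singleton_self e))
  have hinf : LinearMap.ker B ⊓ Submodule.span K {e} = ⊥ := by
    rw [eq_bot_iff]
    rintro y ⟨hy1, hy2⟩
    obtain ⟨c, rfl⟩ := Submodule.mem_span_singleton.1 hy2
    rcases eq_or_ne c 0 with hc | hc
    · simp [hc]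
    · exfalso
      apply he
      have : c • B e = 0 := by simpa using hy1
      exact (smul_eq_zero.1 this).resolve_left hc
  have h1 := LinearMap.finrank_range_add_finrank_ker B
  have h2 := LinearMap.finrank_range_add_finrank_ker (B e)
  have h3 := Submodule.finrank_sup_add_finrank_inf_eq (LinearMap.ker B) (Submodule.span K {e})
  rw [hsup, hinf, finrank_bot, finrank_span_singleton he0] at h3
  omega

/-- The form `ω ∘ B` lives on the 3-space V / ker (B e), where a nonzero alternating form has rank
2. Two frame vectors span a hyperbolic plane and the third can be moved into the radical. -/
theorem exists_alternating_frame [Infinite F] (hr : finrank K (LinearMap.range (B e)) = 3)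
    (hA : ∀ x, B x x = 0) (hB : MinorsVanish F B) {ω : Dual K W} (hω : ∀ z, ω (B e z) = 0)
    (hne : ∃ x y, ω (B x y) ≠ 0) :
    ∃ (f : Frame B e) (ω₀ : Dual K W), (∀ z, ω₀ (B e z) = 0) ∧ ω₀ (B (f.v 0) (f.v 1)) = 1 ∧
      ω₀ (B (f.v 0) (f.v 2)) = 0 ∧ ω₀ (B (f.v 1) (f.v 2)) = 0 := by
  obtain ⟨f₀⟩ := nonempty_frame hr
  have hanti : ∀ x y, B x y = -B y x := fun x y => by
    have := hA (x + y)
    simp only [map_add, LinearMap.add_apply, hA, zero_add, add_zero] at this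
    exact eq_neg_of_add_eq_zero_right this
  obtain ⟨x, y, hxy⟩ := hne
  set ω₀ : Dual K W := (ω (B x y))⁻¹ • ω with hω₀
  have hk : ∀ z, ω₀ (B e z) = 0 := fun z => by simp [hω₀, hω]
  have h1 : ω₀ (B x y) = 1 := by simp [hω₀, hxy]
  have h2 : ω₀ (B y x) = -1 := by rw [hanti, map_neg, h1]
  -- `Frame.kills` makes the form vanish against any combination of `x` and `y` that lies in the
  -- kernel of `B e`; pairing with `x` and `y` reads off its coefficients.
  have hli : LinearIndependent K ![B e x, B e y] := by
    rw [LinearIndependent.pair_iff]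
    intro α β hαβ
    have hy0 : B e (α • x + β • y) = 0 := by simpa using hαβ
    have hx := (f₀.kills hB hk hy0 x).1
    have hy := (f₀.kills hB hk hy0 y).1
    simp only [map_add, map_smul, hA, h1, h2, smul_eq_mul, map_zero] at hx hy
    constructor
    · linear_combination -hy
    · linear_combination hx
  obtain ⟨f, rfl, rfl, h3, h4⟩ := exists_frame hr hli
    (fun u => ω₀ (B x u) = 0 ∧ ω₀ (B y u) = 0) (fun v => ⟨ω₀ (B y v), -ω₀ (B x v), by
      simp only [map_add, map_smul, hA, h1, h2, smul_eq_mul, map_zero]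
      constructor <;> ring⟩)
  exact ⟨f, ω₀, hk, h1, h3, h4⟩

/-- In a frame with ω₀ ∘ B = ℓ₀ ∧ ℓ₁, the components `f.ω 0` and `f.ω 1` of B are ε ∧ ℓ₀ and ε ∧ ℓ₁
up to multiples of ℓ₀ ∧ ℓ₁ and terms with ℓ₂. If the ℓ₂ terms vanish and no second form exists, this
is the wedge form; otherwise ker (B e) is the radical plus the line of `e`. -/
theorem alternating_classification [FiniteDimensional K V] [Infinite F]
    (hr : finrank K (LinearMap.range (B e)) = 3) (hA : ∀ x, B x x = 0) (hB : MinorsVanish F B) :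
    finrank K (imageSpan B) ≤ 3 ∨ finrank K (LinearMap.range B) = 4 ∨ HasWedgeForm B := by
  by_cases hall : ∀ ω : Dual K W, (∀ z, ω (B e z) = 0) → ∀ x y, ω (B x y) = 0
  · exact Or.inl (finrank_imageSpan_le hr hall)
  push Not at hall
  obtain ⟨ω, hω, hne⟩ := hall
  obtain ⟨f, ω₀, hk, q01, q02, q12⟩ := exists_alternating_frame hr hA hB hω hne
  have hanti : ∀ x y, B x y = -B y x := fun x y => by
    have := hA (x + y)
    simp only [map_add, LinearMap.add_apply, hA, zero_add, add_zero] at this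
    exact eq_neg_of_add_eq_zero_right this
  -- a form vanishing on `B(e, V)` is determined by its values on the frame
  have hform : ∀ ω' : Dual K W, (∀ z, ω' (B e z) = 0) → ∀ x,
      ω' (B x (f.v 0)) = -f.coord 1 x * ω' (B (f.v 0) (f.v 1))
        - f.coord 2 x * ω' (B (f.v 0) (f.v 2)) ∧
      ω' (B x (f.v 1)) = f.coord 0 x * ω' (B (f.v 0) (f.v 1))
        - f.coord 2 x * ω' (B (f.v 1) (f.v 2)) ∧
      ω' (B x (f.v 2)) = f.coord 0 x * ω' (B (f.v 0) (f.v 2))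
        + f.coord 1 x * ω' (B (f.v 1) (f.v 2)) := by
    intro ω' hω' x
    obtain ⟨n, hn, hx⟩ := f.exists_decomposition x
    have hn' : ∀ z, ω' (B n z) = 0 := fun z => by
      rw [hanti, map_neg, (f.kills hB hω' hn z).1, neg_zero]
    have e10 : ω' (B (f.v 1) (f.v 0)) = -ω' (B (f.v 0) (f.v 1)) := by rw [hanti, map_neg]
    have e20 : ω' (B (f.v 2) (f.v 0)) = -ω' (B (f.v 0) (f.v 2)) := by rw [hanti, map_neg]
    have e21 : ω' (B (f.v 2) (f.v 1)) = -ω' (B (f.v 1) (f.v 2)) := by rw [hanti, map_neg]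
    have hb : ∀ z, ω' (B x z) = f.coord 0 x * ω' (B (f.v 0) z) + f.coord 1 x * ω' (B (f.v 1) z)
        + f.coord 2 x * ω' (B (f.v 2) z) := fun z => by
      conv_lhs => rw [hx]
      simp only [map_add, map_smul, LinearMap.add_apply, LinearMap.smul_apply, smul_eq_mul, hn',
        add_zero]
    refine ⟨?_, ?_, ?_⟩ <;> rw [hb] <;> simp only [hA, map_zero, e10, e20, e21] <;> ring
  have cv : ∀ i, f.coord i (f.v i) = 1 := fun i => by rw [f.coord_v, if_pos rfl]
  have cv' : ∀ i j, i ≠ j → f.coord i (f.v j) = 0 := fun i j h => by rw [f.coord_v, if_neg h]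
  have c01 := cv' 0 1 (by decide)
  have c02 := cv' 0 2 (by decide)
  have c10 := cv' 1 0 (by decide)
  have c12 := cv' 1 2 (by decide)
  have c20 := cv' 2 0 (by decide)
  have c21 := cv' 2 1 (by decide)
  have ce : ∀ i, f.coord i e = 0 := fun i => by simp [Frame.coord, hA]
  have hxe : ∀ i x, f.ω i (B x e) = -f.coord i x := fun i x => by
    rw [hanti, map_neg]; rfl
  -- The second relation of `Frame.kills` for ω₀ says that the components 0 and 1 of `B x y` are
  -- parallel to the coordinates 0 and 1 of `x`.
  have h01 : ∀ y, B e y = 0 → ∀ x, f.ω 0 (B x y) = f.ω 0 (B (f.v 0) y) * f.coord 0 x ∧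
      f.ω 1 (B x y) = f.ω 0 (B (f.v 0) y) * f.coord 1 x := by
    intro y hy
    refine proportional_of_wedge (g₀ := f.ω 0 ∘ₗ B.flip y) (g₁ := f.ω 1 ∘ₗ B.flip y)
      (cv 0) c10 c01 (cv 1) ?_
    intro x
    have h1 := (f.kills hB hk hy x).2
    obtain ⟨e0, e1, e2⟩ := hform ω₀ hk x
    rw [e0, e1, e2, q01, q02, q12] at h1
    simp only [LinearMap.comp_apply, LinearMap.flip_apply]
    linear_combination h1
  -- membership in the radical
  have hrad : ∀ y, B e y = 0 → (∀ x i, f.ω i (B x y) = 0) → B y = 0 := by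
    intro y hy hf
    ext x
    rw [hanti]
    simp only [LinearMap.zero_apply, neg_eq_zero]
    exact f.eq_zero (hf x) fun ω' hω' => (f.kills hB hω' hy x).1
  by_cases hd : ∀ ω' : Dual K W, (∀ z, ω' (B e z) = 0) →
      ∃ κ : K, ∀ x y, ω' (B x y) = κ * ω₀ (B x y)
  swap
  · right; left
    push Not at hd
    obtain ⟨ω', hω', hnp⟩ := hd
    -- Normalized so that ω'' ∘ B = l ∧ `f.coord 2`. With M = `f.ω 0 (B (f.v 0) y)`, the relation of
    -- `Frame.kills` becomes l(x) · (`f.ω 2 (B x y)` - M · `f.coord 2 x`) = 0.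
    set ω'' : Dual K W := ω' - ω' (B (f.v 0) (f.v 1)) • ω₀ with hω''
    have hk'' : ∀ z, ω'' (B e z) = 0 := fun z => by simp [hω'', hω', hk]
    have p01 : ω'' (B (f.v 0) (f.v 1)) = 0 := by simp [hω'', q01]
    set l : Dual K V := ω'' (B (f.v 0) (f.v 2)) • f.coord 0
      + ω'' (B (f.v 1) (f.v 2)) • f.coord 1 with hl
    have hl0 : l ≠ 0 := by
      intro h0
      have p02 : ω'' (B (f.v 0) (f.v 2)) = 0 := by
        have := LinearMap.congr_fun h0 (f.v 0)
        simpa [hl, cv, c10] using this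
      have p12 : ω'' (B (f.v 1) (f.v 2)) = 0 := by
        have := LinearMap.congr_fun h0 (f.v 1)
        simpa [hl, cv, c01] using this
      obtain ⟨x, y, hxy⟩ := hnp (ω' (B (f.v 0) (f.v 1)))
      apply hxy
      rw [← sub_eq_zero]
      change ω'' (B x y) = 0
      obtain ⟨n, hn, hy⟩ := f.exists_decomposition y
      obtain ⟨e0, e1, e2⟩ := hform ω'' hk'' x
      rw [hy]
      simp only [map_add, map_smul, smul_eq_mul, e0, e1, e2, p01, p02, p12,
        (f.kills hB hk'' hn x).1]
      ring
    -- The components of `B x y` turn out to be this scalar times the coordinates of `x`, while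
    -- those of `B x e` are minus these coordinates, so the sum cancels.
    refine finrank_range_eq_four hr hA fun y hy => ⟨f.ω 0 (B (f.v 0) y), ?_⟩
    have h2 : f.ω 2 ∘ₗ B.flip y - f.ω 0 (B (f.v 0) y) • f.coord 2 = 0 := by
      refine functional_mul_eq_zero (l := l) (fun x => ?_) hl0
      have h1 := (f.kills hB hk'' hy x).2
      obtain ⟨e0, e1, e2⟩ := hform ω'' hk'' x
      obtain ⟨g0, g1⟩ := h01 y hy x
      rw [e0, e1, e2, p01, g0, g1] at h1
      simp only [hl, LinearMap.sub_apply, LinearMap.comp_apply, LinearMap.flip_apply,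
        LinearMap.smul_apply, LinearMap.add_apply, smul_eq_mul]
      linear_combination h1
    refine hrad _ (by simp [hy, hA]) fun x i => ?_
    have h2x := LinearMap.congr_fun h2 x
    simp only [LinearMap.sub_apply, LinearMap.comp_apply, LinearMap.flip_apply,
        LinearMap.smul_apply, smul_eq_mul, LinearMap.zero_apply] at h2x
    obtain ⟨g0, g1⟩ := h01 y hy x
    fin_cases i <;> simp only [map_add, map_smul, smul_eq_mul, hxe] <;>
      simp only [Fin.zero_eta, Fin.mk_one, Fin.reduceFinMk]
    · rw [g0]; ring
    · rw [g1]; ring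
    · linear_combination h2x
  set r := f.ω 0 (B (f.v 0) (f.v 1)) with hr0
  set r' := f.ω 1 (B (f.v 0) (f.v 1)) with hr1
  set A := f.ω 0 (B (f.v 2) (f.v 0)) with hAdef
  set b := f.ω 0 (B (f.v 2) (f.v 1)) with hbdef
  set c := f.ω 1 (B (f.v 2) (f.v 0)) with hcdef
  set d := f.ω 1 (B (f.v 2) (f.v 1)) with hddef
  -- The correction by `r` makes ε vanish on `f.v 1`; it already vanishes on `f.v 0` and is 1 at
  -- `e`.
  set ε : Dual K V := f.ω 0 ∘ₗ B.flip (f.v 0) + r • f.coord 1 with hε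
  have hεe : ε e = 1 := by
    simp only [hε, LinearMap.add_apply, LinearMap.comp_apply, LinearMap.flip_apply,
      LinearMap.smul_apply, ce, smul_zero, add_zero]
    exact cv 0
  have hε0 : ε (f.v 0) = 0 := by simp [hε, hA, c10]
  have hε1 : ε (f.v 1) = 0 := by
    simp only [hε, LinearMap.add_apply, LinearMap.comp_apply, LinearMap.flip_apply,
      LinearMap.smul_apply, cv, smul_eq_mul, mul_one, hanti (f.v 1), map_neg, hr0]
    ring
  have hε2 : ε (f.v 2) = A := by simp [hε, hAdef, c12]
  have hεn : ∀ n, B e n = 0 → ε n = -f.ω 0 (B (f.v 0) n) := by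
    intro n hn
    have : f.coord 1 n = 0 := by simp [Frame.coord, hn]
    simp [hε, this, hanti n]
  have hf0 : ∀ x z, f.ω 0 (B x z) = ε x * f.coord 0 z - f.coord 0 x * ε z
      + r * (f.coord 0 x * f.coord 1 z - f.coord 1 x * f.coord 0 z)
      + b * (f.coord 2 x * f.coord 1 z - f.coord 1 x * f.coord 2 z) ∧
    f.ω 1 (B x z) = ε x * f.coord 1 z - f.coord 1 x * ε z
      + r' * (f.coord 0 x * f.coord 1 z - f.coord 1 x * f.coord 0 z)
      + c * (f.coord 2 x * f.coord 0 z - f.coord 0 x * f.coord 2 z)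
      + (d - A) * (f.coord 2 x * f.coord 1 z - f.coord 1 x * f.coord 2 z) := by
    intro x z
    obtain ⟨n, hn, hx⟩ := f.exists_decomposition x
    obtain ⟨k, hk, hz⟩ := f.exists_decomposition z
    have hεx : ε x = f.coord 2 x * A + ε n := by
      conv_lhs => rw [hx]
      simp [hε0, hε1, hε2]
    have hεz : ε z = f.coord 2 z * A + ε k := by
      conv_lhs => rw [hz]
      simp [hε0, hε1, hε2]
    have hcn : ∀ i, f.coord i n = 0 := fun i => by simp [Frame.coord, hn]
    have hck : ∀ i, f.coord i k = 0 := fun i => by simp [Frame.coord, hk]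
    obtain ⟨a1, a2⟩ := h01 k hk x
    have b1 : ∀ u, f.ω 0 (B n u) = ε n * f.coord 0 u := fun u => by
      rw [hanti, map_neg, (h01 n hn u).1, hεn n hn]; ring
    have b2 : ∀ u, f.ω 1 (B n u) = ε n * f.coord 1 u := fun u => by
      rw [hanti, map_neg, (h01 n hn u).2, hεn n hn]; ring
    have hbx : ∀ i u, f.ω i (B x u) = f.coord 0 x * f.ω i (B (f.v 0) u)
        + f.coord 1 x * f.ω i (B (f.v 1) u) + f.coord 2 x * f.ω i (B (f.v 2) u)
        + f.ω i (B n u) := fun i u => by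
      conv_lhs => rw [hx]
      simp only [map_add, map_smul, LinearMap.add_apply, LinearMap.smul_apply, smul_eq_mul]
    have hbz : ∀ i, f.ω i (B x z) = f.coord 0 z * f.ω i (B x (f.v 0))
        + f.coord 1 z * f.ω i (B x (f.v 1)) + f.coord 2 z * f.ω i (B x (f.v 2))
        + f.ω i (B x k) := fun i => by
      conv_lhs => rw [hz]
      simp only [map_add, map_smul, smul_eq_mul]
    have e10 : B (f.v 1) (f.v 0) = -B (f.v 0) (f.v 1) := hanti _ _
    have e02 : B (f.v 0) (f.v 2) = -B (f.v 2) (f.v 0) := hanti _ _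
    have e12 : B (f.v 1) (f.v 2) = -B (f.v 2) (f.v 1) := hanti _ _
    constructor
    · rw [hbz, hbx 0 (f.v 0), hbx 0 (f.v 1), hbx 0 (f.v 2), a1, hεx, hεz, hεn k hk, b1, b1, b1, cv,
        c01, c02, hA, hA, hA, e10, e02, e12]
      simp only [map_neg, map_zero, ← hr0, ← hAdef, ← hbdef]
      ring
    · rw [hbz, hbx 1 (f.v 0), hbx 1 (f.v 1), hbx 1 (f.v 2), a2, hεx, hεz, hεn k hk, b2, b2, b2, cv,
        c10, c12, hA, hA, hA, e10, e02, e12]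
      simp only [map_neg, map_zero, ← hr1, ← hcdef, ← hddef]
      ring
  have hq : ∀ x z, ω₀ (B x z) = f.coord 0 x * f.coord 1 z - f.coord 1 x * f.coord 0 z := by
    intro x z
    obtain ⟨k, hkz, hz⟩ := f.exists_decomposition z
    obtain ⟨e0, e1, e2⟩ := hform ω₀ hk x
    conv_lhs => rw [hz]
    simp only [map_add, map_smul, smul_eq_mul, e0, e1, e2, (f.kills hB hk hkz x).1, q01, q02, q12]
    ring
  -- These are the coefficients of the terms that involve `f.coord 2`. The terms with `r` and `r'`
  -- are multiples of ω₀ ∘ B and can be subtracted.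
  by_cases hpar : b = 0 ∧ c = 0 ∧ d - A = 0
  · right; right
    obtain ⟨hb0, hc0, hd0⟩ := hpar
    refine ⟨![ε, f.coord 0, f.coord 1], ![f.ω 2, f.ω 0 - r • ω₀, f.ω 1 - r' • ω₀, ω₀], ?_, ?_, ?_⟩
    · refine linearIndependent_of_dual_vectors (u := ![e, f.v 0, f.v 1]) ?_
      intro i j
      fin_cases i <;> fin_cases j <;> simp [hεe, hε0, hε1, ce, cv, c01, c10]
    · intro w hw hi
      have i0 := hi 0
      have i1 := hi 1
      have i2 := hi 2
      have i3 := hi 3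
      simp only [Matrix.cons_val, LinearMap.sub_apply, LinearMap.smul_apply, smul_eq_mul]
        at i0 i1 i2 i3
      rw [i3, mul_zero, sub_zero] at i1 i2
      refine f.separates hd hw i3 fun i => ?_
      fin_cases i
      exacts [i1, i2, i0]
    · intro x y
      obtain ⟨g0, g1⟩ := hf0 x y
      simp only [Matrix.cons_val, LinearMap.sub_apply, LinearMap.smul_apply, smul_eq_mul]
      rw [g0, g1, hq, hb0, hc0, hd0]
      refine ⟨?_, ?_, ?_⟩ <;> ring
  · right; left
    -- A binary quadratic form that vanishes at (0, 1), (1, 0) and (1, 1) is zero over any field.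
    obtain ⟨α, β, hαβ⟩ : ∃ α β : K, b * β ^ 2 - (d - A) * (α * β) - c * α ^ 2 ≠ 0 := by
      by_contra hc
      push Not at hc
      have h1 := hc 0 1
      have h2 := hc 1 0
      have h3 := hc 1 1
      have hb0 : b = 0 := by linear_combination h1
      have hc0 : c = 0 := by linear_combination -h2
      exact hpar ⟨hb0, hc0, by linear_combination -h3 + hb0 - hc0⟩
    refine finrank_range_eq_four hr hA fun y hy => ⟨f.ω 0 (B (f.v 0) y), ?_⟩
    set y' := y + f.ω 0 (B (f.v 0) y) • e with hy'
    have hey' : B e y' = 0 := by simp [hy', hy, hA]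
    have hM : f.ω 0 (B (f.v 0) y') = 0 := by
      simp only [hy', map_add, map_smul, smul_eq_mul, hxe, cv]
      ring
    have hy0 : ∀ x, f.ω 0 (B x y') = 0 := fun x => by rw [(h01 y' hey' x).1, hM, zero_mul]
    have hy1 : ∀ x, f.ω 1 (B x y') = 0 := fun x => by rw [(h01 y' hey' x).2, hM, zero_mul]
    have hyq : ∀ x, ω₀ (B x y') = 0 := fun x => (f.kills hB hk hey' x).1
    refine hrad y' hey' fun z i => ?_
    fin_cases i
    · exact hy0 z
    · exact hy1 z
    set ι := algebraMap K F with hι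
    -- Only the last entry of the column of y' can be nonzero. The minor at x is therefore `f.ω 2 (B
    -- x y')` times `f.coord 2 x` times the quadratic form above at (`f.coord 0 x`, `f.coord 1 x`).
    -- At the chosen point the last two factors have leading coefficients in τ equal to 1 and the
    -- nonzero value just found.
    have key := fun τ : F => hB ![ω₀, f.ω 0, f.ω 1, f.ω 2] ![f.v 0, f.v 1, e, y'] 2
      ![α • f.v 0 + β • f.v 1 + f.v 2, z] ![τ, 1]
    simp only [det_fin_four, Matrix.of_apply, Fin.sum_univ_two, Matrix.cons_val, hy0, hy1, hyq,
      ← hι, map_zero, mul_zero, zero_add, one_mul, hxe, hf0, hq, ce, cv, c01, c10, c02, c12, c20,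
      c21, hε0, hε1, hε2, map_add, map_sub, map_mul, map_smul, map_neg, smul_eq_mul,
      LinearMap.add_apply, LinearMap.smul_apply, map_one] at key
    have hθ : ι (b * β ^ 2 - (d - A) * (α * β) - c * α ^ 2) ≠ 0 := by
      rwa [Ne, map_eq_zero]
    have := linear_factor_eq_zero (a := ι (f.ω 2 (B (α • f.v 0 + β • f.v 1 + f.v 2) y')))
      (b := ι (f.ω 2 (B z y'))) (c := ι (f.coord 2 z))
      (q := ι (2 * b * β * f.coord 1 z - (d - A) * (α * f.coord 1 z + β * f.coord 0 z)
        - 2 * c * α * f.coord 0 z))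
      (r := ι (b * f.coord 1 z ^ 2 - (d - A) * (f.coord 0 z * f.coord 1 z) - c * f.coord 0 z ^ 2))
      hθ (fun τ => by
        simp only [map_add, map_sub, map_mul, map_pow, map_smul, LinearMap.add_apply,
          LinearMap.smul_apply, smul_eq_mul, map_ofNat]
        linear_combination key τ)
    exact (map_eq_zero ι).1 this

end

end PolyMap

/-! ### Symmetric bilinear maps away from characteristic 2 -/

namespace PolyMap

open Module

/-- Three of four separating coordinates of `B` are `ℓ₀²`, `ℓ₀ ℓ₁`, `ℓ₁²`, polarized. -/
def HasBinaryForm {K V W : Type*} [Field K] [AddCommGroup V] [Module K V] [AddCommGroup W]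
    [Module K W] (B : V →ₗ[K] V →ₗ[K] W) : Prop :=
  ∃ (l : Fin 2 → Dual K V) (ω : Fin 4 → Dual K W), LinearIndependent K l ∧ Separates B ω ∧
    ∀ x y, ω 1 (B x y) = l 0 x * l 0 y ∧ ω 2 (B x y) = l 0 x * l 1 y + l 1 x * l 0 y ∧
      ω 3 (B x y) = l 1 x * l 1 y

/-- Four separating coordinates of `B` are the polarized exceptional quadratic forms. -/
def HasExceptionalForm {K V W : Type*} [Field K] [AddCommGroup V] [Module K V] [AddCommGroup W]
    [Module K W] (B : V →ₗ[K] V →ₗ[K] W) : Prop :=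
  ∃ (l : Fin 4 → Dual K V) (ω : Fin 4 → Dual K W) (c : K), c ≠ 0 ∧ LinearIndependent K l ∧
    Separates B ω ∧ ∀ x y,
      ω 0 (B x y) = l 0 x * l 2 y + l 2 x * l 0 y + c * (l 1 x * l 3 y + l 3 x * l 1 y) ∧
      ω 1 (B x y) = l 1 x * l 2 y + l 2 x * l 1 y - (l 0 x * l 3 y + l 3 x * l 0 y) ∧
      ω 2 (B x y) = l 2 x * l 2 y + c * (l 3 x * l 3 y) ∧
      ω 3 (B x y) = l 0 x * l 0 y + c * (l 1 x * l 1 y)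

section

variable {K V W : Type*} [Field K] [AddCommGroup V] [Module K V] [AddCommGroup W] [Module K W]
  {F : Type*} [Field F] [Algebra K F]
  {B : V →ₗ[K] V →ₗ[K] W} {e : V}

/-- As 2 ≠ 0, the vectors `s`, `p`, `s + p`, `s - p` span four distinct lines, whereas a nonzero
binary cubic has at most three zeros; so `g` vanishes at `s` and `p`. Adding combinations of these
to a vector in the common kernel of `a` and `b` then isolates `g x`. -/
theorem quadratic_mul_functional_eq_zero (h2 : (2 : K) ≠ 0) {a b g : Dual K V} {s p : V}
    (has : a s = 1) (hbs : b s = 0) (hap : a p = 0) (hbp : b p = 1) {δ₀ δ₁ δ₂ : K}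
    (hδ : ¬(δ₀ = 0 ∧ δ₁ = 0 ∧ δ₂ = 0))
    (h : ∀ x, (δ₀ * a x ^ 2 + δ₁ * (a x * b x) + δ₂ * b x ^ 2) * g x = 0) (x : V) : g x = 0 := by
  have k1 := h s
  have k2 := h p
  have k3 := h (s + p)
  have k4 := h (s - p)
  simp only [map_add, map_sub, has, hbs, hap, hbp] at k1 k2 k3 k4
  have k5 : δ₀ * g s = 0 := by linear_combination k1
  have k6 : δ₂ * g p = 0 := by linear_combination k2
  have k7 : δ₁ * g p + δ₂ * g s = 0 := by
    have : (2 : K) * (δ₁ * g p + δ₂ * g s) = 0 := by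
      linear_combination k3 + k4 - 2 * k5
    exact (mul_eq_zero.1 this).resolve_left h2
  have k8 : δ₀ * g p + δ₁ * g s = 0 := by linear_combination k3 - k5 - k6 - k7
  have gs : g s = 0 := by
    by_contra hg
    have d0 : δ₀ = 0 := (mul_eq_zero.1 k5).resolve_right hg
    have d1 : δ₁ = 0 := by
      rw [d0, zero_mul, zero_add] at k8
      exact (mul_eq_zero.1 k8).resolve_right hg
    rw [d1, zero_mul, zero_add] at k7
    exact hδ ⟨d0, d1, (mul_eq_zero.1 k7).resolve_right hg⟩
  have gp : g p = 0 := by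
    by_contra hg
    rw [gs, mul_zero, add_zero] at k7 k8
    exact hδ ⟨(mul_eq_zero.1 k8).resolve_right hg, (mul_eq_zero.1 k7).resolve_right hg,
      (mul_eq_zero.1 k6).resolve_right hg⟩
  have k9 : ∀ α β : K, (δ₀ * α ^ 2 + δ₁ * (α * β) + δ₂ * β ^ 2) * g x = 0 := by
    intro α β
    have := h (α • s + β • p + (x - a x • s - b x • p))
    simp only [map_add, map_sub, map_smul, smul_eq_mul, has, hbs, hap, hbp, gs, gp] at this
    linear_combination this
  by_contra hg
  have d0 := (mul_eq_zero.1 (k9 1 0)).resolve_right hg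
  have d2 := (mul_eq_zero.1 (k9 0 1)).resolve_right hg
  have d1 := (mul_eq_zero.1 (k9 1 1)).resolve_right hg
  exact hδ ⟨by linear_combination d0, by linear_combination d1 - d0 - d2,
    by linear_combination d2⟩

/-- By polarization some `s` has ω(B(s, s)) ≠ 0. Since `e` is in the radical of ω ∘ B, the vectors
`e`, `s` start a frame, and the third can be made orthogonal to `s`. -/
theorem exists_symmetric_frame [Infinite F] (h2 : (2 : K) ≠ 0)
    (hr : finrank K (LinearMap.range (B e)) = 3) (hS : ∀ x y, B x y = B y x) (he : B e e ≠ 0)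
    (hB : MinorsVanish F B) {ω : Dual K W} (hω : ∀ z, ω (B e z) = 0)
    (hne : ∃ x y, ω (B x y) ≠ 0) :
    ∃ (f : Frame B e) (ω₀ : Dual K W), (∀ z, ω₀ (B e z) = 0) ∧ f.v 0 = e ∧
      ω₀ (B (f.v 1) (f.v 1)) = 1 ∧ ω₀ (B (f.v 1) (f.v 2)) = 0 := by
  obtain ⟨f₀⟩ := nonempty_frame hr
  obtain ⟨s, hs⟩ : ∃ s, ω (B s s) ≠ 0 := by
    by_contra hc
    push Not at hc
    obtain ⟨x, y, hxy⟩ := hne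
    have h := hc (x + y)
    simp only [map_add, LinearMap.add_apply, hc, hS y x] at h
    have : (2 : K) * ω (B x y) = 0 := by linear_combination h
    exact hxy ((mul_eq_zero.1 this).resolve_left h2)
  set ω₀ : Dual K W := (ω (B s s))⁻¹ • ω with hω₀
  have hk : ∀ z, ω₀ (B e z) = 0 := fun z => by simp [hω₀, hω]
  have h1 : ω₀ (B s s) = 1 := by simp [hω₀, hs]
  have hli : LinearIndependent K ![B e e, B e s] := by
    rw [LinearIndependent.pair_iff]
    intro α β hαβ
    have hy0 : B e (α • e + β • s) = 0 := by simpa using hαβ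
    have hx := (f₀.kills hB hk hy0 s).1
    simp only [map_add, map_smul, hS s e, hk, h1, smul_eq_mul] at hx
    have hβ : β = 0 := by linear_combination hx
    rw [hβ, zero_smul, add_zero] at hαβ
    exact ⟨(smul_eq_zero.1 hαβ).resolve_right he, hβ⟩
  obtain ⟨f, h3, rfl, h4⟩ := exists_frame hr hli
    (fun u => ω₀ (B s u) = 0) (fun v => ⟨0, -ω₀ (B s v), by
      simp only [map_add, map_smul, h1, smul_eq_mul]
      simp⟩)
  exact ⟨f, ω₀, hk, h3, h1, h4⟩

end

end PolyMap

/-! ### Diagonal frames; two independent forms -/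

namespace PolyMap

open Module

/-- A frame `(e, s, p)` of a symmetric bilinear map together with a functional `ω₀` vanishing on
`B(e, V)` such that `ω₀ ∘ B` is diagonal on `s`, `p`. -/
structure DiagonalFrame {K V W : Type*} [Field K] [AddCommGroup V] [Module K V] [AddCommGroup W]
    [Module K W] (B : V →ₗ[K] V →ₗ[K] W) (e : V) extends Frame B e where
  ω₀ : Dual K W
  c : K
  symm : ∀ x y, B x y = B y x
  v_zero : v 0 = e
  kills₀ : ∀ z, ω₀ (B e z) = 0
  diag_one : ω₀ (B (v 1) (v 1)) = 1
  diag_off : ω₀ (B (v 1) (v 2)) = 0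
  diag_two : ω₀ (B (v 2) (v 2)) = c

section

variable {K V W : Type*} [Field K] [AddCommGroup V] [Module K V] [AddCommGroup W] [Module K W]
  {F : Type*} [Field F] [Algebra K F]
  {B : V →ₗ[K] V →ₗ[K] W} {e : V}

namespace DiagonalFrame

theorem coord_self (f : DiagonalFrame B e) (i : Fin 3) : f.coord i (f.v i) = 1 := by
  rw [f.coord_v, if_pos rfl]

theorem coord_ne (f : DiagonalFrame B e) {i j : Fin 3} (h : i ≠ j) : f.coord i (f.v j) = 0 := by
  rw [f.coord_v, if_neg h]

theorem coord_table (f : DiagonalFrame B e) :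
    f.coord 0 e = 1 ∧ f.coord 1 e = 0 ∧ f.coord 2 e = 0 ∧
    f.coord 0 (f.v 1) = 0 ∧ f.coord 1 (f.v 1) = 1 ∧ f.coord 2 (f.v 1) = 0 ∧
    f.coord 0 (f.v 2) = 0 ∧ f.coord 1 (f.v 2) = 0 ∧ f.coord 2 (f.v 2) = 1 := by
  have h := f.v_zero
  refine ⟨?_, ?_, ?_, ?_, ?_, ?_, ?_, ?_, ?_⟩
  · exact (congrArg (f.coord 0) h).symm.trans (f.coord_self 0)
  · exact (congrArg (f.coord 1) h).symm.trans (f.coord_ne (by decide))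
  · exact (congrArg (f.coord 2) h).symm.trans (f.coord_ne (by decide))
  · exact f.coord_ne (by decide)
  · exact f.coord_self 1
  · exact f.coord_ne (by decide)
  · exact f.coord_ne (by decide)
  · exact f.coord_ne (by decide)
  · exact f.coord_self 2

theorem decomposition (f : DiagonalFrame B e) (x : V) :
    ∃ z, B e z = 0 ∧
      x = f.coord 0 x • e + f.coord 1 x • f.v 1 + f.coord 2 x • f.v 2 + z := by
  obtain ⟨z, hz, hx⟩ := f.exists_decomposition x
  rw [f.v_zero] at hx
  exact ⟨z, hz, hx⟩

theorem apply_e (f : DiagonalFrame B e) (i : Fin 3) (x : V) :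
    f.ω i (B x e) = f.coord i x := by rw [f.symm]; rfl

theorem coord_ker (f : DiagonalFrame B e) {n : V} (hn : B e n = 0) (i : Fin 3) :
    f.coord i n = 0 := by simp [Frame.coord, hn]

theorem eq_zero_of_ker (f : DiagonalFrame B e) [Infinite F] (hB : MinorsVanish F B) {y : V}
    (hy : B e y = 0) (h : ∀ x i, f.ω i (B x y) = 0) : B y = 0 := by
  ext x
  rw [f.symm]
  exact f.eq_zero (h x) fun ω hω => (f.kills hB hω hy x).1

theorem form_apply (f : DiagonalFrame B e) [Infinite F] (hB : MinorsVanish F B) {ω : Dual K W}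
    (hω : ∀ z, ω (B e z) = 0) (x : V) :
    ω (B x e) = 0 ∧
    ω (B x (f.v 1)) = f.coord 1 x * ω (B (f.v 1) (f.v 1)) + f.coord 2 x * ω (B (f.v 1) (f.v 2)) ∧
    ω (B x (f.v 2)) = f.coord 1 x * ω (B (f.v 1) (f.v 2)) + f.coord 2 x * ω (B (f.v 2) (f.v 2)) := by
  obtain ⟨n, hn, hx⟩ := f.decomposition x
  have hn' : ∀ z, ω (B n z) = 0 := fun z => by rw [f.symm, (f.kills hB hω hn z).1]
  have hb : ∀ z, ω (B x z) = f.coord 1 x * ω (B (f.v 1) z)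
      + f.coord 2 x * ω (B (f.v 2) z) := fun z => by
    conv_lhs => rw [hx]
    simp only [map_add, map_smul, LinearMap.add_apply, LinearMap.smul_apply, smul_eq_mul, hn', hω]
    ring
  exact ⟨by rw [f.symm, hω], by rw [hb, f.symm (f.v 2) (f.v 1)], hb _⟩

theorem form₀_apply (f : DiagonalFrame B e) [Infinite F] (hB : MinorsVanish F B) (x : V) :
    f.ω₀ (B x e) = 0 ∧ f.ω₀ (B x (f.v 1)) = f.coord 1 x ∧
      f.ω₀ (B x (f.v 2)) = f.c * f.coord 2 x := by
  obtain ⟨h0, h1, h2⟩ := f.form_apply hB f.kills₀ x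
  refine ⟨h0, ?_, ?_⟩
  · rw [h1, f.diag_one, f.diag_off]; ring
  · rw [h2, f.diag_off, f.diag_two]; ring

theorem form₀_eq (f : DiagonalFrame B e) [Infinite F] (hB : MinorsVanish F B) (x y : V) :
    f.ω₀ (B x y) = f.coord 1 x * f.coord 1 y + f.c * (f.coord 2 x * f.coord 2 y) := by
  obtain ⟨h0, h1, h2⟩ := f.form₀_apply hB x
  obtain ⟨n, hn, hy⟩ := f.decomposition y
  conv_lhs => rw [hy]
  simp only [map_add, map_smul, smul_eq_mul, h0, h1, h2, (f.kills hB f.kills₀ hn x).1]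
  ring

theorem kills₀_mul (f : DiagonalFrame B e) [Infinite F] (hB : MinorsVanish F B) {y : V}
    (hy : B e y = 0) (x : V) :
    f.coord 1 x * f.ω 1 (B x y) + f.c * f.coord 2 x * f.ω 2 (B x y) = 0 := by
  have h := (f.kills hB f.kills₀ hy x).2
  obtain ⟨h0, h1, h2⟩ := f.form₀_apply hB x
  rw [f.v_zero, h0, h1, h2] at h
  linear_combination h

/-- If a second form vanishes on `B(e, V)`, then the kernel of `B(e, ·)` is the radical. -/
theorem eq_zero_of_two_forms (f : DiagonalFrame B e) [Infinite F] (h2 : (2 : K) ≠ 0)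
    (hB : MinorsVanish F B) {ω : Dual K W} (hω : ∀ z, ω (B e z) = 0)
    (hne : ∀ κ : K, ∃ x y, ω (B x y) ≠ κ * f.ω₀ (B x y)) {y : V} (hy : B e y = 0) : B y = 0 := by
  obtain ⟨te, ae, be, ts, as, bs, tp, ap, bp⟩ := f.coord_table
  set ω' : Dual K W := ω - ω (B (f.v 1) (f.v 1)) • f.ω₀ with hω'
  have hk : ∀ z, ω' (B e z) = 0 := fun z => by simp [hω', hω, f.kills₀]
  have pss : ω' (B (f.v 1) (f.v 1)) = 0 := by simp [hω', f.diag_one]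
  set m := ω' (B (f.v 1) (f.v 2)) with hm
  set k := ω' (B (f.v 2) (f.v 2)) with hkdef
  have hform : ∀ x, ω' (B x e) = 0 ∧ ω' (B x (f.v 1)) = f.coord 2 x * m ∧
      ω' (B x (f.v 2)) = f.coord 1 x * m + f.coord 2 x * k := fun x => by
    obtain ⟨h0, h1, h3⟩ := f.form_apply hB hk x
    refine ⟨h0, ?_, h3⟩
    rw [h1, pss]; ring
  -- The three entries are the coefficients of the quadratic form m a² + k ab - c m b² in a =
  -- `f.coord 1`, b = `f.coord 2`, which arises on eliminating `f.ω 1` between the relations for ω₀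
  -- and ω'.
  have hmk : ¬(m = 0 ∧ k = 0 ∧ -f.c * m = 0) := by
    rintro ⟨hm0, hk0, -⟩
    obtain ⟨x, z, hxz⟩ := hne (ω (B (f.v 1) (f.v 1)))
    apply hxz
    rw [← sub_eq_zero]
    change ω' (B x z) = 0
    obtain ⟨n, hn, hz⟩ := f.decomposition z
    obtain ⟨e0, e1, e2⟩ := hform x
    rw [hz]
    simp only [map_add, map_smul, smul_eq_mul, e0, e1, e2, hm0, hk0, (f.kills hB hk hn x).1]
    ring
  have hCB : ∀ x, f.coord 2 x * m * f.ω 1 (B x y)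
      + (f.coord 1 x * m + f.coord 2 x * k) * f.ω 2 (B x y) = 0 := fun x => by
    have h := (f.kills hB hk hy x).2
    obtain ⟨h0, h1, h3⟩ := hform x
    rw [f.v_zero, h0, h1, h3] at h
    linear_combination h
  have hb : ∀ x, f.ω 2 (B x y) = 0 := by
    refine quadratic_mul_functional_eq_zero (g := f.ω 2 ∘ₗ B.flip y) h2 as bs ap bp hmk
      fun x => ?_
    simp only [LinearMap.comp_apply, LinearMap.flip_apply]
    linear_combination f.coord 1 x * hCB x - f.coord 2 x * m * f.kills₀_mul hB hy x
  have ha : ∀ x, f.ω 1 (B x y) = 0 := by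
    have hne : f.coord 1 ≠ 0 := fun h0 => by
      rw [h0] at as; simp at as
    have := functional_mul_eq_zero (g := f.ω 1 ∘ₗ B.flip y) (l := f.coord 1) (fun x => by
      simp only [LinearMap.comp_apply, LinearMap.flip_apply]
      have := f.kills₀_mul hB hy x
      rw [hb] at this
      linear_combination this) hne
    exact fun x => LinearMap.congr_fun this x
  have hd : ∀ x, f.ω 0 (B x y) = 0 := by
    refine quadratic_mul_functional_eq_zero (g := f.ω 0 ∘ₗ B.flip y) h2 as bs ap bp hmk
      fun x => ?_
    simp only [LinearMap.comp_apply, LinearMap.flip_apply]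
    obtain ⟨h0, h1, h3⟩ := hform x
    obtain ⟨q0, q1, q3⟩ := f.form₀_apply hB x
    -- The column of `y` has only its top entry, so the two minors are `f.ω 0 (B x y)` times that
    -- quadratic form times `f.coord 1 x` and `f.coord 2 x` respectively.
    have k1 := hB.det_eq_zero ![f.ω 0, f.ω 1, f.ω₀, ω'] ![y, e, f.v 1, f.v 2] x
    have k2 := hB.det_eq_zero ![f.ω 0, f.ω 2, f.ω₀, ω'] ![y, e, f.v 1, f.v 2] x
    simp only [det_fin_four, Matrix.of_apply, Matrix.cons_val, ha, hb, h0, h1,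
      h3, q0, q1, q3, (f.kills hB hk hy x).1, (f.kills hB f.kills₀ hy x).1, f.apply_e, mul_zero,
      zero_mul] at k1 k2
    by_cases hax : f.coord 1 x = 0
    · by_cases hbx : f.coord 2 x = 0
      · rw [hax, hbx]; ring
      · refine (mul_eq_zero.1 ?_).resolve_left hbx
        linear_combination k2
    · refine (mul_eq_zero.1 ?_).resolve_left hax
      linear_combination k1
  refine f.eq_zero_of_ker hB hy fun x i => ?_
  fin_cases i
  exacts [hd x, ha x, hb x]

end DiagonalFrame

end

end PolyMap

/-! ### One form of rank one: the binary case -/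

namespace PolyMap

open Module

section

variable {K V W : Type*} [Field K] [AddCommGroup V] [Module K V] [AddCommGroup W] [Module K W]
  {F : Type*} [Field F] [Algebra K F]
  {B : V →ₗ[K] V →ₗ[K] W} {e : V}

namespace DiagonalFrame

theorem e_apply (f : DiagonalFrame B e) (i : Fin 3) (x : V) :
    f.ω i (B e x) = f.coord i x := rfl

theorem form₁_apply_ker (f : DiagonalFrame B e) [Infinite F] (hB : MinorsVanish F B)
    (hc : f.c = 0) {y : V} (hy : B e y = 0) (x : V) : f.ω 1 (B x y) = 0 := by
  obtain ⟨-, -, -, -, as, -⟩ := f.coord_table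
  have hne : f.coord 1 ≠ 0 := fun h0 => by
    rw [h0] at as; simp at as
  have := functional_mul_eq_zero (g := f.ω 1 ∘ₗ B.flip y) (l := f.coord 1) (fun x => by
    simp only [LinearMap.comp_apply, LinearMap.flip_apply]
    have := f.kills₀_mul hB hy x
    rw [hc] at this
    linear_combination this) hne
  exact LinearMap.congr_fun this x

theorem form₁_apply (f : DiagonalFrame B e) [Infinite F] (hB : MinorsVanish F B)
    (hc : f.c = 0) (x : V) :
    f.ω 1 (B x (f.v 2)) = f.coord 1 x * f.ω 1 (B (f.v 1) (f.v 2))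
      + f.coord 2 x * f.ω 1 (B (f.v 2) (f.v 2)) ∧
    f.ω 1 (B x (f.v 1)) = f.coord 0 x + f.coord 1 x * f.ω 1 (B (f.v 1) (f.v 1))
      + f.coord 2 x * f.ω 1 (B (f.v 1) (f.v 2)) := by
  obtain ⟨te, ae, be, ts, as, bs, tp, ap, bp⟩ := f.coord_table
  obtain ⟨n, hn, hx⟩ := f.decomposition x
  have hn' : ∀ z, f.ω 1 (B n z) = 0 := fun z => by rw [f.symm, f.form₁_apply_ker hB hc hn]
  have hb : ∀ z, f.ω 1 (B x z) = f.coord 0 x * f.coord 1 z + f.coord 1 x * f.ω 1 (B (f.v 1) z)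
      + f.coord 2 x * f.ω 1 (B (f.v 2) z) := fun z => by
    conv_lhs => rw [hx]
    simp only [map_add, map_smul, LinearMap.add_apply, LinearMap.smul_apply, smul_eq_mul, hn',
      e_apply]
    ring
  constructor
  · rw [hb, ap]; ring
  · rw [hb, as, f.symm (f.v 2) (f.v 1)]; ring

/-- The relations between the forms that the vanishing of one minor imposes when `c = 0`. -/
theorem relations_of_c_eq_zero (f : DiagonalFrame B e) [Infinite F] (hB : MinorsVanish F B)
    (hc : f.c = 0) {y z : V} (hy : B e y = 0) (hzt : f.coord 0 z = 0) (hza : f.coord 1 z = 0) :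
    let k₁ := f.ω 1 (B (f.v 1) (f.v 2))
    let k₂ := f.ω 1 (B (f.v 2) (f.v 2))
    let β := f.coord 2 z
    let κ := f.ω 2 (B (f.v 1) y)
    let κ₀ := f.ω 0 (B (f.v 1) y)
    let φ := f.ω 2 (B z y)
    let φ₀ := f.ω 0 (B z y)
    let g := f.ω 2 (B (f.v 1) (f.v 2))
    let h := f.ω 0 (B (f.v 1) (f.v 2))
    let γ := f.ω 2 (B z (f.v 2))
    let η := f.ω 0 (B z (f.v 2))
    (κ₀ + k₁ * κ = 0 ∧ φ₀ + k₁ * φ + β * k₂ * κ = 0 ∧ β * k₂ * φ = 0) ∧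
    (β ^ 2 * k₂ * φ₀ = 0 ∧ γ * φ₀ - φ * η - k₁ * β * φ₀ - β ^ 2 * k₂ * κ₀ = 0 ∧
      g * φ₀ + γ * κ₀ - κ * η - φ * h - k₁ * β * κ₀ = 0 ∧ g * κ₀ - κ * h = 0) := by
  intro k₁ k₂ β κ κ₀ φ φ₀ g h γ η
  obtain ⟨te, ae, be, ts, as, bs, tp, ap, bp⟩ := f.coord_table
  set ι := algebraMap K F with hι
  -- The row of ω₀ is zero except for the entry σ in the first column, since `c = 0`. The minor is
  -- thus σ times a 3 × 3 minor that is affine in `T`; the σ-coefficients of its two parts are the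
  -- seven relations.
  have key := fun T σ : F => hB ![f.ω₀, f.ω 1, f.ω 2, f.ω 0] ![f.v 1, e, f.v 2, y] 3
    ![e, f.v 1, z] ![T, σ, 1]
  obtain ⟨qs0, qs1, qs2⟩ := f.form₀_apply hB (f.v 1)
  obtain ⟨qz0, qz1, qz2⟩ := f.form₀_apply hB z
  rw [bs, mul_zero] at qs2
  rw [as] at qs1
  rw [hza] at qz1
  rw [hc, zero_mul] at qz2
  have gz := (f.form₁_apply hB hc z).1
  rw [hza, zero_mul, zero_add] at gz
  have hk1 : f.ω 1 (B (f.v 1) (f.v 2)) = k₁ := rfl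
  have hk2 : f.ω 1 (B (f.v 2) (f.v 2)) = k₂ := rfl
  have hβ : f.coord 2 z = β := rfl
  have hκ : f.ω 2 (B (f.v 1) y) = κ := rfl
  have hκ0 : f.ω 0 (B (f.v 1) y) = κ₀ := rfl
  have hφ : f.ω 2 (B z y) = φ := rfl
  have hφ0 : f.ω 0 (B z y) = φ₀ := rfl
  have hg : f.ω 2 (B (f.v 1) (f.v 2)) = g := rfl
  have hh : f.ω 0 (B (f.v 1) (f.v 2)) = h := rfl
  have hγ : f.ω 2 (B z (f.v 2)) = γ := rfl
  have hη : f.ω 0 (B z (f.v 2)) = η := rfl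
  rw [hk2, hβ] at gz
  simp only [det_fin_four, Matrix.of_apply, Fin.sum_univ_three, Matrix.cons_val, f.kills₀,
    (f.kills hB f.kills₀ hy _).1, f.form₁_apply_ker hB hc hy, qs0, qs1, qs2, qz0, qz1, qz2, gz,
    e_apply, apply_e, te, ae, be, ts, as, bs, tp, ap, bp, hzt, hza, hk1, hβ, hκ, hκ0, hφ, hφ0,
    hg, hh, hγ, hη, f.coord_ker hy, ← hι, map_zero, map_one, map_mul, mul_zero, mul_one, zero_mul,
    zero_add, add_zero, one_mul, sub_zero] at key
  obtain ⟨-, a1, a2, a3, -⟩ := coeffs_eq_zero_of_forall (F := F) (c₀ := 0) (c₁ := ι (β * k₂ * φ))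
    (c₂ := ι (φ₀ + k₁ * φ + β * k₂ * κ)) (c₃ := ι (κ₀ + k₁ * κ)) (c₄ := 0) (fun σ => by
      simp only [map_add, map_mul]
      linear_combination key 1 σ - key 0 σ)
  obtain ⟨-, b1, b2, b3, b4⟩ := coeffs_eq_zero_of_forall (F := F) (c₀ := 0)
    (c₁ := ι (β ^ 2 * k₂ * φ₀)) (c₂ := -ι (γ * φ₀ - φ * η - k₁ * β * φ₀ - β ^ 2 * k₂ * κ₀))
    (c₃ := -ι (g * φ₀ + γ * κ₀ - κ * η - φ * h - k₁ * β * κ₀)) (c₄ := -ι (g * κ₀ - κ * h))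
    (fun σ => by
      simp only [map_add, map_sub, map_mul, map_pow]
      linear_combination -key 0 σ)
  rw [neg_eq_zero] at b2 b3 b4
  rw [map_eq_zero] at a1 a2 a3 b1 b2 b3 b4
  exact ⟨⟨a3, a2, a1⟩, b1, b2, b3, b4⟩

/-- The relations make ker (B e) radical unless two obstructions vanish: the number `f.ω 1 (B (f.v
2) (f.v 2))` and the functional θ below. When both vanish, three of the separating components depend
on just two linear forms. -/
theorem eq_zero_or_hasBinaryForm (f : DiagonalFrame B e) [Infinite F] (hB : MinorsVanish F B)
    (hd : ∀ ω : Dual K W, (∀ z, ω (B e z) = 0) → ∃ κ : K, ∀ x y, ω (B x y) = κ * f.ω₀ (B x y))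
    (hc : f.c = 0) : (∀ y, B e y = 0 → B y = 0) ∨ HasBinaryForm B := by
  obtain ⟨te, ae, be, ts, as, bs, tp, ap, bp⟩ := f.coord_table
  by_cases hk2 : f.ω 1 (B (f.v 2) (f.v 2)) = 0
  swap
  · left
    intro y hy
    -- the forms vanish on `p + n` and `s`, hence everywhere
    have hz : ∀ z, f.coord 0 z = 0 → f.coord 1 z = 0 → f.coord 2 z = 1 →
        f.ω 2 (B z y) = 0 ∧ f.ω 0 (B z y) = 0 ∧ f.ω 2 (B (f.v 1) y) = 0 ∧
          f.ω 0 (B (f.v 1) y) = 0 := by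
      intro z h0 h1 h2
      obtain ⟨⟨i, ii, iii⟩, iv, -⟩ := f.relations_of_c_eq_zero hB hc hy h0 h1
      rw [h2, one_mul] at ii iii
      rw [h2, one_pow, one_mul] at iv
      have hφ := (mul_eq_zero.1 iii).resolve_left hk2
      have hφ0 := (mul_eq_zero.1 iv).resolve_left hk2
      rw [hφ, hφ0, mul_zero, zero_add, zero_add] at ii
      have hκ := (mul_eq_zero.1 ii).resolve_left hk2
      rw [hκ, mul_zero, add_zero] at i
      exact ⟨hφ, hφ0, hκ, i⟩
    refine f.eq_zero_of_ker hB hy fun x i => ?_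
    obtain ⟨n, hn, hx⟩ := f.decomposition x
    obtain ⟨p2, p0, s2, s0⟩ := hz (f.v 2) tp ap bp
    -- Comparing z = `f.v 2` with z = `f.v 2 + n` isolates the values at the kernel vector `n`.
    obtain ⟨n2, n0, -⟩ := hz (f.v 2 + n) (by rw [map_add, tp, f.coord_ker hn, add_zero])
      (by rw [map_add, ap, f.coord_ker hn, add_zero])
      (by rw [map_add, bp, f.coord_ker hn, add_zero])
    simp only [map_add, LinearMap.add_apply, p2, p0, zero_add] at n2 n0
    fin_cases i
    · change f.ω 0 (B x y) = 0
      rw [hx]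
      simp [p0, s0, n0, hy]
    · exact f.form₁_apply_ker hB hc hy x
    · change f.ω 2 (B x y) = 0
      rw [hx]
      simp [p2, s2, n2, hy]
  set k₁ := f.ω 1 (B (f.v 1) (f.v 2)) with hk1
  have h0 : ∀ y, B e y = 0 → ∀ x, f.ω 0 (B x y) = -k₁ * f.ω 2 (B x y) := by
    intro y hy x
    set z := x - f.coord 0 x • e - f.coord 1 x • f.v 1 with hz
    obtain ⟨⟨i, ii, -⟩, -⟩ := f.relations_of_c_eq_zero hB hc (z := z) hy
      (by simp [hz, te, ts]) (by simp [hz, ae, as])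
    rw [hk2] at ii
    have hx : x = z + f.coord 0 x • e + f.coord 1 x • f.v 1 := by rw [hz]; abel
    rw [hx]
    simp only [map_add, map_smul, LinearMap.add_apply, LinearMap.smul_apply, hy, smul_eq_mul,
      map_zero]
    linear_combination ii + f.coord 1 x * i
  -- With `G` and `t'` as defined below, θ(x) = G(B(x, `f.v 2`)) - k₁ t'(x).
  set θ : Dual K V := f.ω 0 ∘ₗ B.flip (f.v 2) + k₁ • (f.ω 2 ∘ₗ B.flip (f.v 2))
    - k₁ ^ 2 • f.coord 2 - k₁ • f.coord 0 with hθ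
  have hmul : ∀ y, B e y = 0 → ∀ x, (f.ω 2 ∘ₗ B.flip y) x * θ x = 0 := by
    intro y hy x
    set z := x - f.coord 0 x • e - f.coord 1 x • f.v 1 with hz
    have hzt : f.coord 0 z = 0 := by simp [hz, te, ts]
    have hza : f.coord 1 z = 0 := by simp [hz, ae, as]
    obtain ⟨⟨i, ii, -⟩, -, v, vi, vii⟩ := f.relations_of_c_eq_zero hB hc (z := z) hy hzt hza
    rw [hk2] at ii v
    have hx : x = z + f.coord 0 x • e + f.coord 1 x • f.v 1 := by rw [hz]; abel
    rw [hx]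
    simp only [hθ, LinearMap.comp_apply, LinearMap.flip_apply, LinearMap.sub_apply, map_add,
      map_smul, LinearMap.add_apply, LinearMap.smul_apply, hy, smul_eq_mul, e_apply, te, be, ts,
      bs, tp, bp, hzt, map_zero]
    generalize f.ω 2 (B z y) = φ at *
    generalize f.ω 0 (B z y) = φ₀ at *
    generalize f.ω 2 (B (f.v 1) y) = κ at *
    generalize f.ω 0 (B (f.v 1) y) = κ₀ at *
    have hφ0 : φ₀ = -k₁ * φ := by linear_combination ii
    have hκ0 : κ₀ = -k₁ * κ := by linear_combination i
    rw [hφ0, hκ0] at v vi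
    rw [hκ0] at vii
    linear_combination -v - f.coord 1 x * vi - f.coord 1 x ^ 2 * vii
  by_cases hθ0 : θ = 0
  swap
  · left
    intro y hy
    have h2 := LinearMap.congr_fun (functional_mul_eq_zero (hmul y hy) hθ0)
    simp only [LinearMap.comp_apply, LinearMap.flip_apply, LinearMap.zero_apply] at h2
    refine f.eq_zero_of_ker hB hy fun x i => ?_
    fin_cases i
    · change f.ω 0 (B x y) = 0
      rw [h0 y hy, h2, mul_zero]
    · exact f.form₁_apply_ker hB hc hy x
    · exact h2 x
  right
  set k₃ := f.ω 1 (B (f.v 1) (f.v 1)) with hk3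
  set G : Dual K W := f.ω 0 + k₁ • f.ω 2 with hG
  set k₄ := G (B (f.v 1) (f.v 1)) with hk4
  set t' : Dual K V := f.coord 0 + k₁ • f.coord 2 with ht'
  have hGe : ∀ x, G (B e x) = t' x := fun x => rfl
  have hGp : ∀ x, G (B x (f.v 2)) = k₁ * t' x := fun x => by
    have := LinearMap.congr_fun hθ0 x
    simp only [hθ, LinearMap.comp_apply, LinearMap.flip_apply, LinearMap.sub_apply,
      LinearMap.add_apply, LinearMap.smul_apply, smul_eq_mul, LinearMap.zero_apply] at this
    simp only [hG, ht', LinearMap.add_apply, LinearMap.smul_apply, smul_eq_mul]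
    linear_combination this
  have hGn : ∀ y, B e y = 0 → ∀ x, G (B x y) = 0 := fun y hy x => by
    simp only [hG, LinearMap.add_apply, LinearMap.smul_apply, smul_eq_mul, h0 y hy]
    ring
  have t's : t' (f.v 1) = 0 := by simp [ht', ts, bs]
  have t'e : t' e = 1 := by simp [ht', te, be]
  have t'p : t' (f.v 2) = k₁ := by simp [ht', tp, bp]
  have hGs : ∀ x, G (B x (f.v 1)) = f.coord 1 x * k₄ := fun x => by
    obtain ⟨n, hn, hx⟩ := f.decomposition x
    have e1 : G (B n (f.v 1)) = 0 := by rw [f.symm, hGn n hn]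
    have e2 : G (B (f.v 2) (f.v 1)) = 0 := by rw [f.symm, hGp, t's, mul_zero]
    conv_lhs => rw [hx]
    simp only [map_add, map_smul, LinearMap.add_apply, LinearMap.smul_apply, smul_eq_mul, e1, e2,
      hGe, t's]
    ring
  -- Subtracting `k₃` and `k₄` times ω₀ removes the multiples of ℓ₀² from ℓ₀ℓ₁ and ℓ₁².
  refine ⟨![f.coord 1, t'], ![f.ω 2, f.ω₀, f.ω 1 - k₃ • f.ω₀, G - k₄ • f.ω₀], ?_, ?_, ?_⟩
  · refine linearIndependent_of_dual_vectors (u := ![f.v 1, e]) ?_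
    intro i j
    fin_cases i <;> fin_cases j <;> simp [as, ae, t's, t'e]
  · intro w hw hi
    have i0 := hi 0
    have i1 := hi 1
    have i2 := hi 2
    have i3 := hi 3
    simp only [Matrix.cons_val, hG, LinearMap.sub_apply, LinearMap.smul_apply, smul_eq_mul,
      LinearMap.add_apply] at i0 i1 i2 i3
    rw [i1, mul_zero, sub_zero] at i2 i3
    rw [i0, mul_zero, add_zero] at i3
    refine f.separates hd hw i1 fun i => ?_
    fin_cases i
    exacts [i3, i2, i0]
  · intro x y
    simp only [Matrix.cons_val, LinearMap.sub_apply, LinearMap.smul_apply, smul_eq_mul]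
    obtain ⟨n, hn, hy⟩ := f.decomposition y
    obtain ⟨p1, p2⟩ := f.form₁_apply hB hc x
    have hF : f.ω 1 (B x y) = f.coord 1 x * t' y + t' x * f.coord 1 y
        + k₃ * (f.coord 1 x * f.coord 1 y) := by
      conv_lhs => rw [hy]
      simp only [map_add, map_smul, smul_eq_mul, apply_e, p1, p2, hk2,
        f.form₁_apply_ker hB hc hn, ← hk1, ← hk3, ht', LinearMap.add_apply, LinearMap.smul_apply]
      ring
    have hGG : G (B x y) = t' x * t' y + k₄ * (f.coord 1 x * f.coord 1 y) := by
      conv_lhs => rw [hy]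
      have : G (B x e) = t' x := by rw [f.symm, hGe]
      simp only [map_add, map_smul, smul_eq_mul, hGs, hGp, hGn n hn, this]
      simp only [ht', LinearMap.add_apply, LinearMap.smul_apply, smul_eq_mul]
      ring
    rw [f.form₀_eq hB, hF, hGG, hc]
    refine ⟨?_, ?_, ?_⟩ <;> ring

end DiagonalFrame

end

end PolyMap

/-! ### One form of rank two: the exceptional case -/

namespace PolyMap

open Module

section

variable {K V W : Type*} [Field K] [AddCommGroup V] [Module K V] [AddCommGroup W] [Module K W]
  {F : Type*} [Field F] [Algebra K F]
  {B : V →ₗ[K] V →ₗ[K] W} {e : V}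

namespace DiagonalFrame

/-- By `kills₀_mul`, the pair (-c `f.ω 2`, `f.ω 1`) of `B x y` is parallel to (`f.coord 1 x`,
`f.coord 2 x`). Hence these two components of a kernel vector are governed by one number. -/
theorem forms_apply_ker (f : DiagonalFrame B e) [Infinite F] (hB : MinorsVanish F B)
    (hc : f.c ≠ 0) {y : V} (hy : B e y = 0) (x : V) :
    f.ω 2 (B x y) = f.ω 2 (B (f.v 1) y) * f.coord 1 x ∧
      f.ω 1 (B x y) = -f.c * f.ω 2 (B (f.v 1) y) * f.coord 2 x := by
  obtain ⟨-, -, -, -, as, bs, -, ap, bp⟩ := f.coord_table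
  obtain ⟨h1, h2⟩ := proportional_of_wedge (a := f.coord 1) (b := f.coord 2)
    (g₀ := -f.c • (f.ω 2 ∘ₗ B.flip y)) (g₁ := f.ω 1 ∘ₗ B.flip y) as bs ap bp (fun x => by
      simp only [LinearMap.comp_apply, LinearMap.flip_apply, LinearMap.smul_apply, smul_eq_mul]
      linear_combination f.kills₀_mul hB hy x) x
  simp only [LinearMap.comp_apply, LinearMap.flip_apply, LinearMap.smul_apply, smul_eq_mul]
    at h1 h2
  refine ⟨?_, by linear_combination h2⟩
  have h3 : f.c * (f.ω 2 (B x y) - f.ω 2 (B (f.v 1) y) * f.coord 1 x) = 0 := by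
    linear_combination -h1
  exact sub_eq_zero.1 ((mul_eq_zero.1 h3).resolve_left hc)

/-- Only the `f.ω 0` entry of the column of `y` is left. In the minor at Te + z, the coefficient of
T is up to sign this entry times the nonzero form a² + cb² in a = `f.coord 1 z`, b = `f.coord 2 z`.
-/
theorem eq_zero_of_form₂ (f : DiagonalFrame B e) [Infinite F] (h2 : (2 : K) ≠ 0)
    (hB : MinorsVanish F B) (hc : f.c ≠ 0) {y : V} (hy : B e y = 0)
    (hμ : f.ω 2 (B (f.v 1) y) = 0) : B y = 0 := by
  obtain ⟨te, ae, be, ts, as, bs, tp, ap, bp⟩ := f.coord_table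
  have hf := f.forms_apply_ker hB hc hy
  simp only [hμ, zero_mul, mul_zero] at hf
  have h0 : ∀ x, f.ω 0 (B x y) = 0 := by
    refine quadratic_mul_functional_eq_zero (g := f.ω 0 ∘ₗ B.flip y) (δ₀ := 1) (δ₁ := 0)
      (δ₂ := f.c) h2 as bs ap bp (by simp) fun z => ?_
    simp only [LinearMap.comp_apply, LinearMap.flip_apply]
    set ι := algebraMap K F with hι
    have key := fun T : F => hB ![f.ω₀, f.ω 1, f.ω 2, f.ω 0] ![f.v 1, f.v 2, e, y] 2
      ![e, z] ![T, 1]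
    obtain ⟨q0, q1, q2⟩ := f.form₀_apply hB z
    simp only [det_fin_four, Matrix.of_apply, Fin.sum_univ_two, Matrix.cons_val, f.kills₀,
      (f.kills hB f.kills₀ hy _).1, q0, q1, q2, fun x => (hf x).1, fun x => (hf x).2,
      e_apply, apply_e, te, ae, be, ts, as, bs, tp, ap, bp, f.coord_ker hy, ← hι, map_zero,
      map_one, map_mul, mul_zero, mul_one, zero_add, add_zero, one_mul] at key
    have h3 : ι ((1 * f.coord 1 z ^ 2 + 0 * (f.coord 1 z * f.coord 2 z)
        + f.c * f.coord 2 z ^ 2) * f.ω 0 (B z y)) = 0 := by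
      simp only [map_add, map_mul, map_pow, map_one, map_zero]
      linear_combination key 0 - key 1
    exact (map_eq_zero ι).1 h3
  refine f.eq_zero_of_ker hB hy fun x i => ?_
  fin_cases i
  exacts [h0 x, (hf x).2, (hf x).1]

/-- By `eq_zero_of_form₂`, ker (B e) modulo the radical is at most a line; if it is one, spanned by
`y₀`, then B involves four variables. A single minor at a general combination of `e`, `y₀`, `f.v 1`,
`f.v 2` determines the structure constants up to `f1`, `g1`, `m1`, which are absorbed into multiples
of ω₀, and `l1`, `l2`, which a shift of the fourth coordinate removes. -/
theorem eq_zero_or_hasExceptionalForm (f : DiagonalFrame B e) [Infinite F] (h2 : (2 : K) ≠ 0)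
    (hB : MinorsVanish F B)
    (hd : ∀ ω : Dual K W, (∀ z, ω (B e z) = 0) → ∃ κ : K, ∀ x y, ω (B x y) = κ * f.ω₀ (B x y))
    (hc : f.c ≠ 0) : (∀ y, B e y = 0 → B y = 0) ∨ HasExceptionalForm B := by
  by_cases hμ : ∀ y, B e y = 0 → f.ω 2 (B (f.v 1) y) = 0
  · exact Or.inl fun y hy => f.eq_zero_of_form₂ h2 hB hc hy (hμ y hy)
  right
  push Not at hμ
  obtain ⟨y₁, hy₁, hne⟩ := hμ
  obtain ⟨te, ae, be, ts, as, bs, tp, ap, bp⟩ := f.coord_table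
  obtain ⟨y₀, hy₀, hy₀1⟩ : ∃ y, B e y = 0 ∧ f.ω 2 (B (f.v 1) y) = 1 :=
    ⟨(f.ω 2 (B (f.v 1) y₁))⁻¹ • y₁, by simp [hy₁], by simp [hne]⟩
  have hyf := f.forms_apply_ker hB hc hy₀
  simp only [hy₀1, one_mul, mul_one] at hyf
  set c := f.c with hcdef
  set f1 := f.ω 1 (B (f.v 1) (f.v 1)) with hf1
  set f2 := f.ω 1 (B (f.v 1) (f.v 2)) with hf2
  set f3 := f.ω 1 (B (f.v 2) (f.v 2)) with hf3
  set g1 := f.ω 2 (B (f.v 1) (f.v 1)) with hg1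
  set g2 := f.ω 2 (B (f.v 1) (f.v 2)) with hg2
  set g3 := f.ω 2 (B (f.v 2) (f.v 2)) with hg3
  set m1 := f.ω 0 (B (f.v 1) (f.v 1)) with hm1
  set m2 := f.ω 0 (B (f.v 1) (f.v 2)) with hm2
  set m3 := f.ω 0 (B (f.v 2) (f.v 2)) with hm3
  set l1 := f.ω 0 (B (f.v 1) y₀) with hl1
  set l2 := f.ω 0 (B (f.v 2) y₀) with hl2
  set γ := f.ω 0 (B y₀ y₀) with hγ
  have cy : ∀ i, f.coord i y₀ = 0 := fun i => f.coord_ker hy₀ i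
  have sps : B (f.v 2) (f.v 1) = B (f.v 1) (f.v 2) := f.symm _ _
  have sys : B y₀ (f.v 1) = B (f.v 1) y₀ := f.symm _ _
  have syp : B y₀ (f.v 2) = B (f.v 2) y₀ := f.symm _ _
  obtain ⟨qs0, qs1, qs2⟩ := f.form₀_apply hB (f.v 1)
  obtain ⟨qp0, qp1, qp2⟩ := f.form₀_apply hB (f.v 2)
  rw [as] at qs1
  rw [bs, mul_zero] at qs2
  rw [ap] at qp1
  rw [bp, mul_one] at qp2
  have qy : ∀ x, f.ω₀ (B x y₀) = 0 := fun x => (f.kills hB f.kills₀ hy₀ x).1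
  have qye : f.ω₀ (B y₀ e) = 0 := (f.form₀_apply hB y₀).1
  have hγc : γ = c ∧ l1 = -f2 ∧ l2 = c * g2 ∧ c * f1 - f3 = 2 * l2 ∧ c * g1 - g3 = 2 * l1 ∧
      c * m2 = l1 * l2 ∧ c * (c * m1 - m3) = c * l1 ^ 2 - l2 ^ 2 := by
    set ι := algebraMap K F with hι
    have key := fun t η β : F => hB ![f.ω₀, f.ω 1, f.ω 2, f.ω 0] ![e, y₀, f.v 1, f.v 2] 4
      ![e, y₀, f.v 1, f.v 2] ![t, η, 1, β]
    simp only [det_fin_four, Matrix.of_apply, Fin.sum_univ_four, Matrix.cons_val, f.kills₀,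
      sps, sys, syp, qs0, qs1, qs2, qp0, qp2, qy, qye, fun x => (hyf x).1, fun x => (hyf x).2,
      e_apply, apply_e, te, ae, be, ts, as, bs, tp, ap, bp, cy, ← hf1, ← hf2, ← hf3, ← hg1, ← hg2,
      ← hg3, ← hm1, ← hm2, ← hm3, ← hl1, ← hl2, ← hγ, ← hι, ← hcdef, map_zero,
      map_one, map_neg, mul_zero, mul_one, zero_add, add_zero, one_mul, sub_zero,
      zero_mul] at key
    -- The point with η = 1, β = 0 serves only to find γ; the points with η = 0, compared first in
    -- `t` and then in β, give everything else.
    obtain ⟨-, a1, -⟩ := coeffs_eq_zero_of_forall (F := F)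
      (c₀ := ι (l1 * g2 - m2 - (l2 - γ * g2))) (c₁ := ι (γ - c + (l1 + f2)))
      (c₂ := 0) (c₃ := 0) (c₄ := 0) (fun t => by
        simp only [map_add, map_sub, map_mul]
        linear_combination -key t 1 0)
    have hβ : ∀ β : F, _ := fun β => coeffs_eq_zero_of_forall (F := F)
      (c₀ := ι (l1 * g2 - m2)
        + ι (l1 * (-f2 - (c * g1 - g3)) + l2 * g2 + (c * m1 - m3)) * β
        + ι (l1 * ((c * f1 - f3) - c * g2) + l2 * (-f2 - (c * g1 - g3))) * β ^ 2
        + ι (l1 * (c * f2) + l2 * ((c * f1 - f3) - c * g2) + c * (c * m1 - m3)) * β ^ 3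
        + ι (l2 * (c * f2) + c ^ 2 * m2) * β ^ 4)
      (c₁ := ι (l1 + f2) + ι (l2 - (c * f1 - f3) + c * g2) * β
        + ι (c * l1 - c * f2 - c * (c * g1 - g3)) * β ^ 2 + ι (c * l2 - c ^ 2 * g2) * β ^ 3
        + 0 * β ^ 4)
      (c₂ := 0) (c₃ := 0) (c₄ := 0) (fun t => by
        simp only [map_add, map_sub, map_mul, map_pow, map_neg]
        linear_combination -key t 0 β)
    obtain ⟨b0, b1, -⟩ := coeffs_eq_zero_of_forall fun β => (hβ β).1
    obtain ⟨d0, d1, d2, d3, -⟩ := coeffs_eq_zero_of_forall fun β => (hβ β).2.1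
    rw [map_eq_zero] at a1 b0 b1 d0 d1 d2 d3
    have e1 : l1 = -f2 := by linear_combination d0
    have e2 : l2 = c * g2 := by
      have : c * (l2 - c * g2) = 0 := by linear_combination d3
      exact sub_eq_zero.1 ((mul_eq_zero.1 this).resolve_left hc)
    have e3 : c * g1 - g3 = 2 * l1 := by
      have : c * (l1 - f2 - (c * g1 - g3)) = 0 := by linear_combination d2
      linear_combination -(mul_eq_zero.1 this).resolve_left hc - e1
    refine ⟨by linear_combination a1 - d0, e1, e2, by linear_combination -d1 - e2, e3, ?_, ?_⟩
    · linear_combination -c * b0 - l1 * e2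
    · linear_combination c * b1 + l2 * e2 + c * l1 * e3 + c * l1 * e1
  obtain ⟨r0, r1, r2, r3, r4, r5, r6⟩ := hγc
  -- The coordinate along `y₀`: zero on `e`, `f.v 1`, `f.v 2`, one at `y₀`.
  set ζ : Dual K V := f.ω 2 ∘ₗ B (f.v 1) - g1 • f.coord 1 - g2 • f.coord 2 with hζ
  have ζs : ζ (f.v 1) = 0 := by simp [hζ, as, bs, ← hg1]
  have ζp : ζ (f.v 2) = 0 := by simp [hζ, ap, bp, ← hg2]
  have ζe : ζ e = 0 := by simp [hζ, ae, be, apply_e, bs]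
  have ζy : ζ y₀ = 1 := by simp [hζ, cy, hy₀1]
  have hdec : ∀ x, ∃ n, B n = 0 ∧
      x = f.coord 0 x • e + f.coord 1 x • f.v 1 + f.coord 2 x • f.v 2 + ζ x • y₀ + n := by
    intro x
    obtain ⟨n, hn, hx⟩ := f.decomposition x
    have hζn : ζ x = f.ω 2 (B (f.v 1) n) := by
      conv_lhs => rw [hx]
      simp only [map_add, map_smul, ζe, ζs, ζp, smul_zero, zero_add]
      simp [hζ, f.coord_ker hn]
    refine ⟨n - ζ x • y₀, f.eq_zero_of_form₂ h2 hB hc ?_ ?_, ?_⟩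
    · simp [hn, hy₀]
    · simp [hζn, hy₀1]
    · conv_lhs => rw [hx]
      abel
  have hbil : ∀ i x z, f.ω i (B x z) =
      f.coord 0 x * f.coord i z + f.coord 0 z * f.coord i x
        - f.coord 0 x * f.coord 0 z * f.coord i e
      + f.coord 1 x * f.coord 1 z * f.ω i (B (f.v 1) (f.v 1))
      + (f.coord 1 x * f.coord 2 z + f.coord 2 x * f.coord 1 z) * f.ω i (B (f.v 1) (f.v 2))
      + f.coord 2 x * f.coord 2 z * f.ω i (B (f.v 2) (f.v 2))
      + (f.coord 1 x * ζ z + ζ x * f.coord 1 z) * f.ω i (B (f.v 1) y₀)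
      + (f.coord 2 x * ζ z + ζ x * f.coord 2 z) * f.ω i (B (f.v 2) y₀)
      + ζ x * ζ z * f.ω i (B y₀ y₀) := by
    intro i x z
    obtain ⟨n, hn, hx⟩ := hdec x
    obtain ⟨k, hk, hz⟩ := hdec z
    have hk' : ∀ u, B u k = 0 := fun u => by rw [f.symm, hk]; rfl
    have ci : ∀ u, f.coord i u = f.coord 0 u * f.coord i e + f.coord 1 u * f.coord i (f.v 1)
        + f.coord 2 u * f.coord i (f.v 2) := fun u => by
      obtain ⟨n, hn, hu⟩ := f.decomposition u
      conv_lhs => rw [hu]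
      simp only [map_add, map_smul, smul_eq_mul, f.coord_ker hn, add_zero]
    rw [ci x, ci z]
    conv_lhs => rw [hx, hz]
    simp only [map_add, map_smul, LinearMap.add_apply, LinearMap.smul_apply, smul_eq_mul, hn, hk',
      apply_e, e_apply, cy, sps, sys, syp, LinearMap.zero_apply, map_zero]
    ring
  -- Completing the square in `f.ω 0 ∘ B`, whose terms in ζ are cζ² + 2 l1 ζ `f.coord 1` + 2 l2 ζ
  -- `f.coord 2` on the diagonal.
  set ψ : Dual K V := ζ + (c⁻¹ * l1) • f.coord 1 + (c⁻¹ * l2) • f.coord 2 with hψ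
  refine ⟨![f.coord 1, f.coord 2, f.coord 0, -ψ],
    ![f.ω 1 - f1 • f.ω₀, f.ω 2 - (g1 - 2 * (c⁻¹ * l1)) • f.ω₀, f.ω 0 - (m1 - c⁻¹ * l1 ^ 2) • f.ω₀,
      f.ω₀], c, hc, ?_, ?_, ?_⟩
  · refine linearIndependent_of_dual_vectors
      (u := ![f.v 1 - (c⁻¹ * l1) • y₀, f.v 2 - (c⁻¹ * l2) • y₀, e, -y₀]) ?_
    intro i j
    fin_cases i <;> fin_cases j <;> simp [hψ, te, ae, be, ts, as, bs, tp, ap, bp, cy, ζs, ζp, ζe,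
      ζy]
  · intro w hw hi
    have i0 := hi 0
    have i1 := hi 1
    have i2 := hi 2
    have i3 := hi 3
    simp only [Matrix.cons_val, LinearMap.sub_apply, LinearMap.smul_apply, smul_eq_mul]
      at i0 i1 i2 i3
    rw [i3, mul_zero, sub_zero] at i0 i1 i2
    refine f.separates hd hw i3 fun i => ?_
    fin_cases i
    exacts [i2, i0, i1]
  · intro x y
    have hq := f.form₀_eq hB x y
    have hcc : c * c⁻¹ = 1 := mul_inv_cancel₀ hc
    have e1 := hbil 1 x y
    have e2 := hbil 2 x y
    have e0 := hbil 0 x y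
    simp only [ae, be, te, (hyf _).1, (hyf _).2, as, bs, ap, bp, cy, ← hf1, ← hf2, ← hf3, ← hg1,
      ← hg2, ← hg3, ← hm1, ← hm2, ← hm3, ← hl1, ← hl2, ← hγ] at e0 e1 e2
    have s1 : f2 = -l1 := by linear_combination r1
    have s2 : g2 = c⁻¹ * l2 := by rw [r2, ← mul_assoc, inv_mul_cancel₀ hc, one_mul]
    have s3 : f3 = c * f1 - 2 * l2 := by linear_combination -r3
    have s4 : g3 = c * g1 - 2 * l1 := by linear_combination -r4
    have s5 : m2 = c⁻¹ * (l1 * l2) := by rw [← r5, ← mul_assoc, inv_mul_cancel₀ hc, one_mul]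
    have s6 : m3 = c * m1 - l1 ^ 2 + c⁻¹ * l2 ^ 2 := by
      linear_combination -c⁻¹ * r6 + (c * m1 - m3 - l1 ^ 2) * hcc
    rw [r0, s5, s6] at e0
    rw [s1, s3] at e1
    rw [s2, s4] at e2
    simp only [Matrix.cons_val, LinearMap.sub_apply, LinearMap.smul_apply, LinearMap.neg_apply,
      smul_eq_mul, hψ, LinearMap.add_apply]
    rw [e0, e1, e2, hq, ← hcdef]
    refine ⟨?_, ?_, ?_, ?_⟩
    · linear_combination (l1 * (f.coord 1 x * f.coord 2 y + f.coord 2 x * f.coord 1 y)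
        + 2 * l2 * (f.coord 2 x * f.coord 2 y)) * hcc
    · linear_combination 2 * l1 * (f.coord 2 x * f.coord 2 y) * hcc
    · linear_combination (l1 ^ 2 * (f.coord 2 x * f.coord 2 y)
        - c⁻¹ * l1 ^ 2 * (f.coord 1 x * f.coord 1 y)
        - c⁻¹ * l1 * l2 * (f.coord 1 x * f.coord 2 y + f.coord 2 x * f.coord 1 y)
        - c⁻¹ * l2 ^ 2 * (f.coord 2 x * f.coord 2 y)
        - l1 * (f.coord 1 x * ζ y + ζ x * f.coord 1 y)
        - l2 * (f.coord 2 x * ζ y + ζ x * f.coord 2 y)) * hcc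
    · ring

end DiagonalFrame

theorem symmetric_classification [FiniteDimensional K V] [Infinite F] (h2 : (2 : K) ≠ 0)
    (hr : finrank K (LinearMap.range (B e)) = 3) (hS : ∀ x y, B x y = B y x) (he : B e e ≠ 0)
    (hB : MinorsVanish F B) :
    finrank K (imageSpan B) ≤ 3 ∨ finrank K (LinearMap.range B) = 3 ∨ HasBinaryForm B ∨
      HasExceptionalForm B := by
  by_cases hall : ∀ ω : Dual K W, (∀ z, ω (B e z) = 0) → ∀ x y, ω (B x y) = 0
  · exact Or.inl (finrank_imageSpan_le hr hall)
  push Not at hall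
  obtain ⟨ω, hω, hne⟩ := hall
  obtain ⟨f₀, ω₀, hk, h0, hss, hsp⟩ := exists_symmetric_frame h2 hr hS he hB hω hne
  let f : DiagonalFrame B e := ⟨f₀, ω₀, _, hS, h0, hk, hss, hsp, rfl⟩
  have hrad : (∀ y, B e y = 0 → B y = 0) → finrank K (LinearMap.range B) = 3 := fun h =>
    finrank_range_eq hr h fun y hy => by rw [hS, hy]; rfl
  by_cases hd : ∀ ω' : Dual K W, (∀ z, ω' (B e z) = 0) →
      ∃ κ : K, ∀ x y, ω' (B x y) = κ * f.ω₀ (B x y)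
  · rcases eq_or_ne f.c 0 with hc | hc
    · rcases f.eq_zero_or_hasBinaryForm hB hd hc with h | h
      · exact Or.inr (Or.inl (hrad h))
      · exact Or.inr (Or.inr (Or.inl h))
    · rcases f.eq_zero_or_hasExceptionalForm h2 hB hd hc with h | h
      · exact Or.inr (Or.inl (hrad h))
      · exact Or.inr (Or.inr (Or.inr h))
  · push Not at hd
    obtain ⟨ω', hω', hnp⟩ := hd
    exact Or.inr (Or.inl (hrad fun y hy => f.eq_zero_of_two_forms h2 hB hω' hnp hy))

end

end PolyMap

/-! ### Invertible matrices from functionals; bounds on the number of rows -/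

namespace PolyMap

open Module

section

variable {K V W : Type*} [Field K] [AddCommGroup V] [Module K V] [AddCommGroup W] [Module K W]
  {B : V →ₗ[K] V →ₗ[K] W}

/-- Functionals on the whole space that restrict to coordinates on a subspace. -/
theorem exists_dual_coordinates (I : Submodule K W) [FiniteDimensional K I] :
    ∃ (ω : Fin (finrank K I) → Dual K W) (b : Fin (finrank K I) → W), (∀ i, b i ∈ I) ∧
      (∀ i j, ω i (b j) = if i = j then 1 else 0) ∧ ∀ w ∈ I, (∀ i, ω i w = 0) → w = 0 := by
  let b := finBasis K I
  choose ω hω using fun i => (b.coord i).exists_extend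
  have hv : ∀ i (w : I), ω i w = b.coord i w := fun i w => LinearMap.congr_fun (hω i) w
  refine ⟨ω, fun i => b i, fun i => (b i).2, fun i j => ?_, fun w hw h => ?_⟩
  · rw [hv, Basis.coord_apply, b.repr_self, Finsupp.single_apply]
    simp only [eq_comm]
  · have : (⟨w, hw⟩ : I) = 0 := b.ext_elem fun i => by
      rw [map_zero, Finsupp.zero_apply, ← Basis.coord_apply, ← hv, h]
    simpa using this

theorem exists_mem_dual_of_separates {I : Submodule K W} [FiniteDimensional K I] {r : ℕ}
    {ω : Fin r → Dual K W} (hI : ∀ w ∈ I, (∀ i, ω i w = 0) → w = 0) (hr : r ≤ finrank K I) :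
    ∃ u : Fin r → W, (∀ j, u j ∈ I) ∧ ∀ i j, ω i (u j) = if i = j then 1 else 0 := by
  let Φ : I →ₗ[K] (Fin r → K) := LinearMap.pi ω ∘ₗ I.subtype
  have hinj : Function.Injective Φ := by
    rw [← LinearMap.ker_eq_bot, LinearMap.ker_eq_bot']
    exact fun w hw => Subtype.ext (hI w w.2 fun i => congrFun hw i)
  have hd : finrank K I = finrank K (Fin r → K) :=
    le_antisymm (LinearMap.finrank_le_finrank_of_injective hinj) (by simpa using hr)
  have hs := (LinearMap.injective_iff_surjective_of_finrank_eq_finrank hd).1 hinj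
  choose u hu using fun j => hs (Pi.single j 1)
  refine ⟨fun j => u j, fun j => (u j).2, fun i j => ?_⟩
  have := congrFun (hu j) i
  simpa [Φ, Pi.single_apply] using this

theorem linearIndependent_of_separates {I : Submodule K W} [FiniteDimensional K I] {r : ℕ}
    {ω : Fin r → Dual K W} (hI : ∀ w ∈ I, (∀ i, ω i w = 0) → w = 0) (hr : r ≤ finrank K I) :
    LinearIndependent K ω := by
  obtain ⟨u, -, hu⟩ := exists_mem_dual_of_separates hI hr
  exact linearIndependent_of_dual_vectors hu

/-- `I` meets the common kernel of the `ω i` trivially, so some complement `D` of that kernel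
contains `I`. The rows after the first `r` are coordinates on the kernel composed with the
projection along `D`, hence vanish on `I`. -/
theorem exists_general_linear_rows {m r : ℕ} {I : Submodule K (Fin m → K)}
    {ω : Fin r → Dual K (Fin m → K)} (hω : LinearIndependent K ω)
    (hI : ∀ w ∈ I, (∀ i, ω i w = 0) → w = 0) :
    r ≤ m ∧ ∃ S : Matrix.GeneralLinearGroup (Fin m) K,
      (∀ (i : Fin m) (h : (i : ℕ) < r) w, (S.1.mulVec w) i = ω ⟨i, h⟩ w) ∧
      ∀ i : Fin m, r ≤ (i : ℕ) → ∀ w ∈ I, (S.1.mulVec w) i = 0 := by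
  have hrm : r ≤ m := by
    have := hω.fintype_card_le_finrank
    simpa using this
  refine ⟨hrm, ?_⟩
  set Ω : (Fin m → K) →ₗ[K] (Fin r → K) := LinearMap.pi ω with hΩ
  have hker : LinearMap.ker Ω = (Submodule.span K (Set.range ω)).dualCoannihilator := by
    ext w
    rw [Submodule.mem_dualCoannihilator, LinearMap.mem_ker]
    refine ⟨fun h φ hφ => ?_, fun h => funext fun i => h _ (Submodule.subset_span ⟨i, rfl⟩)⟩
    induction hφ using Submodule.span_induction with
    | mem φ hφ =>
      obtain ⟨i, rfl⟩ := hφ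
      exact congrFun h i
    | zero => rfl
    | add φ ψ _ _ h₁ h₂ => rw [LinearMap.add_apply, h₁, h₂, add_zero]
    | smul c φ _ h₁ => rw [LinearMap.smul_apply, h₁, smul_zero]
  have hC : finrank K (LinearMap.ker Ω) = m - r := by
    have := Subspace.finrank_add_finrank_dualCoannihilator_eq (Submodule.span K (Set.range ω))
    rw [← hker, finrank_span_eq_card hω, Fintype.card_fin, finrank_fin_fun] at this
    omega
  have hdis : Disjoint I (LinearMap.ker Ω) := by
    rw [Submodule.disjoint_def]
    exact fun w hw hk => hI w hw fun i => congrFun hk i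
  obtain ⟨D, hD, hc⟩ := hdis.exists_isCompl
  let c := finBasisOfFinrankEq K _ hC
  let π := Submodule.projectionOnto _ _ hc.symm
  let Φ : (Fin m → K) →ₗ[K] (Fin m → K) := LinearMap.pi fun i =>
    if h : (i : ℕ) < r then ω ⟨i, h⟩ else c.coord ⟨i - r, by omega⟩ ∘ₗ π
  have hlt : ∀ (i : Fin m) (h : (i : ℕ) < r) w, Φ w i = ω ⟨i, h⟩ w := fun i h w => by
    simp only [Φ, LinearMap.pi_apply, dif_pos h]
  have hge : ∀ (i : Fin m) (h : ¬ (i : ℕ) < r) w,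
      Φ w i = c.coord ⟨i - r, by omega⟩ (π w) := fun i h w => by
    simp only [Φ, LinearMap.pi_apply, dif_neg h, LinearMap.comp_apply]
  have hinj : Function.Injective Φ := by
    rw [← LinearMap.ker_eq_bot, LinearMap.ker_eq_bot']
    intro w hw
    have hk : w ∈ LinearMap.ker Ω := by
      ext i
      have := hlt ⟨i, by omega⟩ i.2 w
      rw [hw] at this
      exact this.symm
    have hπ : π w = 0 := c.ext_elem fun i => by
      have h := hge ⟨i + r, by omega⟩ (by simp) w
      rw [hw] at h
      rw [map_zero, Finsupp.zero_apply, ← Basis.coord_apply]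
      refine Eq.trans ?_ h.symm
      congr 3
      ext; simp
    rw [Submodule.projectionOnto_apply_of_mem_left _ hk] at hπ
    simpa using hπ
  have hu : IsUnit (LinearMap.toMatrix' Φ) := by
    rw [← Matrix.mulVec_injective_iff_isUnit]
    convert hinj using 1
    exact funext fun w => LinearMap.toMatrix'_mulVec Φ w
  refine ⟨hu.unit, fun i h w => ?_, fun i h w hw => ?_⟩
  · rw [IsUnit.unit_spec, LinearMap.toMatrix'_mulVec, hlt i h]
  · rw [IsUnit.unit_spec, LinearMap.toMatrix'_mulVec, hge i (by omega)]
    have : π w = 0 := by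
      rw [← LinearMap.mem_ker, Submodule.ker_projectionOnto]
      exact hD hw
    rw [this, map_zero]

theorem exists_general_linear_basis {n r : ℕ} {l : Fin r → Dual K (Fin n → K)}
    (hl : LinearIndependent K l) :
    r ≤ n ∧ ∃ T : Matrix.GeneralLinearGroup (Fin n) K,
      ∀ (i : Fin n) (h : (i : ℕ) < r) x, l ⟨i, h⟩ (T.1.mulVec x) = x i := by
  obtain ⟨hrn, S, hS, -⟩ := exists_general_linear_rows (I := ⊥) hl (by simp)
  refine ⟨hrn, S⁻¹, fun i h x => ?_⟩
  rw [← hS i h, Matrix.mulVec_mulVec, ← Units.val_mul, mul_inv_cancel, Units.val_one,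
    Matrix.one_mulVec]

theorem exists_dual_vectors {n r : ℕ} {l : Fin r → Dual K (Fin n → K)}
    (hl : LinearIndependent K l) :
    ∃ u : Fin r → Fin n → K, ∀ i j, l i (u j) = if i = j then 1 else 0 := by
  obtain ⟨hr, T, hT⟩ := exists_general_linear_basis hl
  refine ⟨fun j => T.1.mulVec (Pi.single (Fin.castLE hr j) 1), fun i j => ?_⟩
  refine (hT (Fin.castLE hr i) i.2 _).trans ?_
  simp [Pi.single_apply]

theorem exists_functionals_of_range [FiniteDimensional K V] {r : ℕ}
    (hr : finrank K (LinearMap.range B) = r) :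
    ∃ (l : Fin r → Dual K V) (v : Fin r → V), (∀ i j, l i (v j) = if i = j then 1 else 0) ∧
      ∀ x, B x = 0 ↔ ∀ i, l i x = 0 := by
  subst hr
  obtain ⟨ω, b, hb, hωb, hI⟩ := exists_dual_coordinates (LinearMap.range B)
  choose v hv using hb
  refine ⟨fun i => ω i ∘ₗ B, v, fun i j => by simp [hv, hωb], fun x => ⟨fun h i => by simp [h],
    fun h => hI _ ⟨x, rfl⟩ h⟩⟩

theorem apply_eq_sum_of_radical {r : ℕ} {l : Fin r → Dual K V} {v : Fin r → V}
    (hlv : ∀ i j, l i (v j) = if i = j then 1 else 0) (hl : ∀ x, (∀ i, l i x = 0) → B x = 0)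
    (hB : ∀ x, (∀ i, l i x = 0) → ∀ y, B y x = 0) (x y : V) :
    B x y = ∑ i, ∑ j, (l i x * l j y) • B (v i) (v j) := by
  have hd : ∀ x, B (x - ∑ i, l i x • v i) = 0 := fun x => by
    refine hl _ fun i => ?_
    simp [hlv]
  have hx : ∀ y, B x y = ∑ i, l i x • B (v i) y := fun y => by
    have := LinearMap.congr_fun (hd x) y
    simpa [sub_eq_zero] using this
  have hy : ∀ z, B z y = ∑ i, l i y • B z (v i) := fun z => by
    have := hB (y - ∑ i, l i y • v i) (fun i => by simp [hlv]) z
    simpa [sub_eq_zero] using this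
  rw [hx]
  refine Finset.sum_congr rfl fun i _ => ?_
  rw [hy, Finset.smul_sum]
  exact Finset.sum_congr rfl fun j _ => by rw [smul_smul]

theorem finrank_imageSpan_le_six {s : Fin 6 → W} (h : ∀ x y, B x y ∈ Submodule.span K (Set.range s)) :
    finrank K (imageSpan B) ≤ 6 := by
  have hle : imageSpan B ≤ Submodule.span K (Set.range s) := by
    rw [imageSpan, Submodule.span_le]
    rintro _ ⟨x, y, rfl⟩
    exact h x y
  have := FiniteDimensional.span_of_finite K (Set.finite_range s)
  exact (Submodule.finrank_mono hle).trans ((finrank_range_le_card s).trans (by simp))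

/-- `B` factors through the symmetric square of a 3-space. -/
theorem finrank_imageSpan_le_six_of_symmetric [FiniteDimensional K V]
    (hr : finrank K (LinearMap.range B) = 3) (hS : ∀ x y, B x y = B y x) :
    finrank K (imageSpan B) ≤ 6 := by
  obtain ⟨l, v, hlv, hl⟩ := exists_functionals_of_range hr
  refine finrank_imageSpan_le_six (s := ![B (v 0) (v 0), B (v 0) (v 1), B (v 0) (v 2),
    B (v 1) (v 1), B (v 1) (v 2), B (v 2) (v 2)]) fun x y => ?_
  have hm := fun i => Submodule.subset_span (R := K) (Set.mem_range_self (f := ![B (v 0) (v 0),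
    B (v 0) (v 1), B (v 0) (v 2), B (v 1) (v 1), B (v 1) (v 2), B (v 2) (v 2)]) i)
  rw [apply_eq_sum_of_radical hlv (fun x => (hl x).2)
    (fun x h y => (hS y x).trans (by rw [(hl x).2 h]; rfl)) x y]
  refine sum_mem fun i _ => ?_
  refine sum_mem fun j _ => Submodule.smul_mem _ _ ?_
  fin_cases i <;> fin_cases j
  exacts [hm 0, hm 1, hm 2, (hS (v 1) (v 0)).symm.subst (motive := (· ∈ _)) (hm 1), hm 3, hm 4,
    (hS (v 2) (v 0)).symm.subst (motive := (· ∈ _)) (hm 2),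
    (hS (v 2) (v 1)).symm.subst (motive := (· ∈ _)) (hm 4), hm 5]

/-- `B` factors through the exterior square of a 4-space. -/
theorem finrank_imageSpan_le_six_of_alternating [FiniteDimensional K V]
    (hr : finrank K (LinearMap.range B) = 4) (hA : ∀ x, B x x = 0) :
    finrank K (imageSpan B) ≤ 6 := by
  have hneg : ∀ x y, B x y = -B y x := fun x y => by
    have := hA (x + y)
    simp only [map_add, LinearMap.add_apply, hA, zero_add, add_zero] at this
    exact eq_neg_of_add_eq_zero_right this
  obtain ⟨l, v, hlv, hl⟩ := exists_functionals_of_range hr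
  refine finrank_imageSpan_le_six (s := ![B (v 0) (v 1), B (v 0) (v 2), B (v 0) (v 3),
    B (v 1) (v 2), B (v 1) (v 3), B (v 2) (v 3)]) fun x y => ?_
  have hm := fun i => Submodule.subset_span (R := K) (Set.mem_range_self (f := ![B (v 0) (v 1),
    B (v 0) (v 2), B (v 0) (v 3), B (v 1) (v 2), B (v 1) (v 3), B (v 2) (v 3)]) i)
  have hn := fun i => Submodule.neg_mem _ (hm i)
  have h0 := fun i => (hA (v i)).symm ▸ Submodule.zero_mem (Submodule.span K (Set.range
    ![B (v 0) (v 1), B (v 0) (v 2), B (v 0) (v 3), B (v 1) (v 2), B (v 1) (v 3), B (v 2) (v 3)]))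
  rw [apply_eq_sum_of_radical hlv (fun x => (hl x).2)
    (fun x h y => (hneg y x).trans (by rw [(hl x).2 h]; simp)) x y]
  refine sum_mem fun i _ => ?_
  refine sum_mem fun j _ => Submodule.smul_mem _ _ ?_
  fin_cases i <;> fin_cases j
  exacts [h0 0, hm 0, hm 1, hm 2, hneg (v 1) (v 0) ▸ hn 0, h0 1, hm 3, hm 4,
    hneg (v 2) (v 0) ▸ hn 1, hneg (v 2) (v 1) ▸ hn 3, h0 2, hm 5,
    hneg (v 3) (v 0) ▸ hn 2, hneg (v 3) (v 1) ▸ hn 4, hneg (v 3) (v 2) ▸ hn 5, h0 3]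

end

end PolyMap

/-! ### The polar map of a quadratic homogeneous map -/

namespace PolyMap

open Module MvPolynomial

section

variable {K : Type*} [Field K] {m n : ℕ}

/-- The bilinear map whose value at `(x, y)` is the Jacobian matrix at `x` applied to `y`. -/
noncomputable def polar (H : Map K m n) :
    (Fin n → K) →ₗ[K] (Fin n → K) →ₗ[K] (Fin m → K) :=
  LinearMap.mk₂ K
    (fun x y k => ∑ l, ∑ j, x l * y j * coeff 0 (pderiv l (pderiv j (H k))))
    (fun x x' y => by
      ext k
      simp only [Pi.add_apply, add_mul, Finset.sum_add_distrib])
    (fun c x y => by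
      ext k
      simp only [Pi.smul_apply, smul_eq_mul, Finset.mul_sum, mul_assoc])
    (fun x y y' => by
      ext k
      simp only [Pi.add_apply, add_mul, mul_add, Finset.sum_add_distrib])
    (fun c x y => by
      ext k
      simp only [Pi.smul_apply, smul_eq_mul, Finset.mul_sum]
      exact Finset.sum_congr rfl fun l _ => Finset.sum_congr rfl fun j _ => by ring)

theorem polar_apply (H : Map K m n) (x y : Fin n → K) (k : Fin m) :
    polar H x y k = ∑ l, ∑ j, x l * y j * coeff 0 (pderiv l (pderiv j (H k))) := rfl

theorem polar_single (H : Map K m n) (l j : Fin n) (k : Fin m) :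
    polar H (Pi.single l 1) (Pi.single j 1) k = coeff 0 (pderiv l (pderiv j (H k))) := by
  simp [polar_apply, Pi.single_apply]

theorem coeff_pderiv_pderiv (f : MvPolynomial (Fin n) K) (l j : Fin n) :
    coeff 0 (pderiv l (pderiv j f)) =
      coeff (Finsupp.single l 1 + Finsupp.single j 1) f * (if l = j then 2 else 1) := by
  rw [coeff_pderiv, coeff_pderiv]
  split_ifs with h
  · subst h
    norm_num [one_add_one_eq_two]
  · simp [h]

theorem polar_symm (H : Map K m n) (x y : Fin n → K) : polar H x y = polar H y x := by
  ext k
  rw [polar_apply, polar_apply, Finset.sum_comm]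
  refine Finset.sum_congr rfl fun l _ => Finset.sum_congr rfl fun j _ => ?_
  rw [coeff_pderiv_pderiv, coeff_pderiv_pderiv, add_comm, mul_comm (x j)]
  simp only [eq_comm]

/-- Second derivatives ∂²/∂xⱼ² carry a factor 2, and the mixed terms cancel in pairs by symmetry. -/
theorem polar_self (h2 : (2 : K) = 0) (H : Map K m n) (x : Fin n → K) : polar H x x = 0 := by
  have hz : ∀ j, polar H (Pi.single j 1) (Pi.single j 1) = 0 := fun j => by
    ext k
    rw [polar_single, coeff_pderiv_pderiv, if_pos rfl, h2, mul_zero, Pi.zero_apply]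
  have hx : x = ∑ j, x j • (Pi.single j 1 : Fin n → K) := by
    ext i
    simp [Finset.sum_apply, Pi.single_apply]
  have key : ∀ s : Finset (Fin n), polar H (∑ j ∈ s, x j • Pi.single j 1)
      (∑ j ∈ s, x j • Pi.single j 1) = 0 := fun s => by
    classical
    induction s using Finset.induction_on with
    | empty => simp
    | insert a s ha ih =>
      rw [Finset.sum_insert ha]
      simp only [map_add, LinearMap.add_apply, ih, map_smul, LinearMap.smul_apply, hz, smul_zero,
        zero_add, add_zero]
      rw [polar_symm H (Pi.single a 1), ← two_smul K, h2, zero_smul]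
  rw [hx]
  exact key _

theorem pderiv_pderiv_of_isHomogeneous {f : MvPolynomial (Fin n) K} (hf : f.IsHomogeneous 2)
    (l j : Fin n) : pderiv l (pderiv j f) = C (coeff 0 (pderiv l (pderiv j f))) := by
  rw [← totalDegree_eq_zero_iff_eq_C, totalDegree_zero_iff_isHomogeneous]
  exact (hf.pderiv (i := j)).pderiv (i := l)

theorem pderiv_of_isHomogeneous {f : MvPolynomial (Fin n) K} (hf : f.IsHomogeneous 2)
    (j : Fin n) : pderiv j f = ∑ l, C (coeff 0 (pderiv l (pderiv j f))) * X l := by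
  have h := (hf.pderiv (i := j)).sum_X_mul_pderiv
  rw [Nat.add_one_sub_one, one_smul] at h
  conv_lhs => rw [← h]
  exact Finset.sum_congr rfl fun l _ => by rw [← pderiv_pderiv_of_isHomogeneous hf, mul_comm]

theorem jacobian_apply {H : Map K m n} (hH : IsQuadraticHomogeneous H) (i : Fin m) (j : Fin n) :
    jacobian H i j = ∑ l, C (polar H (Pi.single l 1) (Pi.single j 1) i) * X l := by
  simp only [polar_single]
  exact pderiv_of_isHomogeneous (hH i) j

theorem pderiv_substLinear (T : Matrix (Fin n) (Fin n) K) (j : Fin n)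
    (f : MvPolynomial (Fin n) K) :
    pderiv j (substLinear T f) = ∑ p, C (T p j) * substLinear T (pderiv p f) := by
  induction f using MvPolynomial.induction_on with
  | C a => simp [substLinear, ← algebraMap_eq]
  | add f g hf hg =>
    simp only [substLinear, map_add, mul_add, Finset.sum_add_distrib] at hf hg ⊢
    rw [hf, hg]
  | mul_X f i hf =>
    have hX : pderiv j (∑ l, C (T i l) * X l : MvPolynomial (Fin n) K) = C (T i j) := by
      simp [pderiv_X, Pi.single_apply]
    simp only [substLinear, map_mul, aeval_X, pderiv_mul, map_add, mul_add,
      Finset.sum_add_distrib, pderiv_X] at hf ⊢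
    rw [hf, hX, Finset.sum_mul]
    congr 1
    · exact Finset.sum_congr rfl fun p _ => by rw [mul_assoc]
    · rw [Finset.sum_eq_single i]
      · simp [mul_comm]
      · intro b _ hb
        simp [hb.symm]
      · simp

theorem isQuadraticHomogeneous_transform {H : Map K m n} (hH : IsQuadraticHomogeneous H)
    (S : Matrix (Fin m) (Fin m) K) (T : Matrix (Fin n) (Fin n) K) :
    IsQuadraticHomogeneous (transform S T H) := fun i => by
  refine IsHomogeneous.sum _ _ _ fun k _ => IsHomogeneous.C_mul ?_ _
  have := (hH k).aeval (g := fun j => ∑ l, C (T j l) * X l) (n := 1) fun j =>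
    IsHomogeneous.sum _ _ _ fun l _ => isHomogeneous_C_mul_X _ _
  simpa [substLinear] using this

theorem polar_transform {H : Map K m n} (hH : IsQuadraticHomogeneous H)
    (S : Matrix (Fin m) (Fin m) K) (T : Matrix (Fin n) (Fin n) K) (x y : Fin n → K) :
    polar (transform S T H) x y = S.mulVec (polar H (T.mulVec x) (T.mulVec y)) := by
  have h : polar (transform S T H) =
      ((polar H).compl₁₂ T.mulVecLin T.mulVecLin).compr₂ S.mulVecLin := by
    refine LinearMap.ext_basis (Pi.basisFun K (Fin n)) (Pi.basisFun K (Fin n)) fun l j => ?_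
    ext i
    rw [Pi.basisFun_apply, Pi.basisFun_apply, polar_single]
    simp only [LinearMap.compr₂_apply, LinearMap.compl₁₂_apply, Matrix.mulVecLin_apply, transform, map_sum, pderiv_C_mul,
      pderiv_substLinear, Matrix.mulVec_single_one, Matrix.mulVec, dotProduct, polar_apply,
      coeff_sum, coeff_C_mul, Matrix.col_apply]
    refine Finset.sum_congr rfl fun k _ => ?_
    congr 1
    rw [Finset.sum_comm]
    refine Finset.sum_congr rfl fun p _ => ?_
    rw [Finset.mul_sum]
    refine Finset.sum_congr rfl fun q _ => ?_
    rw [pderiv_pderiv_of_isHomogeneous (hH k)]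
    simp only [substLinear, aeval_C, algebraMap_eq, coeff_C, if_true]
    ring
  rw [h]
  rfl

theorem onlyFirstRows_of_polar {H : Map K m n} (hH : IsQuadraticHomogeneous H) {k : ℕ}
    (h : ∀ i : Fin m, k ≤ (i : ℕ) → ∀ x y, polar H x y i = 0) : OnlyFirstRows k H := by
  intro i hi
  ext1 j
  rw [Matrix.row_apply, jacobian_apply hH]
  simp [h i hi]

theorem col_jacobian_eq_zero_iff {H : Map K m n} (hH : IsQuadraticHomogeneous H) (j : Fin n) :
    (jacobian H).col j = 0 ↔ polar H (Pi.single j 1) = 0 := by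
  constructor
  · intro h
    refine (Pi.basisFun K (Fin n)).ext fun l => ?_
    ext i
    have hi : pderiv j (H i) = 0 := congrFun h i
    rw [Pi.basisFun_apply, polar_symm, polar_single, hi, map_zero, coeff_zero]
    rfl
  · intro h
    ext1 i
    rw [Matrix.col_apply, jacobian_apply hH]
    simp [polar_symm H _ (Pi.single j 1), h]

/-- Euler's identity 2H = ∑ xⱼ ∂ⱼH recovers `H` from its polar map. In characteristic 2 squares are
lost, which is why `FourRowsCharTwo` prescribes only Jacobians. -/
theorem eq_sum_of_isHomogeneous (h2 : (2 : K) ≠ 0) {H : Map K m n}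
    (hH : IsQuadraticHomogeneous H) (i : Fin m) :
    H i = C (1 / 2) *
      ∑ j, X j * ∑ l, C (polar H (Pi.single l 1) (Pi.single j 1) i) * X l := by
  have h := (hH i).sum_X_mul_pderiv
  have h' : C (1 / 2 : K) * (2 • H i) = H i := by
    rw [nsmul_eq_mul, ← mul_assoc, Nat.cast_ofNat, ← map_ofNat C 2, ← C_mul,
      one_div_mul_cancel h2, C_1, one_mul]
  rw [← h', ← h]
  congr 1
  exact Finset.sum_congr rfl fun j _ => by rw [← jacobian_apply hH]; rfl

end

end PolyMap

/-! ### From bilinear normal forms to polynomial normal forms -/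

namespace PolyMap

open Module MvPolynomial

section

variable {K : Type*} [Field K] {m n : ℕ} {H : Map K m n}

theorem two_eq_zero_iff_ringChar : (2 : K) = 0 ↔ ringChar K = 2 := by
  refine ⟨fun h => ?_, fun h => ?_⟩
  · have hd : ringChar K ∣ 2 := (ringChar.spec K 2).1 (by exact_mod_cast h)
    exact ((Nat.dvd_prime Nat.prime_two).1 hd).resolve_left CharP.ringChar_ne_one
  · have := (ringChar.spec K 2).2 (by rw [h])
    exact_mod_cast this

theorem exists_transform (hH : IsQuadraticHomogeneous H) {r s : ℕ}
    {ω : Fin r → Dual K (Fin m → K)} {l : Fin s → Dual K (Fin n → K)}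
    (hω : LinearIndependent K ω) (hI : Separates (polar H) ω) (hl : LinearIndependent K l) :
    ∃ (hr : r ≤ m) (hs : s ≤ n) (S : Matrix.GeneralLinearGroup (Fin m) K)
      (T : Matrix.GeneralLinearGroup (Fin n) K), OnlyFirstRows r (transform S.1 T.1 H) ∧
      (∀ i x y, polar (transform S.1 T.1 H) x y (Fin.castLE hr i) =
        ω i (polar H (T.1.mulVec x) (T.1.mulVec y))) ∧
      ∀ i x, l i (T.1.mulVec x) = x (Fin.castLE hs i) := by
  obtain ⟨hr, S, hS, hS'⟩ := exists_general_linear_rows hω hI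
  obtain ⟨hs, T, hT⟩ := exists_general_linear_basis hl
  refine ⟨hr, hs, S, T, ?_, fun i x y => ?_, fun i x => ?_⟩
  · refine onlyFirstRows_of_polar (isQuadraticHomogeneous_transform hH _ _) fun i hi x y => ?_
    rw [polar_transform hH]
    exact hS' i hi _ (Submodule.subset_span ⟨_, _, rfl⟩)
  · rw [polar_transform hH]
    exact hS (Fin.castLE hr i) i.2 _
  · exact hT (Fin.castLE hs i) i.2 x

theorem exists_separating_family (B : (Fin n → K) →ₗ[K] (Fin n → K) →ₗ[K] (Fin m → K)) :
    ∃ ω : Fin (finrank K (imageSpan B)) → Dual K (Fin m → K),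
      LinearIndependent K ω ∧ Separates B ω := by
  obtain ⟨ω, b, -, hb, hI⟩ := exists_dual_coordinates (imageSpan B)
  exact ⟨ω, linearIndependent_of_dual_vectors hb, hI⟩

theorem OnlyFirstRows.mono {k k' : ℕ} (h : OnlyFirstRows k H) (hk : k ≤ k') :
    OnlyFirstRows k' H := fun i hi => h i (hk.trans hi)

theorem exists_threeRows (hH : IsQuadraticHomogeneous H)
    (h : finrank K (imageSpan (polar H)) ≤ 3) :
    ∃ (S : Matrix.GeneralLinearGroup (Fin m) K) (T : Matrix.GeneralLinearGroup (Fin n) K),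
      ThreeRows (transform S.1 T.1 H) := by
  obtain ⟨ω, hω, hI⟩ := exists_separating_family (polar H)
  obtain ⟨-, -, S, T, hST, -⟩ := exists_transform (l := ![]) hH hω hI linearIndependent_empty_type
  exact ⟨S, T, hST.mono h⟩

theorem exists_fewCols (hH : IsQuadraticHomogeneous H) {r : ℕ}
    (hr : finrank K (LinearMap.range (polar H)) = r)
    (h6 : finrank K (imageSpan (polar H)) ≤ 6) :
    ∃ (S : Matrix.GeneralLinearGroup (Fin m) K) (T : Matrix.GeneralLinearGroup (Fin n) K),
      OnlyFirstRows 6 (transform S.1 T.1 H) ∧ OnlyFirstCols r (transform S.1 T.1 H) ∧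
        FirstColsNonzero r (transform S.1 T.1 H) := by
  obtain ⟨ω, hω, hI⟩ := exists_separating_family (polar H)
  obtain ⟨l, v, hlv, hl⟩ := exists_functionals_of_range hr
  obtain ⟨hm, hn, S, T, hST, hS, hT⟩ := exists_transform hH hω hI
    (linearIndependent_of_dual_vectors hlv)
  have hH' := isQuadraticHomogeneous_transform hH S.1 T.1
  refine ⟨S, T, hST.mono h6, fun j hj => ?_, fun j hj => ?_⟩
  · have h0 : polar H (T.1.mulVec (Pi.single j 1)) = 0 := (hl _).2 fun i => by
      rw [hT, Pi.single_apply, if_neg]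
      rintro rfl
      exact absurd i.2 (not_lt.2 hj)
    rw [col_jacobian_eq_zero_iff hH']
    refine LinearMap.ext fun y => ?_
    rw [polar_transform hH, h0, LinearMap.zero_apply, Matrix.mulVec_zero, LinearMap.zero_apply]
  · rw [ne_eq, col_jacobian_eq_zero_iff hH']
    intro h0
    -- A vanishing column would put this vector in the radical, since the `ω i` separate the values
    -- of the polar map; but its coordinate `l ⟨j, hj⟩` is 1.
    have h1 : polar H (T.1.mulVec (Pi.single j 1)) = 0 := by
      refine LinearMap.ext fun y => ?_
      refine hI _ (Submodule.subset_span ⟨_, _, rfl⟩) fun i => ?_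
      have hy : T.1.mulVec ((T⁻¹).1.mulVec y) = y := by
        rw [Matrix.mulVec_mulVec, ← Units.val_mul, mul_inv_cancel, Units.val_one,
          Matrix.one_mulVec]
      rw [← hy, ← hS, h0]
      rfl
    have := (hl _).1 h1 ⟨j, hj⟩
    rw [hT, show Fin.castLE hn ⟨j, hj⟩ = j from rfl, Pi.single_eq_same] at this
    exact one_ne_zero this

theorem sum_X_mul_single (p q : Fin n) :
    ∑ j, X j * ∑ l, C ((Pi.single l 1 : Fin n → K) p * (Pi.single j 1 : Fin n → K) q) * X l =
      (X p * X q : MvPolynomial (Fin n) K) := by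
  rw [Finset.sum_eq_single q, Finset.sum_eq_single p]
  · simp [mul_comm]
  · intro l _ hl
    simp [hl.symm]
  · simp
  · intro j _ hj
    simp [hj.symm]
  · simp

theorem eq_of_polar {f : MvPolynomial (Fin n) K} (h2 : (2 : K) ≠ 0)
    (hH : IsQuadraticHomogeneous H) {i : Fin m}
    (h : ∑ j, X j * ∑ l, C (polar H (Pi.single l 1) (Pi.single j 1) i) * X l = C 2 * f) :
    H i = f := by
  rw [eq_sum_of_isHomogeneous h2 hH, h, ← mul_assoc, ← C_mul, one_div_mul_cancel h2, C_1, one_mul]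

theorem exists_fourRowsBinary (h2 : (2 : K) ≠ 0) (hH : IsQuadraticHomogeneous H)
    (h4 : 4 ≤ finrank K (imageSpan (polar H))) (h : HasBinaryForm (polar H)) :
    ∃ (S : Matrix.GeneralLinearGroup (Fin m) K) (T : Matrix.GeneralLinearGroup (Fin n) K),
      FourRowsBinary (transform S.1 T.1 H) := by
  obtain ⟨l, ω, hl, hω, hf⟩ := h
  obtain ⟨hm, hn, S, T, hST, hS, hT⟩ := exists_transform hH (linearIndependent_of_separates hω h4)
    hω hl
  have hH' := isQuadraticHomogeneous_transform hH S.1 T.1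
  refine ⟨S, T, fun h => h2 (two_eq_zero_iff_ringChar.2 h), hST, hm, hn, ?_⟩
  have hc : (C 2 : MvPolynomial (Fin n) K) * C (1 / 2) = 1 := by
    rw [← C_mul, mul_one_div_cancel h2, C_1]
  funext i
  fin_cases i
  · rfl
  · refine eq_of_polar h2 hH' ?_
    simp only [Fin.mk_one, hS, hf, hT, sum_X_mul_single, Matrix.cons_val]
    linear_combination -(X (Fin.castLE hn 0)) ^ 2 * hc
  · refine eq_of_polar h2 hH' ?_
    simp only [Fin.reduceFinMk, hS, hf, hT, map_add, add_mul, mul_add, Finset.sum_add_distrib,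
      sum_X_mul_single]
    rw [map_ofNat]
    simp only [Matrix.cons_val]
    ring
  · refine eq_of_polar h2 hH' ?_
    simp only [Fin.reduceFinMk, hS, hf, hT, sum_X_mul_single, Matrix.cons_val]
    linear_combination -(X (Fin.castLE hn 1)) ^ 2 * hc

theorem exists_exceptional (h2 : (2 : K) ≠ 0) (hH : IsQuadraticHomogeneous H)
    (h4 : 4 ≤ finrank K (imageSpan (polar H))) (h : HasExceptionalForm (polar H)) :
    ∃ (S : Matrix.GeneralLinearGroup (Fin m) K) (T : Matrix.GeneralLinearGroup (Fin n) K),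
      Exceptional (transform S.1 T.1 H) := by
  obtain ⟨l, ω, c, hc0, hl, hω, hf⟩ := h
  obtain ⟨hm, hn, S, T, hST, hS, hT⟩ := exists_transform hH (linearIndependent_of_separates hω h4)
    hω hl
  have hH' := isQuadraticHomogeneous_transform hH S.1 T.1
  refine ⟨S, T, fun h => h2 (two_eq_zero_iff_ringChar.2 h), hST, hm, hn, c, hc0, ?_⟩
  have hc : (C 2 : MvPolynomial (Fin n) K) * C (1 / 2) = 1 := by
    rw [← C_mul, mul_one_div_cancel h2, C_1]
  have hc' : (C 2 : MvPolynomial (Fin n) K) * C (c / 2) = C c := by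
    rw [← C_mul, mul_div_cancel₀ _ h2]
  have hC : (C 2 : MvPolynomial (Fin n) K) = 2 := map_ofNat C 2
  have hs : ∀ p q, ∑ j, X j * ∑ l, C (c * ((Pi.single l 1 : Fin n → K) p *
      (Pi.single j 1 : Fin n → K) q)) * X l = (C c * (X p * X q) : MvPolynomial (Fin n) K) :=
    fun p q => by
      rw [← sum_X_mul_single, Finset.mul_sum]
      refine Finset.sum_congr rfl fun j _ => ?_
      rw [mul_left_comm, Finset.mul_sum]
      simp only [C_mul, mul_assoc, Finset.mul_sum]
  funext i
  fin_cases i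
  · refine eq_of_polar h2 hH' ?_
    simp only [Fin.zero_eta, hS, hf, hT, map_add, add_mul, mul_add, Finset.sum_add_distrib,
      sum_X_mul_single, hs]
    simp only [Matrix.cons_val, hC]
    ring
  · refine eq_of_polar h2 hH' ?_
    simp only [Fin.mk_one, hS, hf, hT, map_add, map_sub, add_mul, mul_add, sub_mul, mul_sub,
      Finset.sum_add_distrib, Finset.sum_sub_distrib, sum_X_mul_single]
    simp only [Matrix.cons_val, hC]
    ring
  · refine eq_of_polar h2 hH' ?_
    simp only [Fin.reduceFinMk, hS, hf, hT, map_add, add_mul, mul_add, Finset.sum_add_distrib,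
      sum_X_mul_single, hs]
    simp only [Matrix.cons_val]
    linear_combination -(X (Fin.castLE hn 2)) ^ 2 * hc - (X (Fin.castLE hn 3)) ^ 2 * hc'
  · refine eq_of_polar h2 hH' ?_
    simp only [Fin.reduceFinMk, hS, hf, hT, map_add, add_mul, mul_add, Finset.sum_add_distrib,
      sum_X_mul_single, hs]
    simp only [Matrix.cons_val]
    linear_combination -(X (Fin.castLE hn 0)) ^ 2 * hc - (X (Fin.castLE hn 1)) ^ 2 * hc'

theorem sum_single_mul_X (p q j : Fin n) :
    ∑ l, C ((Pi.single l 1 : Fin n → K) p * (Pi.single j 1 : Fin n → K) q) * X l =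
      (X p * pderiv j (X q) : MvPolynomial (Fin n) K) := by
  rw [Finset.sum_eq_single p]
  · rw [pderiv_X]
    by_cases h : q = j
    · subst h
      simp
    · simp [h]
  · intro l _ hl
    simp [hl.symm]
  · simp

theorem exists_fourRowsCharTwo (h2 : (2 : K) = 0) (hH : IsQuadraticHomogeneous H)
    (h4 : 4 ≤ finrank K (imageSpan (polar H))) (h : HasWedgeForm (polar H)) :
    ∃ (S : Matrix.GeneralLinearGroup (Fin m) K) (T : Matrix.GeneralLinearGroup (Fin n) K),
      FourRowsCharTwo (transform S.1 T.1 H) := by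
  obtain ⟨l, ω, hl, hω, hf⟩ := h
  obtain ⟨hm, hn, S, T, hST, hS, hT⟩ := exists_transform hH (linearIndependent_of_separates hω h4)
    hω hl
  have hH' := isQuadraticHomogeneous_transform hH S.1 T.1
  refine ⟨S, T, two_eq_zero_iff_ringChar.1 h2, hST, hm, hn, ?_⟩
  have hC : (2 : MvPolynomial (Fin n) K) = 0 := by
    rw [← map_ofNat C 2, h2, C_0]
  ext1 i j
  have hj := fun i => jacobian_apply hH' (Fin.castLE hm i) j
  refine Eq.trans (b := jacobian (transform S.1 T.1 H) (Fin.castLE hm i) j) rfl ?_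
  fin_cases i
  · rfl
  · rw [hj]
    simp only [Fin.mk_one, hS, hf, hT, map_sub, sub_mul, Finset.sum_sub_distrib,
      sum_single_mul_X]
    simp only [jacobian, Matrix.of_apply, Matrix.cons_val, pderiv_mul]
    linear_combination -(X (Fin.castLE hn 1)) * pderiv j (X (Fin.castLE hn 0)) * hC
  · rw [hj]
    simp only [Fin.reduceFinMk, hS, hf, hT, map_sub, sub_mul, Finset.sum_sub_distrib,
      sum_single_mul_X]
    simp only [jacobian, Matrix.of_apply, Matrix.cons_val, pderiv_mul]
    linear_combination -(X (Fin.castLE hn 2)) * pderiv j (X (Fin.castLE hn 0)) * hC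
  · rw [hj]
    simp only [Fin.reduceFinMk, hS, hf, hT, map_sub, sub_mul, Finset.sum_sub_distrib,
      sum_single_mul_X]
    simp only [jacobian, Matrix.of_apply, Matrix.cons_val, pderiv_mul]
    linear_combination -(X (Fin.castLE hn 2)) * pderiv j (X (Fin.castLE hn 1)) * hC

end

end PolyMap

/-! ### Minors and base change -/

namespace PolyMap

open Module MvPolynomial

section

/-- Multilinearity in the rows expands the determinant of `P * M` into a combination of minors of
`M`. -/
theorem det_mul_eq_zero_of_forall_rows {R ι : Type*} [CommRing R] [Fintype ι] {r : ℕ}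
    {M : Matrix ι (Fin r) R} (hM : ∀ f : Fin r → ι, (M.submatrix f id).det = 0)
    (P : Matrix (Fin r) ι R) : (P * M).det = 0 := by
  classical
  have h : P * M = Matrix.of fun i => ∑ k, P i k • M k := by
    ext i j
    simp [Matrix.mul_apply, Finset.sum_apply]
  rw [h]
  change Matrix.detRowAlternating.toMultilinearMap (fun i => ∑ k, P i k • M k) = 0
  rw [MultilinearMap.map_sum]
  refine Finset.sum_eq_zero fun f _ => ?_
  rw [MultilinearMap.map_smul_univ (f := Matrix.detRowAlternating.toMultilinearMap)
    (c := fun i => P i (f i)) (m := fun i => M (f i))]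
  exact (congrArg _ (hM f)).trans (smul_zero _)

theorem det_mul_mul_eq_zero {R ι κ : Type*} [CommRing R] [Fintype ι] [Fintype κ] {r : ℕ}
    {A : Matrix ι κ R} (hA : ∀ (f : Fin r → ι) (g : Fin r → κ), (A.submatrix f g).det = 0)
    (P : Matrix (Fin r) ι R) (Q : Matrix κ (Fin r) R) : (P * A * Q).det = 0 := by
  classical
  rw [Matrix.mul_assoc]
  refine det_mul_eq_zero_of_forall_rows (fun f => ?_) P
  have h : (A * Q).submatrix f id = (Q.transpose * (A.submatrix f id).transpose).transpose := by
    rw [Matrix.transpose_mul, Matrix.transpose_transpose, Matrix.transpose_transpose]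
    rfl
  rw [h, Matrix.det_transpose]
  refine det_mul_eq_zero_of_forall_rows (fun g => ?_) _
  rw [← Matrix.transpose_submatrix, Matrix.submatrix_submatrix, Matrix.det_transpose]
  exact hA f g

theorem dual_apply_eq_sum {K ι : Type*} [Field K] [Fintype ι] [DecidableEq ι]
    (φ : Dual K (ι → K)) (w : ι → K) : φ w = ∑ k, φ (Pi.single k 1) * w k := by
  rw [LinearMap.pi_apply_eq_sum_univ φ w]
  refine Finset.sum_congr rfl fun k _ => ?_
  rw [smul_eq_mul, mul_comm]
  congr 2
  ext j
  simp only [Pi.single_apply, eq_comm]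

/-- A factorization M = (MV)(ΩM) through dimension `r` with Ω(MV) = 1 survives the extension; the
first identity bounds the rank above, the second below. -/
theorem rank_map_algebraMap {K F : Type*} [Field K] [Field F] [Algebra K F]
    {ι κ : Type*} [Fintype ι] [Fintype κ] [DecidableEq κ] [DecidableEq ι]
    (M : Matrix ι κ K) : (M.map (algebraMap K F)).rank = M.rank := by
  obtain ⟨r, ω, b, hb, hωb, hI, hr⟩ : ∃ (r : ℕ) (ω : Fin r → Dual K (ι → K)) (b : Fin r → ι → K),
      (∀ i, b i ∈ LinearMap.range M.mulVecLin) ∧ (∀ i j, ω i (b j) = if i = j then 1 else 0) ∧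
      (∀ w ∈ LinearMap.range M.mulVecLin, (∀ i, ω i w = 0) → w = 0) ∧ M.rank = r := by
    obtain ⟨ω, b, hb, hωb, hI⟩ := exists_dual_coordinates (LinearMap.range M.mulVecLin)
    exact ⟨_, ω, b, hb, hωb, hI, rfl⟩
  choose v hv using hb
  let Ω : Matrix (Fin r) ι K := Matrix.of fun i k => ω i (Pi.single k 1)
  let V : Matrix κ (Fin r) K := Matrix.of fun k j => v j k
  have hΩ : ∀ i w, ω i w = (Ω.mulVec w) i := fun i w => dual_apply_eq_sum _ _
  have h1 : Ω * (M * V) = 1 := by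
    ext i j
    rw [Matrix.one_apply, ← hωb, hΩ, ← hv]
    rfl
  have h2 : M = M * V * (Ω * M) := by
    refine Matrix.ext_of_mulVec_single fun k => ?_
    rw [← sub_eq_zero]
    refine hI _ ⟨Pi.single k 1 - V.mulVec (Ω.mulVec (M.mulVec (Pi.single k 1))), ?_⟩ fun i => ?_
    · simp only [Matrix.mulVecLin_apply, Matrix.mulVec_sub, Matrix.mulVec_mulVec, Matrix.mul_assoc]
    · have h4 : Ω * M = Ω * (M * V * (Ω * M)) := by rw [← Matrix.mul_assoc Ω, h1, Matrix.one_mul]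
      rw [hΩ, Matrix.mulVec_sub, Matrix.mulVec_mulVec, Matrix.mulVec_mulVec, ← h4, sub_self]
      rfl
  rw [hr]
  apply le_antisymm
  · have h3 : (M.map (algebraMap K F)) = (M * V).map (algebraMap K F) *
        (Ω * M).map (algebraMap K F) := by rw [← Matrix.map_mul, ← h2]
    rw [h3]
    exact (Matrix.rank_mul_le_left _ _).trans
      ((Matrix.rank_le_card_width _).trans (Fintype.card_fin r).le)
  · have h3 : Ω.map (algebraMap K F) * (M.map (algebraMap K F) * V.map (algebraMap K F)) = 1 := by
      rw [← Matrix.map_mul, ← Matrix.map_mul, h1, Matrix.map_one _ (map_zero _) (map_one _)]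
    have h4 := (Matrix.rank_mul_le_right (Ω.map (algebraMap K F))
      (M.map (algebraMap K F) * V.map (algebraMap K F))).trans (Matrix.rank_mul_le_left _ _)
    rwa [h3, Matrix.rank_one, Fintype.card_fin] at h4

variable {K : Type*} [Field K] {m n : ℕ} {H : Map K m n} {F : Type*} [Field F] [Algebra K F]

/-- The same polynomial map over a larger field. -/
noncomputable def baseChange (F : Type*) [Field F] [Algebra K F] (H : Map K m n) : Map F m n :=
  fun i => MvPolynomial.map (algebraMap K F) (H i)

theorem isQuadraticHomogeneous_baseChange (hH : IsQuadraticHomogeneous H) :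
    IsQuadraticHomogeneous (baseChange F H) := fun i => (hH i).map _

theorem jacobian_baseChange :
    jacobian (baseChange F H) = (jacobian H).map (MvPolynomial.map (algebraMap K F)) := by
  ext1 i j
  exact pderiv_map

theorem polar_baseChange_single (l j : Fin n) (k : Fin m) :
    polar (baseChange F H) (Pi.single l 1) (Pi.single j 1) k =
      algebraMap K F (polar H (Pi.single l 1) (Pi.single j 1) k) := by
  rw [polar_single, polar_single, baseChange, pderiv_map, pderiv_map, coeff_map]

theorem polar_eq_sum (x y : Fin n → K) (k : Fin m) :
    polar H x y k = ∑ l, ∑ j, x l * y j * polar H (Pi.single l 1) (Pi.single j 1) k := by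
  simp only [polar_single]
  rfl

theorem det_submatrix_jacobian_eq_zero (hr : jacobianRank H ≤ 3) (f : Fin 4 → Fin m)
    (g : Fin 4 → Fin n) : ((jacobian H).submatrix f g).det = 0 := by
  let ι : MvPolynomial (Fin n) K →+* FractionRing (MvPolynomial (Fin n) K) := algebraMap (MvPolynomial (Fin n) K) (FractionRing (MvPolynomial (Fin n) K))
  have hι : Function.Injective ι := IsFractionRing.injective _ _
  apply hι
  rw [map_zero, RingHom.map_det]
  by_contra h
  have h1 : IsUnit (ι.mapMatrix ((jacobian H).submatrix f g)) :=
    (Matrix.isUnit_iff_isUnit_det _).2 (isUnit_iff_ne_zero.2 h)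
  have h2 := Matrix.rank_of_isUnit _ h1
  have h3 : ι.mapMatrix ((jacobian H).submatrix f g) = ((jacobian H).map ι).submatrix f g := rfl
  rw [h3, Fintype.card_fin] at h2
  have h4 := Matrix.rank_submatrix_le ((jacobian H).map ι) f g
  rw [h2] at h4
  exact absurd (h4.trans hr) (by norm_num)

/-- The Jacobian minors vanish as polynomials, hence at every `F`-point. The matrices in
`MinorsVanish` are products P A Q with A the Jacobian at such a point. -/
theorem minorsVanish_polar (hH : IsQuadraticHomogeneous H)
    (hJ : ∀ (f : Fin 4 → Fin m) (g : Fin 4 → Fin n), ((jacobian H).submatrix f g).det = 0) :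
    MinorsVanish F (polar H) := by
  intro ω v k x c
  let ξ : Fin n → F := fun p => ∑ l, c l * algebraMap K F (x l p)
  let P : Matrix (Fin 4) (Fin m) F := Matrix.of fun i k => algebraMap K F (ω i (Pi.single k 1))
  let Q : Matrix (Fin n) (Fin 4) F := Matrix.of fun q j => algebraMap K F (v j q)
  let A : Matrix (Fin m) (Fin n) F := (jacobian H).map (aeval ξ)
  have hA : ∀ (f : Fin 4 → Fin m) (g : Fin 4 → Fin n), (A.submatrix f g).det = 0 := fun f g => by
    have := congrArg (aeval ξ).toRingHom (hJ f g)
    rw [map_zero, RingHom.map_det] at this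
    exact this
  rw [← det_mul_mul_eq_zero hA P Q]
  congr 1
  ext i j
  have hAe : ∀ k q, A k q = ∑ p, algebraMap K F (polar H (Pi.single p 1) (Pi.single q 1) k) * ξ p :=
    fun k q => by
      change aeval ξ (jacobian H k q) = _
      rw [jacobian_apply hH]
      simp
  have hAQ : ∀ k, (A * Q) k j = ∑ l, c l * algebraMap K F (polar H (x l) (v j) k) := fun k => by
    simp only [Matrix.mul_apply, hAe, Q, ξ, Matrix.of_apply, polar_eq_sum (x _), map_sum, map_mul,
      Finset.mul_sum, Finset.sum_mul]
    rw [Finset.sum_comm]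
    refine Eq.trans (Finset.sum_congr rfl fun p _ => Finset.sum_comm) ?_
    rw [Finset.sum_comm]
    exact Finset.sum_congr rfl fun l _ => Finset.sum_congr rfl fun p _ =>
      Finset.sum_congr rfl fun q _ => by ring
  rw [Matrix.mul_assoc, Matrix.mul_apply, Matrix.of_apply]
  simp only [hAQ, P, Matrix.of_apply, dual_apply_eq_sum (ω i) (polar H _ _), map_sum, map_mul,
    Finset.mul_sum]
  rw [Finset.sum_comm]
  exact Finset.sum_congr rfl fun k _ => Finset.sum_congr rfl fun l _ => by ring

theorem det_submatrix_jacobian_baseChange_eq_zero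
    (hJ : ∀ (f : Fin 4 → Fin m) (g : Fin 4 → Fin n), ((jacobian H).submatrix f g).det = 0)
    (f : Fin 4 → Fin m) (g : Fin 4 → Fin n) :
    ((jacobian (baseChange F H)).submatrix f g).det = 0 := by
  have := congrArg (MvPolynomial.map (algebraMap K F)) (hJ f g)
  rw [map_zero, RingHom.map_det] at this
  rw [jacobian_baseChange]
  exact this

theorem polar_eq_mulVecLin (x : Fin n → K) :
    polar H x = (Matrix.of fun k j => polar H x (Pi.single j 1) k).mulVecLin := by
  refine (Pi.basisFun K (Fin n)).ext fun j => ?_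
  ext k
  simp

theorem polar_baseChange (x y : Fin n → K) (k : Fin m) :
    polar (baseChange F H) (fun j => algebraMap K F (x j)) (fun j => algebraMap K F (y j)) k =
      algebraMap K F (polar H x y k) := by
  rw [polar_eq_sum, polar_eq_sum x]
  simp only [map_sum, map_mul, polar_baseChange_single]

theorem algebraMap_single (j : Fin n) :
    (fun i => algebraMap K F ((Pi.single j 1 : Fin n → K) i)) = Pi.single j 1 := by
  ext i
  simp only [Pi.single_apply]
  split_ifs <;> simp

theorem finrank_range_polar_baseChange (x : Fin n → K) :
    finrank F (LinearMap.range (polar (baseChange F H) fun j => algebraMap K F (x j))) =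
      finrank K (LinearMap.range (polar H x)) := by
  have h : (Matrix.of fun k j => polar (baseChange F H) (fun j => algebraMap K F (x j))
      (Pi.single j 1) k) = (Matrix.of fun k j => polar H x (Pi.single j 1) k).map
        (algebraMap K F) := by
    refine Matrix.ext fun k j => ?_
    rw [Matrix.map_apply, Matrix.of_apply, Matrix.of_apply, ← polar_baseChange,
      algebraMap_single]
  rw [polar_eq_mulVecLin, polar_eq_mulVecLin (H := H), h]
  exact rank_map_algebraMap _

/-- Written as the rank of a matrix over `K`, the dimension is seen to be unchanged by base change.
-/
theorem finrank_range_polar :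
    finrank K (LinearMap.range (polar H)) = (Matrix.of fun (p : Fin m × Fin n) (l : Fin n) =>
      polar H (Pi.single l 1) (Pi.single p.2 1) p.1).rank := by
  have h : LinearMap.ker (polar H) = LinearMap.ker (Matrix.of fun (p : Fin m × Fin n) (l : Fin n) =>
      polar H (Pi.single l 1) (Pi.single p.2 1) p.1).mulVecLin := by
    have hv : ∀ x, (Matrix.of fun (p : Fin m × Fin n) (l : Fin n) =>
        polar H (Pi.single l 1) (Pi.single p.2 1) p.1).mulVec x =
          fun p => polar H x (Pi.single p.2 1) p.1 := fun x => by
      ext p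
      rw [polar_symm H x, polar_eq_mulVecLin]
      simp only [Matrix.mulVecLin_apply, Matrix.mulVec, dotProduct, Matrix.of_apply]
      exact Finset.sum_congr rfl fun l _ => by rw [polar_symm]
    ext x
    rw [LinearMap.mem_ker, LinearMap.mem_ker, Matrix.mulVecLin_apply, hv]
    refine ⟨fun hx => by simp [hx]; rfl, fun hx => (Pi.basisFun K (Fin n)).ext fun j => ?_⟩
    ext k
    rw [Pi.basisFun_apply]
    exact congrFun hx (k, j)
  have h1 := LinearMap.finrank_range_add_finrank_ker (polar H)
  have h2 := LinearMap.finrank_range_add_finrank_ker (Matrix.of fun (p : Fin m × Fin n) (l : Fin n) =>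
      polar H (Pi.single l 1) (Pi.single p.2 1) p.1).mulVecLin
  rw [← h] at h2
  rw [Matrix.rank]
  omega

theorem finrank_range_polar_baseChange_eq :
    finrank F (LinearMap.range (polar (baseChange F H))) =
      finrank K (LinearMap.range (polar H)) := by
  rw [finrank_range_polar, finrank_range_polar (H := H), ← rank_map_algebraMap (K := K) (F := F)]
  refine congrArg Matrix.rank (Matrix.ext fun p l => ?_)
  rw [Matrix.map_apply, Matrix.of_apply, Matrix.of_apply, polar_baseChange_single]

theorem finrank_imageSpan_polar :
    finrank K (imageSpan (polar H)) = (Matrix.of fun (k : Fin m) (p : Fin n × Fin n) =>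
      polar H (Pi.single p.1 1) (Pi.single p.2 1) k).rank := by
  rw [Matrix.rank_eq_finrank_span_cols]
  suffices h : imageSpan (polar H) = Submodule.span K (Set.range
      (Matrix.of fun (k : Fin m) (p : Fin n × Fin n) =>
        polar H (Pi.single p.1 1) (Pi.single p.2 1) k).col) by rw [h]
  refine le_antisymm ?_ ?_
  · rw [imageSpan, Submodule.span_le]
    rintro _ ⟨x, y, rfl⟩
    have h : polar H x y = ∑ l, ∑ j, (x l * y j) • polar H (Pi.single l 1) (Pi.single j 1) := by
      ext k
      rw [polar_eq_sum]
      simp [Finset.sum_apply]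
    rw [h]
    refine sum_mem fun l _ => sum_mem fun j _ => Submodule.smul_mem _ _ ?_
    exact Submodule.subset_span ⟨(l, j), rfl⟩
  · rw [Submodule.span_le]
    rintro _ ⟨p, rfl⟩
    exact Submodule.subset_span ⟨_, _, rfl⟩

theorem finrank_imageSpan_polar_baseChange :
    finrank F (imageSpan (polar (baseChange F H))) = finrank K (imageSpan (polar H)) := by
  rw [finrank_imageSpan_polar, finrank_imageSpan_polar (H := H), ← rank_map_algebraMap (K := K) (F := F)]
  refine congrArg Matrix.rank (Matrix.ext fun k p => ?_)
  rw [Matrix.map_apply, Matrix.of_apply, Matrix.of_apply, polar_baseChange_single]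

end

end PolyMap

/-! ### Points over the base field where the rank is three -/

namespace PolyMap

open Module MvPolynomial

section

theorem finrank_range_le_of_minorsVanish {K V W : Type*} [Field K] [AddCommGroup V] [Module K V]
    [AddCommGroup W] [Module K W] [FiniteDimensional K V] {F : Type*} [Field F] [Algebra K F]
    {B : V →ₗ[K] V →ₗ[K] W} (hB : MinorsVanish F B) (e : V) :
    finrank K (LinearMap.range (B e)) ≤ 3 := by
  by_contra h
  obtain ⟨ω, b, hb, hωb, -⟩ := exists_dual_coordinates (LinearMap.range (B e))
  choose v hv using hb
  let ι := Fin.castLE (show 4 ≤ finrank K (LinearMap.range (B e)) by omega)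
  have h0 := hB.det_eq_zero (fun i => ω (ι i)) (fun j => v (ι j)) e
  have h1 : (Matrix.of fun i j => ω (ι i) (B e (v (ι j)))) = 1 := by
    ext i j
    rw [Matrix.of_apply, hv, hωb, Matrix.one_apply]
    simp only [ι, Fin.castLE_inj]
  rw [h1, Matrix.det_one] at h0
  exact one_ne_zero h0

theorem three_le_finrank_range {K V W : Type*} [Field K] [AddCommGroup V] [Module K V]
    [AddCommGroup W] [Module K W] [FiniteDimensional K V] {A : V →ₗ[K] W} (u v w : V)
    (h : ∀ a b c : K, a • A u + b • A v + c • A w = 0 → a = 0 ∧ b = 0 ∧ c = 0) :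
    3 ≤ finrank K (LinearMap.range A) := by
  have hli : LinearIndependent K
      (fun i => A.rangeRestrict (![u, v, w] i) : Fin 3 → LinearMap.range A) := by
    rw [Fintype.linearIndependent_iff]
    intro g hg
    have hg' := congrArg Subtype.val hg
    rw [Fin.sum_univ_three] at hg'
    obtain ⟨h0, h1, h2⟩ := h (g 0) (g 1) (g 2) hg'
    intro i
    fin_cases i
    exacts [h0, h1, h2]
  simpa using hli.fintype_card_le_finrank

variable {K : Type*} [Field K] {m n : ℕ} {H : Map K m n} {F : Type*} [Field F] [Algebra K F]

theorem exists_single_ne_zero {φ : Dual K (Fin n → K)} (hφ : φ ≠ 0) :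
    ∃ j, φ (Pi.single j 1) ≠ 0 := by
  by_contra! h
  refine hφ (LinearMap.ext fun w => ?_)
  rw [dual_apply_eq_sum]
  simp [h]

theorem algebraMap_single_add (i j : Fin n) :
    (fun k => algebraMap K F ((Pi.single i 1 + Pi.single j 1 : Fin n → K) k)) =
      Pi.single i 1 + Pi.single j 1 := by
  rw [← algebraMap_single (K := K) (F := F) i, ← algebraMap_single (K := K) (F := F) j]
  ext k
  simp only [Pi.add_apply, map_add]

/-- Each functional is nonzero at some standard basis vector; one of the two vectors or their sum
serves both, however small `K` is. -/
theorem exists_rational_point {φ ψ : Dual F (Fin n → F)} (hφ : φ ≠ 0) (hψ : ψ ≠ 0) :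
    ∃ e : Fin n → K, φ (fun j => algebraMap K F (e j)) ≠ 0 ∧
      ψ (fun j => algebraMap K F (e j)) ≠ 0 := by
  obtain ⟨i, hi⟩ := exists_single_ne_zero hφ
  obtain ⟨j, hj⟩ := exists_single_ne_zero hψ
  by_cases hi' : ψ (Pi.single i 1) = 0
  · by_cases hj' : φ (Pi.single j 1) = 0
    · refine ⟨Pi.single i 1 + Pi.single j 1, ?_, ?_⟩
      · rwa [algebraMap_single_add, map_add, hj', add_zero]
      · rwa [algebraMap_single_add, map_add, hi', zero_add]
    · exact ⟨Pi.single j 1, by rwa [algebraMap_single], by rwa [algebraMap_single]⟩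
  · exact ⟨Pi.single i 1, by rwa [algebraMap_single], by rwa [algebraMap_single]⟩

/-- Otherwise `ω 0 ∘ B` would be a quadratic form in `l 0`, `l 1`, hence a combination of the other
three components, against dimension 4. -/
theorem exists_apply_ne_zero_of_binary {V W : Type*} [AddCommGroup V] [Module K V]
    [AddCommGroup W] [Module K W] [FiniteDimensional K W] {B : V →ₗ[K] V →ₗ[K] W}
    {l : Fin 2 → Dual K V} {u : Fin 2 → V} {ω : Fin 4 → Dual K W}
    (h4 : 4 ≤ finrank K (imageSpan B)) (hS : ∀ x y, B x y = B y x)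
    (hu : ∀ i j, l i (u j) = if i = j then 1 else 0) (hω : Separates B ω)
    (hf : ∀ x y, ω 1 (B x y) = l 0 x * l 0 y ∧ ω 2 (B x y) = l 0 x * l 1 y + l 1 x * l 0 y ∧
      ω 3 (B x y) = l 1 x * l 1 y) :
    ∃ x y, (∀ i, l i y = 0) ∧ ω 0 (B x y) ≠ 0 := by
  by_contra! h
  obtain ⟨w, hw, hωw⟩ := exists_mem_dual_of_separates hω h4
  let b := B.compr₂ (ω 0)
  have hb : ∀ x y, b x y = ω 0 (B x y) := fun x y => rfl
  have hsum := apply_eq_sum_of_radical (B := b) hu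
    (fun x hx => LinearMap.ext fun y => by rw [hb, hS]; exact h y x hx)
    (fun x hx y => h y x hx)
  have hbs : b (u 1) (u 0) = b (u 0) (u 1) := by rw [hb, hb, hS]
  have key : imageSpan B ≤ LinearMap.ker
      (ω 0 - b (u 0) (u 0) • ω 1 - b (u 0) (u 1) • ω 2 - b (u 1) (u 1) • ω 3) := by
    rw [imageSpan, Submodule.span_le]
    rintro _ ⟨x, y, rfl⟩
    have := hsum x y
    simp only [Fin.sum_univ_two, smul_eq_mul, hbs] at this
    obtain ⟨f1, f2, f3⟩ := hf x y
    simp only [SetLike.mem_coe, LinearMap.mem_ker, LinearMap.sub_apply, LinearMap.smul_apply,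
      smul_eq_mul, f1, f2, f3, ← hb x y]
    linear_combination this
  have h0 := key (hw 0)
  simp [hωw] at h0

/-- The same count: alternating forms in three variables are combinations of the three wedges. -/
theorem exists_apply_ne_zero_of_wedge {V W : Type*} [AddCommGroup V] [Module K V]
    [AddCommGroup W] [Module K W] [FiniteDimensional K W] {B : V →ₗ[K] V →ₗ[K] W}
    {l : Fin 3 → Dual K V} {u : Fin 3 → V} {ω : Fin 4 → Dual K W}
    (h4 : 4 ≤ finrank K (imageSpan B)) (hA : ∀ x, B x x = 0)
    (hu : ∀ i j, l i (u j) = if i = j then 1 else 0) (hω : Separates B ω)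
    (hf : ∀ x y, ω 1 (B x y) = l 0 x * l 1 y - l 1 x * l 0 y ∧
      ω 2 (B x y) = l 0 x * l 2 y - l 2 x * l 0 y ∧
      ω 3 (B x y) = l 1 x * l 2 y - l 2 x * l 1 y) :
    ∃ x y, (∀ i, l i y = 0) ∧ ω 0 (B x y) ≠ 0 := by
  by_contra! h
  obtain ⟨w, hw, hωw⟩ := exists_mem_dual_of_separates hω h4
  have hneg : ∀ x y, B x y = -B y x := fun x y => by
    have := hA (x + y)
    simp only [map_add, LinearMap.add_apply, hA, zero_add, add_zero] at this
    exact eq_neg_of_add_eq_zero_right this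
  let b := B.compr₂ (ω 0)
  have hb : ∀ x y, b x y = ω 0 (B x y) := fun x y => rfl
  have hsum := apply_eq_sum_of_radical (B := b) hu
    (fun x hx => LinearMap.ext fun y => by
      rw [hb, hneg, map_neg, h y x hx, neg_zero, LinearMap.zero_apply])
    (fun x hx y => h y x hx)
  have hbn : ∀ x y, b x y = -b y x := fun x y => by rw [hb, hb, hneg, map_neg]
  have hbz : ∀ x, b x x = 0 := fun x => by rw [hb, hA, map_zero]
  have key : imageSpan B ≤ LinearMap.ker
      (ω 0 - b (u 0) (u 1) • ω 1 - b (u 0) (u 2) • ω 2 - b (u 1) (u 2) • ω 3) := by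
    rw [imageSpan, Submodule.span_le]
    rintro _ ⟨x, y, rfl⟩
    have := hsum x y
    simp only [Fin.sum_univ_three, smul_eq_mul, hbz, hbn (u 1) (u 0), hbn (u 2) (u 0),
      hbn (u 2) (u 1)] at this
    obtain ⟨f1, f2, f3⟩ := hf x y
    simp only [SetLike.mem_coe, LinearMap.mem_ker, LinearMap.sub_apply, LinearMap.smul_apply,
      smul_eq_mul, f1, f2, f3, ← hb x y]
    linear_combination this
  have h0 := key (hw 0)
  simp [hωw] at h0

/-- If `l 0` and `ω 0 (B · y)` are both nonzero at `e`, then the images of `u 0`, `u 1`, `y` under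
`B e` are independent. Both conditions are linear in `e`, so a `K`-point satisfies them. -/
theorem exists_rational_point_of_binary (h4 : 4 ≤ finrank F (imageSpan (polar (baseChange F H))))
    (h : HasBinaryForm (polar (baseChange F H))) :
    ∃ e : Fin n → K, 3 ≤ finrank K (LinearMap.range (polar H e)) ∧ polar H e e ≠ 0 := by
  obtain ⟨l, ω, hl, hω, hf⟩ := h
  obtain ⟨u, hu⟩ := exists_dual_vectors hl
  obtain ⟨x, y, hy, hxy⟩ := exists_apply_ne_zero_of_binary h4 (polar_symm _) hu hω hf
  have hl0 : l 0 ≠ 0 := fun h => by simpa [h] using hu 0 0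
  obtain ⟨e, he, he'⟩ := exists_rational_point (K := K)
    (ψ := ω 0 ∘ₗ (polar (baseChange F H)).flip y) hl0 fun h => hxy (LinearMap.congr_fun h x)
  rw [LinearMap.comp_apply, LinearMap.flip_apply] at he'
  refine ⟨e, ?_, fun h => ?_⟩
  · rw [← finrank_range_polar_baseChange (F := F)]
    refine three_le_finrank_range (u 0) (u 1) y fun a b c h0 => ?_
    have h1 := congrArg (ω 1) h0
    have h2 := congrArg (ω 2) h0
    have h3 := congrArg (ω 0) h0
    simp only [map_add, map_smul, map_zero, hf, hu, hy, smul_eq_mul] at h1 h2 h3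
    have ha : a = 0 := by simpa [he] using h1
    have hb : b = 0 := by simpa [he, ha] using h2
    exact ⟨ha, hb, by simpa [ha, hb, he'] using h3⟩
  · have h1 := (hf (fun j => algebraMap K F (e j)) (fun j => algebraMap K F (e j))).1
    have h0 : polar (baseChange F H) (fun j => algebraMap K F (e j))
        (fun j => algebraMap K F (e j)) = 0 := by
      ext k
      rw [polar_baseChange, h, Pi.zero_apply, map_zero, Pi.zero_apply]
    rw [h0, map_zero] at h1
    exact mul_ne_zero he he h1.symm

theorem exists_rational_point_of_wedge (h2 : (2 : K) = 0)
    (h4 : 4 ≤ finrank F (imageSpan (polar (baseChange F H))))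
    (h : HasWedgeForm (polar (baseChange F H))) :
    ∃ e : Fin n → K, 3 ≤ finrank K (LinearMap.range (polar H e)) := by
  obtain ⟨l, ω, hl, hω, hf⟩ := h
  obtain ⟨u, hu⟩ := exists_dual_vectors hl
  have hF : (2 : F) = 0 := by rw [← map_ofNat (algebraMap K F) 2, h2, map_zero]
  obtain ⟨x, y, hy, hxy⟩ := exists_apply_ne_zero_of_wedge h4 (polar_self hF _) hu hω hf
  have hl0 : l 0 ≠ 0 := fun h => by simpa [h] using hu 0 0
  obtain ⟨e, he, he'⟩ := exists_rational_point (K := K)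
    (ψ := ω 0 ∘ₗ (polar (baseChange F H)).flip y) hl0 fun h => hxy (LinearMap.congr_fun h x)
  rw [LinearMap.comp_apply, LinearMap.flip_apply] at he'
  refine ⟨e, ?_⟩
  rw [← finrank_range_polar_baseChange (F := F)]
  refine three_le_finrank_range (u 1) (u 2) y fun a b c h0 => ?_
  have h1 := congrArg (ω 1) h0
  have h2 := congrArg (ω 2) h0
  have h3 := congrArg (ω 0) h0
  simp only [map_add, map_smul, map_zero, hf, hu, hy, smul_eq_mul] at h1 h2 h3
  have ha : a = 0 := by simpa [he] using h1
  have hb : b = 0 := by simpa [he, ha] using h2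
  exact ⟨ha, hb, by simpa [ha, hb, he'] using h3⟩

/-- A quadratic form zero at all standard basis vectors and their pairwise sums has zero
polarization, as 2 ≠ 0. -/
theorem exists_rational_point_of_quadratic (h2 : (2 : K) ≠ 0) {φ : Dual F (Fin m → F)}
    {x y : Fin n → F} (h : φ (polar (baseChange F H) x y) ≠ 0) :
    ∃ e : Fin n → K, φ (polar (baseChange F H) (fun j => algebraMap K F (e j))
      (fun j => algebraMap K F (e j))) ≠ 0 := by
  by_contra! h0
  have hF : (2 : F) ≠ 0 := by
    rw [← map_ofNat (algebraMap K F) 2]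
    exact (map_ne_zero _).2 h2
  let b := (polar (baseChange F H)).compr₂ φ
  have hb : b = 0 := by
    refine LinearMap.ext_basis (Pi.basisFun F (Fin n)) (Pi.basisFun F (Fin n)) fun i j => ?_
    have hi := h0 (Pi.single i 1)
    have hj := h0 (Pi.single j 1)
    have hij := h0 (Pi.single i 1 + Pi.single j 1)
    rw [algebraMap_single] at hi hj
    rw [algebraMap_single_add] at hij
    simp only [map_add, LinearMap.add_apply, hi, hj, zero_add, add_zero] at hij
    rw [polar_symm (baseChange F H) (Pi.single j 1), ← two_mul] at hij
    rw [Pi.basisFun_apply, Pi.basisFun_apply, LinearMap.zero_apply, LinearMap.zero_apply]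
    change φ _ = 0
    exact (mul_eq_zero.1 hij).resolve_left hF
  exact h (LinearMap.congr_fun (LinearMap.congr_fun hb x) y)

/-- The rank is at least 3 wherever the norm form (l 0)² + c (l 1)² is nonzero, which is a quadratic
condition on the point. -/
theorem exists_rational_point_of_exceptional (h2 : (2 : K) ≠ 0)
    (h : HasExceptionalForm (polar (baseChange F H))) :
    ∃ e : Fin n → K, 3 ≤ finrank K (LinearMap.range (polar H e)) ∧ polar H e e ≠ 0 := by
  obtain ⟨l, ω, c, hc, hl, hω, hf⟩ := h
  obtain ⟨u, hu⟩ := exists_dual_vectors hl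
  obtain ⟨e, he⟩ := exists_rational_point_of_quadratic (φ := ω 3) (x := u 0) (y := u 0) h2 (by
    rw [(hf _ _).2.2.2]
    simp [hu])
  refine ⟨e, ?_, fun h => ?_⟩
  · rw [← finrank_range_polar_baseChange (F := F)]
    rw [(hf _ _).2.2.2] at he
    set x : Fin n → F := fun j => algebraMap K F (e j)
    -- On the third vector `ω 3 (B x ·)` equals the norm, while it kills `u 2` and `u 3`; on those
    -- two, the components `ω 0` and `ω 1` form a matrix with determinant ± the norm.
    refine three_le_finrank_range (u 2) (u 3) (l 0 x • u 0 + l 1 x • u 1) fun a b d h0 => ?_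
    have h1 := congrArg (ω 3) h0
    have h2 := congrArg (ω 0) h0
    have h3 := congrArg (ω 1) h0
    simp only [map_add, map_smul, map_zero, hf, hu, smul_eq_mul, if_true, Fin.reduceEq, if_false,
      mul_one, mul_zero, add_zero, zero_add, sub_zero, zero_sub] at h1 h2 h3
    have hd : d = 0 := by
      have : d * (l 0 x * l 0 x + c * (l 1 x * l 1 x)) = 0 := by linear_combination h1
      exact (mul_eq_zero.1 this).resolve_right he
    subst hd
    have ha : a = 0 := by
      have : a * (l 0 x * l 0 x + c * (l 1 x * l 1 x)) = 0 := by
        linear_combination l 0 x * h2 + c * l 1 x * h3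
      exact (mul_eq_zero.1 this).resolve_right he
    have hb : b = 0 := by
      have : b * (l 0 x * l 0 x + c * (l 1 x * l 1 x)) = 0 := by
        linear_combination l 1 x * h2 - l 0 x * h3
      exact (mul_eq_zero.1 this).resolve_right he
    exact ⟨ha, hb, rfl⟩
  · refine he ?_
    have h0 : polar (baseChange F H) (fun j => algebraMap K F (e j))
        (fun j => algebraMap K F (e j)) = 0 := by
      ext k
      rw [polar_baseChange, h, Pi.zero_apply, map_zero, Pi.zero_apply]
    rw [h0, map_zero]

end

end PolyMap

/-! ### The generic point and descent to the base field -/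

namespace PolyMap

open Module MvPolynomial

section

variable {K : Type*} [Field K] {m n : ℕ} {H : Map K m n}

/-- The generic point of affine space. -/
noncomputable def genericPoint (K : Type*) [Field K] (n : ℕ) :
    Fin n → FractionRing (MvPolynomial (Fin n) K) :=
  fun j => algebraMap (MvPolynomial (Fin n) K) _ (X j)

theorem polar_genericPoint (hH : IsQuadraticHomogeneous H) :
    polar (baseChange (FractionRing (MvPolynomial (Fin n) K)) H) (genericPoint K n) =
      ((jacobian H).map (algebraMap (MvPolynomial (Fin n) K)
        (FractionRing (MvPolynomial (Fin n) K)))).mulVecLin := by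
  rw [polar_eq_mulVecLin]
  congr 1
  refine Matrix.ext fun k j => ?_
  rw [Matrix.map_apply, Matrix.of_apply, jacobian_apply hH, polar_symm, polar_eq_mulVecLin]
  simp only [Matrix.mulVecLin_apply, Matrix.mulVec, dotProduct, Matrix.of_apply, map_sum, map_mul]
  refine Finset.sum_congr rfl fun l _ => ?_
  rw [polar_symm, polar_baseChange_single, IsScalarTower.algebraMap_apply K
    (MvPolynomial (Fin n) K), algebraMap_eq, genericPoint]

theorem finrank_range_polar_genericPoint (hH : IsQuadraticHomogeneous H) :
    finrank (FractionRing (MvPolynomial (Fin n) K)) (LinearMap.range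
      (polar (baseChange (FractionRing (MvPolynomial (Fin n) K)) H) (genericPoint K n))) =
        jacobianRank H := by
  rw [polar_genericPoint hH]
  rfl

/-- By Euler's identity this value is 2H at the generic point. -/
theorem polar_genericPoint_self_ne_zero (h2 : (2 : K) ≠ 0) (hH : IsQuadraticHomogeneous H)
    (hr : jacobianRank H ≠ 0) :
    polar (baseChange (FractionRing (MvPolynomial (Fin n) K)) H) (genericPoint K n)
      (genericPoint K n) ≠ 0 := by
  intro h0
  rw [polar_genericPoint hH, Matrix.mulVecLin_apply] at h0
  have hz : ∀ k, H k = 0 := fun k => by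
    have hk : algebraMap (MvPolynomial (Fin n) K) (FractionRing (MvPolynomial (Fin n) K))
        (∑ j, X j * pderiv j (H k)) = 0 := by
      rw [← Pi.zero_apply (M := fun _ => FractionRing (MvPolynomial (Fin n) K)) k, ← h0, map_sum]
      refine Finset.sum_congr rfl fun j _ => ?_
      rw [map_mul, mul_comm]
      rfl
    have hk' := (IsFractionRing.injective (MvPolynomial (Fin n) K)
      (FractionRing (MvPolynomial (Fin n) K))) (hk.trans (map_zero _).symm)
    rw [(hH k).sum_X_mul_pderiv, nsmul_eq_mul, Nat.cast_ofNat, ← map_ofNat C 2] at hk'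
    exact (mul_eq_zero.1 hk').resolve_left fun h => h2 (C_eq_zero.1 h)
  apply hr
  have : jacobian H = 0 := by
    refine Matrix.ext fun i j => ?_
    rw [jacobian, Matrix.of_apply, hz, map_zero, Matrix.zero_apply]
  rw [jacobianRank, this, Matrix.map_zero _ (map_zero _), Matrix.rank_zero]

theorem infinite_fractionRing (hr : jacobianRank H = 3) :
    Infinite (FractionRing (MvPolynomial (Fin n) K)) := by
  have hn : 3 ≤ n := hr ▸ Matrix.rank_le_width _
  have : Nonempty (Fin n) := ⟨⟨0, by omega⟩⟩
  exact Infinite.of_injective _ (IsFractionRing.injective (MvPolynomial (Fin n) K)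
    (FractionRing (MvPolynomial (Fin n) K)))

/-- A normal form found over `F` is used only to produce a `K`-point of rank 3; its linear forms
need not be defined over `K`, so the classification is repeated there. -/
theorem polar_classification_of_two_ne_zero (h2 : (2 : K) ≠ 0) (hH : IsQuadraticHomogeneous H)
    (hr : jacobianRank H = 3) :
    finrank K (imageSpan (polar H)) ≤ 3 ∨ finrank K (LinearMap.range (polar H)) = 3 ∨
      HasBinaryForm (polar H) ∨ HasExceptionalForm (polar H) := by
  by_cases h4 : finrank K (imageSpan (polar H)) ≤ 3
  · exact Or.inl h4
  let F := FractionRing (MvPolynomial (Fin n) K)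
  have : Infinite F := infinite_fractionRing hr
  have hF : (2 : F) ≠ 0 := by
    rw [← map_ofNat (algebraMap K F) 2]
    exact (map_ne_zero _).2 h2
  have hJ := det_submatrix_jacobian_eq_zero hr.le
  have hB : MinorsVanish F (polar H) := minorsVanish_polar hH hJ
  have hB' : MinorsVanish F (polar (baseChange F H)) :=
    minorsVanish_polar (isQuadraticHomogeneous_baseChange hH)
      (det_submatrix_jacobian_baseChange_eq_zero hJ)
  have core : ∀ e, 3 ≤ finrank K (LinearMap.range (polar H e)) ∧ polar H e e ≠ 0 →
      finrank K (imageSpan (polar H)) ≤ 3 ∨ finrank K (LinearMap.range (polar H)) = 3 ∨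
        HasBinaryForm (polar H) ∨ HasExceptionalForm (polar H) := fun e he =>
    symmetric_classification (F := F) h2 (le_antisymm (finrank_range_le_of_minorsVanish hB e) he.1)
      (polar_symm H) he.2 hB
  rcases symmetric_classification (F := F) hF
    ((finrank_range_polar_genericPoint hH).trans hr) (polar_symm _)
    (polar_genericPoint_self_ne_zero h2 hH (by omega)) hB' with h | h | h | h
  · exact absurd (finrank_imageSpan_polar_baseChange (H := H) (F := F) ▸ h) h4
  · exact Or.inr (Or.inl (finrank_range_polar_baseChange_eq (H := H) (F := F) ▸ h))
  · obtain ⟨e, he⟩ := exists_rational_point_of_binary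
      (by rw [finrank_imageSpan_polar_baseChange]; omega) h
    exact core e he
  · obtain ⟨e, he⟩ := exists_rational_point_of_exceptional h2 h
    exact core e he

theorem polar_classification_of_two_eq_zero (h2 : (2 : K) = 0) (hH : IsQuadraticHomogeneous H)
    (hr : jacobianRank H = 3) :
    finrank K (imageSpan (polar H)) ≤ 3 ∨ finrank K (LinearMap.range (polar H)) = 4 ∨
      HasWedgeForm (polar H) := by
  by_cases h4 : finrank K (imageSpan (polar H)) ≤ 3
  · exact Or.inl h4
  let F := FractionRing (MvPolynomial (Fin n) K)
  have : Infinite F := infinite_fractionRing hr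
  have hF : (2 : F) = 0 := by rw [← map_ofNat (algebraMap K F) 2, h2, map_zero]
  have hJ := det_submatrix_jacobian_eq_zero hr.le
  have hB : MinorsVanish F (polar H) := minorsVanish_polar hH hJ
  have hB' : MinorsVanish F (polar (baseChange F H)) :=
    minorsVanish_polar (isQuadraticHomogeneous_baseChange hH)
      (det_submatrix_jacobian_baseChange_eq_zero hJ)
  rcases alternating_classification (F := F)
    ((finrank_range_polar_genericPoint hH).trans hr) (polar_self hF _) hB' with h | h | h
  · exact absurd (finrank_imageSpan_polar_baseChange (H := H) (F := F) ▸ h) h4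
  · exact Or.inr (Or.inl (finrank_range_polar_baseChange_eq (H := H) (F := F) ▸ h))
  · obtain ⟨e, he⟩ := exists_rational_point_of_wedge h2
      (by rw [finrank_imageSpan_polar_baseChange]; omega) h
    exact alternating_classification (F := F)
      (le_antisymm (finrank_range_le_of_minorsVanish hB e) he) (polar_self h2 H) hB

theorem exists_normal_form (hH : IsQuadraticHomogeneous H) (hr : jacobianRank H = 3) :
    ∃ (S : Matrix.GeneralLinearGroup (Fin m) K) (T : Matrix.GeneralLinearGroup (Fin n) K),
      let H' : Map K m n := transform S.1 T.1 H
      ThreeRows H' ∨ FourRowsBinary H' ∨ FourRowsCharTwo H' ∨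
        (OnlyFirstRows 6 H' ∧
          ((FewCols 3 H' ∧ FirstColsNonzero 3 H') ∨
            (FewColsCharTwo 3 H' ∧ FirstColsNonzero 4 H'))) ∨
        Exceptional H' := by
  by_cases h3 : finrank K (imageSpan (polar H)) ≤ 3
  · obtain ⟨S, T, h⟩ := exists_threeRows hH h3
    exact ⟨S, T, Or.inl h⟩
  have h4 : 4 ≤ finrank K (imageSpan (polar H)) := by omega
  by_cases h2 : (2 : K) = 0
  · have hc : ringChar K = 2 := two_eq_zero_iff_ringChar.1 h2
    rcases polar_classification_of_two_eq_zero h2 hH hr with h | h | h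
    · exact absurd h h3
    · obtain ⟨S, T, hS, hT, hT'⟩ := exists_fewCols hH h
        (finrank_imageSpan_le_six_of_alternating h (polar_self h2 H))
      exact ⟨S, T, Or.inr (Or.inr (Or.inr (Or.inl ⟨hS, Or.inr ⟨⟨hc, hT⟩, hT'⟩⟩)))⟩
    · obtain ⟨S, T, h⟩ := exists_fourRowsCharTwo h2 hH h4 h
      exact ⟨S, T, Or.inr (Or.inr (Or.inl h))⟩
  · have hc : ringChar K ≠ 2 := fun h => h2 (two_eq_zero_iff_ringChar.2 h)
    rcases polar_classification_of_two_ne_zero h2 hH hr with h | h | h | h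
    · exact absurd h h3
    · obtain ⟨S, T, hS, hT, hT'⟩ := exists_fewCols hH h
        (finrank_imageSpan_le_six_of_symmetric h (polar_symm H))
      exact ⟨S, T, Or.inr (Or.inr (Or.inr (Or.inl ⟨hS, Or.inl ⟨⟨hc, hT⟩, hT'⟩⟩)))⟩
    · obtain ⟨S, T, h⟩ := exists_fourRowsBinary h2 hH h4 h
      exact ⟨S, T, Or.inr (Or.inl h)⟩
    · obtain ⟨S, T, h⟩ := exists_exceptional h2 hH h4 h
      exact ⟨S, T, Or.inr (Or.inr (Or.inr (Or.inr h)))⟩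

end

end PolyMap

/-! ### The converse: dependences among rows or columns -/

namespace PolyMap

open Module MvPolynomial

section

theorem rank_le_card_of_forall {F ι κ : Type*} [Field F] [Fintype ι] [Fintype κ]
    {M : Matrix ι κ F} (s : Finset ι)
    (h : ∀ v, (∀ i ∈ s, M.mulVec v i = 0) → M.mulVec v = 0) : M.rank ≤ s.card := by
  let Φ : LinearMap.range M.mulVecLin →ₗ[F] (s → F) :=
    LinearMap.funLeft F F (fun i : s => (i : ι)) ∘ₗ (LinearMap.range M.mulVecLin).subtype
  have hinj : Function.Injective Φ := by
    rw [← LinearMap.ker_eq_bot, LinearMap.ker_eq_bot']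
    rintro ⟨_, v, rfl⟩ hw
    exact Subtype.ext (h v fun i hi => congrFun hw ⟨i, hi⟩)
  exact (LinearMap.finrank_le_finrank_of_injective hinj).trans (by simp)

variable {K : Type*} [Field K] {m n : ℕ} {H : Map K m n}

/-- The derivative of a polynomial along a vector of rational functions. -/
noncomputable def directional (v : Fin n → FractionRing (MvPolynomial (Fin n) K))
    (f : MvPolynomial (Fin n) K) : FractionRing (MvPolynomial (Fin n) K) :=
  ∑ j, algebraMap (MvPolynomial (Fin n) K) _ (pderiv j f) * v j

variable {v : Fin n → FractionRing (MvPolynomial (Fin n) K)}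

theorem directional_C (a : K) : directional v (C a) = 0 := by
  simp [directional]

theorem directional_X (i : Fin n) : directional v (X i) = v i := by
  rw [directional, Finset.sum_eq_single i]
  · simp
  · intro j _ hj
    rw [pderiv_X_of_ne hj.symm, map_zero, zero_mul]
  · simp

theorem directional_add (f g : MvPolynomial (Fin n) K) :
    directional v (f + g) = directional v f + directional v g := by
  simp [directional, add_mul, Finset.sum_add_distrib]

theorem directional_sub (f g : MvPolynomial (Fin n) K) :
    directional v (f - g) = directional v f - directional v g := by
  simp [directional, sub_mul, Finset.sum_sub_distrib]

theorem directional_mul (f g : MvPolynomial (Fin n) K) :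
    directional v (f * g) = algebraMap (MvPolynomial (Fin n) K) _ f * directional v g +
      algebraMap (MvPolynomial (Fin n) K) _ g * directional v f := by
  simp only [directional, pderiv_mul, map_add, map_mul, Finset.mul_sum, ← Finset.sum_add_distrib]
  exact Finset.sum_congr rfl fun j _ => by ring

theorem directional_eq_zero_of_row {i : Fin m} (h : (jacobian H).row i = 0) :
    directional v (H i) = 0 :=
  Finset.sum_eq_zero fun j _ => by
    rw [show pderiv j (H i) = 0 from congrFun h j, map_zero, zero_mul]

theorem jacobianRank_le_card (s : Finset (Fin m))
    (h : ∀ v : Fin n → FractionRing (MvPolynomial (Fin n) K),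
      (∀ i ∈ s, directional v (H i) = 0) → ∀ i, directional v (H i) = 0) :
    jacobianRank H ≤ s.card :=
  rank_le_card_of_forall s fun v hv => funext (h v hv)

theorem algebraMap_X_ne_zero (i : Fin n) :
    algebraMap (MvPolynomial (Fin n) K) (FractionRing (MvPolynomial (Fin n) K)) (X i) ≠ 0 :=
  (map_ne_zero_iff _ (IsFractionRing.injective _ _)).2 (X_ne_zero i)

theorem C_ofNat_two : (C (2 : K) : MvPolynomial (Fin n) K) = 2 := map_ofNat C 2

theorem algebraMap_C_half_mul_two (h2 : (2 : K) ≠ 0) (a : K) :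
    algebraMap (MvPolynomial (Fin n) K) (FractionRing (MvPolynomial (Fin n) K)) (C (a / 2)) * 2 =
      algebraMap (MvPolynomial (Fin n) K) (FractionRing (MvPolynomial (Fin n) K)) (C a) := by
  have h : (C (a / 2) * 2 : MvPolynomial (Fin n) K) = C a := by
    rw [← C_ofNat_two, ← C_mul, div_mul_cancel₀ _ h2]
  rw [← h, map_mul, map_ofNat]

theorem jacobianRank_le_of_onlyFirstRows_four (hm : 4 ≤ m) (hH : OnlyFirstRows 4 H)
    (a b c d : Fin 4) (hcover : ∀ i, i = a ∨ i = b ∨ i = c ∨ i = d)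
    (h : ∀ v : Fin n → FractionRing (MvPolynomial (Fin n) K),
      directional v (H (Fin.castLE hm a)) = 0 → directional v (H (Fin.castLE hm b)) = 0 →
        directional v (H (Fin.castLE hm c)) = 0 → directional v (H (Fin.castLE hm d)) = 0) :
    jacobianRank H ≤ 3 := by
  refine (jacobianRank_le_card {Fin.castLE hm a, Fin.castLE hm b, Fin.castLE hm c}
    fun v hv i => ?_).trans Finset.card_le_three
  have ha := hv (Fin.castLE hm a) (by simp)
  have hb := hv (Fin.castLE hm b) (by simp)
  have hc := hv (Fin.castLE hm c) (by simp)
  by_cases hi : 4 ≤ (i : ℕ)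
  · exact directional_eq_zero_of_row (hH i hi)
  · have hi' : i = Fin.castLE hm ⟨i, by omega⟩ := rfl
    rw [hi']
    rcases hcover ⟨i, by omega⟩ with h' | h' | h' | h' <;> rw [h']
    exacts [ha, hb, hc, h v ha hb hc]

theorem ThreeRows.jacobianRank_le (hH : ThreeRows H) : jacobianRank H ≤ 3 := by
  rcases le_or_gt m 3 with hm | hm
  · exact (Matrix.rank_le_height _).trans hm
  · exact jacobianRank_le_of_onlyFirstRows_four hm (hH.mono (by norm_num)) 0 1 2 3 (by decide)
      fun v _ _ _ => directional_eq_zero_of_row (hH _ le_rfl)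

/-- A direction that kills x₁² and x₂² kills x₁ and x₂, hence also x₁x₂. -/
theorem FourRowsBinary.jacobianRank_le (hH : FourRowsBinary H) : jacobianRank H ≤ 3 := by
  obtain ⟨hc, hrows, hm, hn, h⟩ := hH
  have h2 : (2 : K) ≠ 0 := fun h => hc (two_eq_zero_iff_ringChar.1 h)
  refine jacobianRank_le_of_onlyFirstRows_four hm hrows 0 1 3 2 (by decide) fun v _ h1 h3 => ?_
  have e1 := congrFun h 1
  have e2 := congrFun h 2
  have e3 := congrFun h 3
  simp only [Matrix.cons_val] at e1 e2 e3
  have hz : ∀ i : Fin n, directional v (C (1 / 2) * X i ^ 2) = 0 → v i = 0 := fun i hi => by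
    have hC := algebraMap_C_half_mul_two (n := n) h2 1
    rw [C_1, map_one] at hC
    refine mul_left_cancel₀ (algebraMap_X_ne_zero i) ?_
    rw [directional_mul, directional_C, mul_zero, add_zero, pow_two, directional_mul,
      directional_X] at hi
    linear_combination hi - algebraMap (MvPolynomial (Fin n) K) _ (X i) * v i * hC
  rw [e1] at h1
  rw [e3] at h3
  rw [e2, directional_mul, directional_X, directional_X, hz _ h1, hz _ h3]
  ring

/-- The identity x₁ d(x₂x₃) = x₂ d(x₁x₃) + x₃ d(x₁x₂) - 2x₂x₃ dx₁ loses its last term in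
characteristic 2. -/
theorem FourRowsCharTwo.jacobianRank_le (hH : FourRowsCharTwo H) : jacobianRank H ≤ 3 := by
  obtain ⟨hc, hrows, hm, hn, h⟩ := hH
  have h2 : (2 : K) = 0 := two_eq_zero_iff_ringChar.2 hc
  have hF : (2 : FractionRing (MvPolynomial (Fin n) K)) = 0 := by
    rw [← map_ofNat (algebraMap K _) 2, h2, map_zero]
  refine jacobianRank_le_of_onlyFirstRows_four hm hrows 0 1 2 3 (by decide) fun v _ h1 h3 => ?_
  have hd : ∀ i : Fin 4, directional v (H (Fin.castLE hm i)) = directional v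
      ((![H (Fin.castLE hm 0), X (Fin.castLE hn 0) * X (Fin.castLE hn 1),
        X (Fin.castLE hn 0) * X (Fin.castLE hn 2), X (Fin.castLE hn 1) * X (Fin.castLE hn 2)] :
          Map K 4 n) i) := fun i =>
    Finset.sum_congr rfl fun j _ => by
      congr 2
      exact congrFun (congrFun h i) j
  rw [hd] at h1 h3 ⊢
  simp only [Matrix.cons_val, directional_mul, directional_X] at h1 h3 ⊢
  refine mul_left_cancel₀ (algebraMap_X_ne_zero (Fin.castLE hn 0)) ?_
  linear_combination algebraMap (MvPolynomial (Fin n) K) _ (X (Fin.castLE hn 1)) * h3 +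
    algebraMap (MvPolynomial (Fin n) K) _ (X (Fin.castLE hn 2)) * h1 -
    algebraMap (MvPolynomial (Fin n) K) _ (X (Fin.castLE hn 1)) *
      algebraMap (MvPolynomial (Fin n) K) _ (X (Fin.castLE hn 2)) * v (Fin.castLE hn 0) * hF

/-- The differential of H₁² + cH₂² = 4H₃H₄ expresses dH₄ through the others, because H₃ ≠ 0. -/
theorem Exceptional.jacobianRank_le (hH : Exceptional H) : jacobianRank H ≤ 3 := by
  obtain ⟨hc, hrows, hm, hn, c, hc0, h⟩ := hH
  have h2 : (2 : K) ≠ 0 := fun h => hc (two_eq_zero_iff_ringChar.1 h)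
  refine jacobianRank_le_of_onlyFirstRows_four hm hrows 0 1 2 3 (by decide)
    fun v h0 h1 h3 => ?_
  have hd : ∀ i : Fin 4, directional v (H (Fin.castLE hm i)) = directional v
      ((![X (Fin.castLE hn 0) * X (Fin.castLE hn 2) +
          C c * X (Fin.castLE hn 1) * X (Fin.castLE hn 3),
        X (Fin.castLE hn 1) * X (Fin.castLE hn 2) - X (Fin.castLE hn 0) * X (Fin.castLE hn 3),
        C (1 / 2) * X (Fin.castLE hn 2) ^ 2 + C (c / 2) * X (Fin.castLE hn 3) ^ 2,
        C (1 / 2) * X (Fin.castLE hn 0) ^ 2 + C (c / 2) * X (Fin.castLE hn 1) ^ 2] :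
          Map K 4 n) i) := fun i => by rw [← h]
  have hC1 := algebraMap_C_half_mul_two (n := n) h2 1
  have hCc := algebraMap_C_half_mul_two (n := n) h2 c
  rw [C_1, map_one] at hC1
  rw [hd] at h0 h1 h3 ⊢
  simp only [Matrix.cons_val, directional_mul, directional_X, directional_add, directional_sub,
    directional_C, pow_two, map_mul] at h0 h1 h3 ⊢
  have hne : algebraMap (MvPolynomial (Fin n) K) (FractionRing (MvPolynomial (Fin n) K))
      (X (Fin.castLE hn 2) ^ 2 + C c * X (Fin.castLE hn 3) ^ 2) ≠ 0 := by
    rw [map_ne_zero_iff _ (IsFractionRing.injective _ _)]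
    intro h
    have := congrArg (eval (Pi.single (Fin.castLE hn 2) 1)) h
    simp at this
  simp only [map_add, map_mul, map_pow] at hne
  generalize algebraMap (MvPolynomial (Fin n) K) (FractionRing (MvPolynomial (Fin n) K))
    (C (1 / 2)) = α at *
  generalize algebraMap (MvPolynomial (Fin n) K) (FractionRing (MvPolynomial (Fin n) K))
    (C (c / 2)) = β at *
  generalize algebraMap (MvPolynomial (Fin n) K) (FractionRing (MvPolynomial (Fin n) K))
    (C c) = γ at *
  generalize algebraMap (MvPolynomial (Fin n) K) (FractionRing (MvPolynomial (Fin n) K))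
    (X (Fin.castLE hn 0)) = a0 at *
  generalize algebraMap (MvPolynomial (Fin n) K) (FractionRing (MvPolynomial (Fin n) K))
    (X (Fin.castLE hn 1)) = a1 at *
  generalize algebraMap (MvPolynomial (Fin n) K) (FractionRing (MvPolynomial (Fin n) K))
    (X (Fin.castLE hn 2)) = a2 at *
  generalize algebraMap (MvPolynomial (Fin n) K) (FractionRing (MvPolynomial (Fin n) K))
    (X (Fin.castLE hn 3)) = a3 at *
  have h3' : a2 * v (Fin.castLE hn 2) + γ * a3 * v (Fin.castLE hn 3) = 0 := by
    linear_combination h3 - a2 * v (Fin.castLE hn 2) * hC1 - a3 * v (Fin.castLE hn 3) * hCc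
  have key : a0 * v (Fin.castLE hn 0) + γ * a1 * v (Fin.castLE hn 1) = 0 := by
    refine mul_left_cancel₀ hne ?_
    -- Half the differential of the norm relation; the factor in `hne` is 2H₃.
    linear_combination (a0 * a2 + γ * a1 * a3) * h0 + γ * (a1 * a2 - a0 * a3) * h1 -
      (a0 ^ 2 + γ * a1 ^ 2) * h3'
  linear_combination key + a0 * v (Fin.castLE hn 0) * hC1 + a1 * v (Fin.castLE hn 1) * hCc

theorem transpose_mulVec_apply_of_col {j : Fin n} (h : (jacobian H).col j = 0)
    (w : Fin m → FractionRing (MvPolynomial (Fin n) K)) :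
    ((jacobian H).map (algebraMap (MvPolynomial (Fin n) K)
      (FractionRing (MvPolynomial (Fin n) K)))).transpose.mulVec w j = 0 := by
  rw [Matrix.mulVec, dotProduct]
  refine Finset.sum_eq_zero fun i _ => ?_
  rw [Matrix.transpose_apply, Matrix.map_apply, show jacobian H i j = 0 from congrFun h i,
    map_zero, zero_mul]

theorem jacobianRank_le_of_onlyFirstCols_four (hn : 4 ≤ n) (hH : OnlyFirstCols 4 H)
    (h : ∀ w : Fin m → FractionRing (MvPolynomial (Fin n) K),
      (∀ j, j ≠ Fin.castLE hn 3 → ((jacobian H).map (algebraMap (MvPolynomial (Fin n) K)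
        (FractionRing (MvPolynomial (Fin n) K)))).transpose.mulVec w j = 0) →
      ((jacobian H).map (algebraMap (MvPolynomial (Fin n) K)
        (FractionRing (MvPolynomial (Fin n) K)))).transpose.mulVec w (Fin.castLE hn 3) = 0) :
    jacobianRank H ≤ 3 := by
  rw [jacobianRank, ← Matrix.rank_transpose]
  refine (rank_le_card_of_forall {Fin.castLE hn 0, Fin.castLE hn 1, Fin.castLE hn 2}
    fun w hw => ?_).trans Finset.card_le_three
  have h3 : ∀ j, j ≠ Fin.castLE hn 3 → ((jacobian H).map (algebraMap (MvPolynomial (Fin n) K)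
      (FractionRing (MvPolynomial (Fin n) K)))).transpose.mulVec w j = 0 := fun j hj => by
    by_cases hj4 : 4 ≤ (j : ℕ)
    · exact transpose_mulVec_apply_of_col (hH j hj4) w
    · refine hw j ?_
      simp only [Finset.mem_insert, Finset.mem_singleton, Fin.ext_iff, Fin.val_castLE, ne_eq]
        at hj ⊢
      norm_num at hj ⊢
      omega
  ext1 j
  by_cases hj : j = Fin.castLE hn 3
  · rw [hj]
    exact h w h3
  · exact h3 j hj

theorem FewCols.jacobianRank_le (hH : FewCols 3 H) : jacobianRank H ≤ 3 := by
  rcases le_or_gt n 3 with hn | hn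
  · exact (Matrix.rank_le_width _).trans hn
  · exact jacobianRank_le_of_onlyFirstCols_four hn (fun j hj => hH.2 j (by omega))
      fun w _ => transpose_mulVec_apply_of_col (hH.2 _ le_rfl) w

/-- Euler's identity ∑ xⱼ ∂ⱼH = 2H = 0 is a linear relation among the four columns, with coefficient
x₄ ≠ 0 at the last. -/
theorem FewColsCharTwo.jacobianRank_le (hq : IsQuadraticHomogeneous H)
    (hH : FewColsCharTwo 3 H) : jacobianRank H ≤ 3 := by
  rcases le_or_gt n 3 with hn | hn
  · exact (Matrix.rank_le_width _).trans hn
  refine jacobianRank_le_of_onlyFirstCols_four hn hH.2 fun w hw => ?_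
  have h2 : (2 : K) = 0 := two_eq_zero_iff_ringChar.2 hH.1
  have hE : ∀ i, ∑ j, X j * pderiv j (H i) = 0 := fun i => by
    rw [(hq i).sum_X_mul_pderiv, nsmul_eq_mul, Nat.cast_ofNat, ← C_ofNat_two, h2, C_0, zero_mul]
  have hs : ∑ j, algebraMap (MvPolynomial (Fin n) K) (FractionRing (MvPolynomial (Fin n) K)) (X j) *
      ((jacobian H).map (algebraMap (MvPolynomial (Fin n) K)
        (FractionRing (MvPolynomial (Fin n) K)))).transpose.mulVec w j = 0 := by
    simp only [Matrix.mulVec, dotProduct, Matrix.transpose_apply, Matrix.map_apply, Finset.mul_sum]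
    rw [Finset.sum_comm]
    refine Finset.sum_eq_zero fun i _ => ?_
    simp only [← mul_assoc, ← map_mul, ← Finset.sum_mul, ← map_sum]
    rw [show ∑ j, X j * jacobian H i j = 0 from hE i, map_zero, zero_mul]
  rw [Finset.sum_eq_single (Fin.castLE hn 3) (fun j _ hj => by rw [hw j hj, mul_zero])
    (by simp)] at hs
  exact (mul_eq_zero.1 hs).resolve_left (algebraMap_X_ne_zero _)

end

end PolyMap

open PolyMap
theorem mainTheorem4 {K : Type*} [Field K] {m n : ℕ} :
    (∀ H : PolyMap.Map K m n, IsQuadraticHomogeneous H → jacobianRank H = 3 →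
      ∃ (S : Matrix.GeneralLinearGroup (Fin m) K) (T : Matrix.GeneralLinearGroup (Fin n) K),
        let H' : PolyMap.Map K m n :=
          transform (S : Matrix (Fin m) (Fin m) K) (T : Matrix (Fin n) (Fin n) K) H
        ThreeRows H' ∨
        FourRowsBinary H' ∨
        FourRowsCharTwo H' ∨
        (OnlyFirstRows 6 H' ∧
          ((FewCols 3 H' ∧ FirstColsNonzero 3 H') ∨
            (FewColsCharTwo 3 H' ∧ FirstColsNonzero 4 H'))) ∨
        Exceptional H') ∧
    (∀ H' : PolyMap.Map K m n, IsQuadraticHomogeneous H' →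
      (ThreeRows H' ∨ FourRowsBinary H' ∨ FourRowsCharTwo H' ∨
        (FewCols 3 H' ∨ FewColsCharTwo 3 H') ∨ Exceptional H') →
      jacobianRank H' ≤ 3) := by
  refine ⟨fun H hH hr => exists_normal_form hH hr, fun H' hq h => ?_⟩
  rcases h with h | h | h | (h | h) | h
  · exact h.jacobianRank_le
  · exact h.jacobianRank_le
  · exact h.jacobianRank_le
  · exact h.jacobianRank_le
  · exact h.jacobianRank_le hq
  · exact h.jacobianRank_le
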